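/- Let $\gamma=(1+\sqrt5)/2$ and let $\lambda_3\cong 0.4245$ be the smallest positive root of $T^2-\gamma^3T+\gamma$. For $\mathbf{x}=(x_0,\dots,x_3)\in\mathbb{Z}^4$ put $\|\mathbf{x}\|=\max_{0\le k\le 3}|x_k|$. Let $\xi\in\mathbb{R}$ with $[\mathbb{Q}(\xi):\mathbb{Q}]>3$ and put $L(\mathbf{x})=\max_{1\le k\le 3}|x_0\xi^k-x_k|$. Let $\lambda>0$ be a real number such that, for some constant $c>0$, the inequalities $|x_0|\le X$ and $L(\mathbf{x})\le cX^{-\lambda}$ have a non-zero solution $\mathbf{x}\in\mathbb{Z}^4$ for each sufficiently large real number $X$. Put $\theta=(1-\lambda)/\lambda$. Let $(\mathbf{x}_i)_{i\ge1}$ be a sequence of minimal points for $\xi$, that is, a sequence of non-zero points of $\mathbb{Z}^4$ such that the norms $X_i=\|\mathbf{x}_i\|$ are strictly increasing, the numbers $L_i=L(\mathbf{x}_i)$ are strictly decreasing, and every non-zero $\mathbf{x}\in\mathbb{Z}^4$ with $L(\mathbf{x})<L_i$ for some $i\ge1$ has $\|\mathbf{x}\|\ge X_{i+1}$. For $i\ge2$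 let $W_i=\langle\mathbf{x}_{i-1},\mathbf{x}_i\rangle_{\mathbb{R}}$ and $U_i=W_i+W_{i+1}$. Let $I$ be the set of integers $i\ge 2$ with $W_i\ne W_{i+1}$, and let $J$ be the set of $i\in I$ with $U_i\neq U_j$, where $j$ is the successor of $i$ in $I$ (the smallest element of $I$ larger than $i$). Elements $i<j$ of $I$ are consecutive if $j$ is the successor of $i$ in $I$. The height of a subspace $V$ of $\mathbb{R}^4$ defined over $\mathbb{Q}$ is $H(V)=\|\mathbf{y}_1\wedge\cdots\wedge\mathbf{y}_p\|$, the maximum absolute value of the Grassmann coordinates, for any basis $(\mathbf{y}_1,\dots,\mathbf{y}_p)$ of $V\cap\mathbb{Z}^4$ over $\mathbb{Z}$. The implied constants in $\ll$ and $\asymp$, as well as the meaning of "large enough", depend only on $\xi$ and $\lambda$. Suppose that $\lambda\ge\lambda_3$. Then $\lambda=\lambda_3$, and there are infinitely many sequences of consecutive elements $g<h<i<j$ of $I$ with $h\notin J$ and $i\in J$. For each of them, we have \[ \begin{array}{llll} X_{g+1}\asymp X_h, & X_{h+1}\asymp X_i\asymp X_h^{\theta}, & X_{i+1}\asymp X_j\asymp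 X_i^{\gamma/\theta}, & X_{j+1}\asymp X_j^{\theta},\\ L_g\asymp X_{g+1}^{-\lambda}, & L_h\asymp X_{h+1}^{-\lambda}, & L_i\asymp X_{i+1}^{-\lambda}, & L_j\asymp X_{j+1}^{-\lambda}, \end{array} \] and $H(U_h)\asymp X_{h+1}^{\lambda/\gamma}$. If $h$ is large enough, we also have $g\in J$ and $X_g\ll X_h^{\theta/\gamma}$. -/

import Mathlib

open Filter
open scoped IntermediateField goldenRatio

noncomputable section

namespace CubicApprox

/-- The real number `λ₃ ≅ 0.4245`: the smallest positive root of `T² - γ³ T + γ`, where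
`γ = (1 + √5) / 2` is the golden ratio. -/
def lambda3 : ℝ := sInf {t : ℝ | 0 < t ∧ t ^ 2 - φ ^ 3 * t + φ = 0}

/-- The set in the definition of `lambda3` does have a least element. -/
theorem isLeast_lambda3 : IsLeast {t : ℝ | 0 < t ∧ t ^ 2 - φ ^ 3 * t + φ = 0} lambda3 := by
  have hfin : {t : ℝ | 0 < t ∧ t ^ 2 - φ ^ 3 * t + φ = 0}.Finite := by
    have hd : 0 ≤ φ ^ 6 - 4 * φ := by
      have h6 : φ ^ 6 = 8 * φ + 5 := by
        linear_combination (φ ^ 4 + φ ^ 3 + 2 * φ ^ 2 + 3 * φ + 5) * Real.goldenRatio_sq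
      linarith [Real.one_lt_goldenRatio]
    refine Set.Finite.subset (Set.toFinite
      {(φ ^ 3 + √(φ ^ 6 - 4 * φ)) / 2, (φ ^ 3 - √(φ ^ 6 - 4 * φ)) / 2}) ?_
    rintro t ⟨-, ht⟩
    have hs := Real.sq_sqrt hd
    have : (t - (φ ^ 3 + √(φ ^ 6 - 4 * φ)) / 2) * (t - (φ ^ 3 - √(φ ^ 6 - 4 * φ)) / 2) = 0 := by
      linear_combination ht - hs / 4
    rcases mul_eq_zero.1 this with h | h
    · exact Or.inl (by linarith)
    · exact Or.inr (by simp only [Set.mem_singleton_iff]; linarith)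
  have hne : {t : ℝ | 0 < t ∧ t ^ 2 - φ ^ 3 * t + φ = 0}.Nonempty := by
    have h1 := Real.one_lt_goldenRatio
    have h3 : φ ^ 3 = 2 * φ + 1 := by
      linear_combination (φ + 1) * Real.goldenRatio_sq
    have hc : ContinuousOn (fun t : ℝ => t ^ 2 - φ ^ 3 * t + φ) (Set.Icc 0 1) := by fun_prop
    obtain ⟨t, ht, h⟩ := intermediate_value_Icc' zero_le_one hc
      (show (0 : ℝ) ∈ _ from ⟨by linarith, by linarith⟩)
    refine ⟨t, lt_of_le_of_ne ht.1 ?_, h⟩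
    rintro rfl
    simp only at h
    linarith
  exact ⟨hne.csInf_mem hfin, fun t ht => csInf_le hfin.bddBelow ht⟩

/-! ### Heights of subspaces -/

/-- The inclusion `ℤⁿ → ℝⁿ`. -/
def toReal (n : ℕ) : (Fin n → ℤ) →ₗ[ℤ] (Fin n → ℝ) :=
  (Int.castAddHom ℝ).toIntLinearMap.compLeft (Fin n)

/-- The maximum norm `‖y₁ ∧ ⋯ ∧ y_p‖`: the largest absolute value of a Grassmann coordinate,
i.e. of a maximal minor of the `p × n` matrix with rows `y₁, …, y_p`. -/
def wedgeNorm {p n : ℕ} (y : Fin p → Fin n → ℝ) : ℝ :=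
  ⨆ e : Fin p ↪o Fin n, |(Matrix.of fun r s => y r (e s)).det|

/-- The group `V ∩ ℤⁿ`, for a subspace `V` of `ℝⁿ`. -/
def latticePoints {n : ℕ} (V : Submodule ℝ (Fin n → ℝ)) : Submodule ℤ (Fin n → ℤ) :=
  (V.restrictScalars ℤ).comap (toReal n)

/-- The height `H(V) = ‖y₁ ∧ ⋯ ∧ y_p‖` of a subspace `V` of `ℝⁿ` defined over `ℚ`, where
`(y₁, …, y_p)` is a basis of `V ∩ ℤⁿ` over `ℤ`. -/
def height {n : ℕ} (V : Submodule ℝ (Fin n → ℝ)) : ℝ :=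
  wedgeNorm fun r => toReal n (Module.finBasis ℤ (latticePoints V) r)

/-- The height can be computed from any basis of `V ∩ ℤⁿ` over `ℤ`. -/
theorem height_eq {n p : ℕ} (V : Submodule ℝ (Fin n → ℝ))
    (b : Module.Basis (Fin p) ℤ (latticePoints V)) :
    height V = wedgeNorm fun r => toReal n (b r) := by
  obtain rfl : Module.finrank ℤ (latticePoints V) = p := by
    simpa using Module.finrank_eq_card_basis b
  unfold height wedgeNorm
  congr 1
  funext e
  set b' := Module.finBasis ℤ (latticePoints V)
  have key : (Matrix.of fun r s => toReal n (b' r) (e s)) =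
      ((b.toMatrix b').transpose.map (Int.castRingHom ℝ)) *
        (Matrix.of fun r s => toReal n (b r) (e s)) := by
    ext r s
    rw [Matrix.mul_apply]
    have h := congrArg (fun v : latticePoints V => (v : Fin n → ℤ) (e s))
      (b.sum_toMatrix_smul_self b' r)
    simp only [Submodule.coe_sum, Finset.sum_apply, Submodule.coe_smul, Pi.smul_apply,
      smul_eq_mul] at h
    have h' := congrArg (fun z : ℤ => (z : ℝ)) h
    simp only [Int.cast_sum, Int.cast_mul] at h'
    exact h'.symm
  have hu : IsUnit (b.toMatrix b').det := by
    refine (Matrix.isUnit_iff_isUnit_det _).1 ?_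
    exact Units.isUnit ⟨_, _, b.toMatrix_mul_toMatrix_flip b', b'.toMatrix_mul_toMatrix_flip b⟩
  have hd : |(((b.toMatrix b').transpose.map (Int.castRingHom ℝ)).det)| = 1 := by
    rw [← RingHom.mapMatrix_apply, ← RingHom.map_det, Matrix.det_transpose, eq_intCast,
      ← Int.cast_abs, Int.isUnit_iff_abs_eq.1 hu, Int.cast_one]
  rw [key, Matrix.det_mul, abs_mul, hd, one_mul]

/-! ### Minimal points -/

/-- `L(x) = max_{1 ≤ k ≤ 3} |x₀ ξᵏ - x_k|` for a point `x` of `ℤ⁴` (the norm on `ℝ³` here is the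
maximum norm). -/
def L (ξ : ℝ) (x : Fin 4 → ℤ) : ℝ :=
  ‖fun k : Fin 3 => (x 0 : ℝ) * ξ ^ ((k : ℕ) + 1) - (x k.succ : ℝ)‖

/-- For some constant `c > 0`, the inequalities `|x₀| ≤ X`, `L(x) ≤ c X^{-λ}` have a non-zero
solution `x ∈ ℤ⁴` for each sufficiently large real number `X`. -/
def UniformlyApproximable (ξ lam : ℝ) : Prop :=
  ∃ c : ℝ, 0 < c ∧ ∀ᶠ X : ℝ in atTop,
    ∃ x : Fin 4 → ℤ, x ≠ 0 ∧ |(x 0 : ℝ)| ≤ X ∧ L ξ x ≤ c * X ^ (-lam)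

/-- `(x i)_{i ≥ 1}` is a sequence of minimal points for `ξ` in `ℤ⁴` (the value `x 0` plays no
role). The norm on `ℤ⁴` is the maximum norm. -/
structure IsMinimalSeq (ξ : ℝ) (x : ℕ → Fin 4 → ℤ) : Prop where
  ne_zero : ∀ i, 1 ≤ i → x i ≠ 0
  norm_lt : ∀ i, 1 ≤ i → ‖x i‖ < ‖x (i + 1)‖
  L_lt : ∀ i, 1 ≤ i → L ξ (x (i + 1)) < L ξ (x i)
  minimal : ∀ i, 1 ≤ i → ∀ y : Fin 4 → ℤ, y ≠ 0 → L ξ y < L ξ (x i) → ‖x (i + 1)‖ ≤ ‖y‖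

/-- `W_i = ⟨x_{i-1}, x_i⟩`, for `i ≥ 2`. -/
def W (x : ℕ → Fin 4 → ℤ) (i : ℕ) : Submodule ℝ (Fin 4 → ℝ) :=
  Submodule.span ℝ {toReal 4 (x (i - 1)), toReal 4 (x i)}

/-- `U_i = W_i + W_{i+1}`. -/
def U (x : ℕ → Fin 4 → ℤ) (i : ℕ) : Submodule ℝ (Fin 4 → ℝ) := W x i ⊔ W x (i + 1)

/-- The set `I` of all `i ≥ 2` with `W_i ≠ W_{i+1}`. -/
def I (x : ℕ → Fin 4 → ℤ) : Set ℕ := {i | 2 ≤ i ∧ W x i ≠ W x (i + 1)}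

/-- `i < j` are consecutive elements of `I`, i.e. `j` is the successor of `i` in `I`. -/
def Consecutive (x : ℕ → Fin 4 → ℤ) (i j : ℕ) : Prop :=
  i ∈ I x ∧ IsLeast {k | k ∈ I x ∧ i < k} j

/-- The set `J` of all `i ∈ I` with `U_i ≠ U_j`, where `j` is the successor of `i` in `I`. -/
def J (x : ℕ → Fin 4 → ℤ) : Set ℕ := {i | i ∈ I x ∧ ∃ j, Consecutive x i j ∧ U x i ≠ U x j}

/-- `g < h < i < j` are consecutive elements of `I` with `h ∉ J` and `i ∈ J`. -/
def IsRun (x : ℕ → Fin 4 → ℤ) (g h i j : ℕ) : Prop :=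
  Consecutive x g h ∧ Consecutive x h i ∧ Consecutive x i j ∧ h ∉ J x ∧ i ∈ J x

/-- `a ≍ b` with implied constant `K`. -/
def Asymp (K a b : ℝ) : Prop := a ≤ K * b ∧ b ≤ K * a

end CubicApprox

end

open CubicApprox

/-!
Write `X_i = ‖x_i‖`, `L_i = L(x_i)`. All constants below are uniform in the sequence of minimal
points, and all estimates are proved for logarithms, where they become linear inequalities with a
bounded error.

*Linear forms.* If an integer linear form `q` vanishes at `z`, its value at another point `y` is
`≪ ‖q‖ (L(y) + ‖y‖ L(z) / ‖z‖)` (`abs_dot_mul_norm_le`), while a non-zero value is at least `1` in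
absolute value. Applied to a normal vector of `U_i`, this gives for consecutive `i < j` with
`i ∈ J` the bound `X_j ≪ H(U_i) X_{j+1} L_j` (`IsMinimalSeq.logN_le_of_mem_J`). Applied to cross
products, it gives `H(U_h) ≪ X_{m+1} L_m X_{h+1} L_h / X_h` whenever `W_h` is spanned by `x_m` and
`x_{m+1}` (`IsMinimalSeq.log_height_le`).

*Recurrences.* With `x⁻ = (x₀, x₁, x₂)` and `x⁺ = (x₁, x₂, x₃)`, the integer vector
`hankel x = x⁻ × x⁺` has norm `≪ ‖x‖ L(x)`, and for every `y` the pair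
`(hankel x · y⁻, hankel x · y⁺)` is an integer approximation to the direction `(1, ξ)`. If the pair
attached to `x = x_i` and `y = x_{i-1}` is not zero, then `X_{i+1} ≪ X_i ^ θ`. It can only vanish
if both points satisfy the same linear recurrence of order two, which is excluded for the relevant
planes as the Plücker coordinates of the plane of all solutions of a recurrence are quadratic in
its coefficients (`ApproxBound.exists_eq_zero_of_recurs`). So `X_{i+1} ≪ X_i ^ θ` for all `i ∈ I`
(`ApproxBound.exists_logN_succ_le`).

*The complement of `J`.* If all large elements of `I` were in `J`, the growth of the `X_i` would
force the approximations attached to consecutive pairs `(x_i, x_{i+1})`, `i ∈ I`, to be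
proportional, since their determinants are integers that tend to zero. But they converge to the
direction `(1, ξ)`, and `ξ` is irrational (`ApproxBound.exists_notMem_J`). Since `J` is infinite as
well, there are runs `g < h < i < j` with `h ∉ J` and `i ∈ J` arbitrarily far.

*Runs.* As `h ∉ J`, the spaces `U_h` and `U_i` coincide, so that the height `H = H(U_h)` is bounded
from below by the first estimate at `(i, j)`, and from above by the second one in two ways, at
`(g, h)` and at `(h, i)`. Eliminating `H` and `X_j` gives `X_{h+1} ^ δ ≪ 1` with
`δ = (θ - u) - u² / θ`, `u = θ² - 1`, where `δ > 0` if `u < θ / φ`, that is, if `λ > λ₃`. Hence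
`λ = λ₃` and `δ = 0`, in which case all the estimates used have to be sharp up to bounded factors
(`slack_bounded`, `run_slack`). This is the list of relations claimed for a run. Since `λ` may be
decreased in the hypothesis, it suffices to treat `λ₃ ≤ λ ≤ 3/7`, where `4/3 ≤ θ ≤ 1.356`.
-/

open scoped Matrix

namespace CubicApprox

/-! ### Integer points and the functional `L` -/

/-- A constant that bounds `|ξ| ^ k` for `k ≤ 3`. -/
noncomputable def powBound (ξ : ℝ) : ℝ := (1 + |ξ|) ^ 3

theorem one_le_powBound (ξ : ℝ) : 1 ≤ powBound ξ :=
  one_le_pow₀ (by linarith [abs_nonneg ξ])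

theorem abs_pow_le_powBound (ξ : ℝ) (k : Fin 4) : |ξ ^ (k : ℕ)| ≤ powBound ξ := by
  rw [abs_pow]
  calc |ξ| ^ (k : ℕ) ≤ (1 + |ξ|) ^ (k : ℕ) :=
        pow_le_pow_left₀ (abs_nonneg _) (by linarith) _
    _ ≤ (1 + |ξ|) ^ 3 :=
        pow_le_pow_right₀ (by linarith [abs_nonneg ξ]) (by omega)

theorem abs_coord_le (x : Fin 4 → ℤ) (k : Fin 4) : |(x k : ℝ)| ≤ ‖x‖ := by
  rw [← Int.norm_eq_abs]; exact norm_le_pi_norm x k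

theorem norm_le_of_coord {n : ℕ} {x : Fin n → ℤ} {r : ℝ} (hr : 0 ≤ r)
    (h : ∀ k, |(x k : ℝ)| ≤ r) : ‖x‖ ≤ r :=
  (pi_norm_le_iff_of_nonneg hr).2 fun k => by rw [Int.norm_eq_abs]; exact h k

theorem one_le_norm {x : Fin 4 → ℤ} (hx : x ≠ 0) : 1 ≤ ‖x‖ := by
  obtain ⟨k, hk⟩ := Function.ne_iff.1 hx
  refine le_trans ?_ (abs_coord_le x k)
  exact_mod_cast Int.one_le_abs hk

/-- The norm of an integer point is an integer. -/
theorem exists_norm_eq (x : Fin 4 → ℤ) : ∃ n : ℕ, ‖x‖ = n := by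
  obtain ⟨k, -, hk⟩ := Finset.exists_mem_eq_sup' (s := (Finset.univ : Finset (Fin 4)))
    ⟨0, Finset.mem_univ _⟩ (fun k => ‖x k‖)
  refine ⟨(x k).natAbs, ?_⟩
  have h1 : ‖x‖ = ‖x k‖ := by
    apply le_antisymm
    · refine (pi_norm_le_iff_of_nonneg (norm_nonneg _)).2 fun l => ?_
      rw [← hk]
      exact Finset.le_sup' (fun k => ‖x k‖) (Finset.mem_univ l)
    · exact norm_le_pi_norm x k
  rw [h1, Int.norm_eq_abs, Nat.cast_natAbs, Int.cast_abs]

theorem norm_add_one_le {x y : Fin 4 → ℤ} (h : ‖x‖ < ‖y‖) : ‖x‖ + 1 ≤ ‖y‖ := by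
  obtain ⟨m, hm⟩ := exists_norm_eq x
  obtain ⟨n, hn⟩ := exists_norm_eq y
  rw [hm, hn] at h ⊢
  exact_mod_cast h

theorem L_nonneg (ξ : ℝ) (x : Fin 4 → ℤ) : 0 ≤ L ξ x := norm_nonneg _

theorem abs_sub_le_L (ξ : ℝ) (x : Fin 4 → ℤ) (k : Fin 4) :
    |(x 0 : ℝ) * ξ ^ (k : ℕ) - x k| ≤ L ξ x := by
  refine Fin.cases ?_ (fun k => ?_) k
  · simpa using L_nonneg ξ x
  · have := norm_le_pi_norm (fun k : Fin 3 => (x 0 : ℝ) * ξ ^ ((k : ℕ) + 1) - (x k.succ : ℝ)) k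
    simpa [L] using this

theorem L_le_of {ξ : ℝ} {x : Fin 4 → ℤ} {r : ℝ} (hr : 0 ≤ r)
    (h : ∀ k : Fin 4, |(x 0 : ℝ) * ξ ^ (k : ℕ) - x k| ≤ r) : L ξ x ≤ r :=
  (pi_norm_le_iff_of_nonneg hr).2 fun k => by simpa using h k.succ

theorem L_add_le (ξ : ℝ) (x y : Fin 4 → ℤ) : L ξ (x + y) ≤ L ξ x + L ξ y := by
  refine L_le_of (add_nonneg (L_nonneg _ _) (L_nonneg _ _)) fun k => ?_
  have h : (((x + y) 0 : ℤ) : ℝ) * ξ ^ (k : ℕ) - ((x + y) k : ℤ) =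
      ((x 0 : ℝ) * ξ ^ (k : ℕ) - x k) + ((y 0 : ℝ) * ξ ^ (k : ℕ) - y k) := by
    simp only [Pi.add_apply, Int.cast_add]; ring
  rw [h]
  exact (abs_add_le _ _).trans (add_le_add (abs_sub_le_L ξ x k) (abs_sub_le_L ξ y k))

theorem L_neg (ξ : ℝ) (x : Fin 4 → ℤ) : L ξ (-x) = L ξ x := by
  unfold L
  rw [← norm_neg]
  congr 1
  funext k
  simp only [Pi.neg_apply, Int.cast_neg]; ring

theorem L_sub_le (ξ : ℝ) (x y : Fin 4 → ℤ) : L ξ (x - y) ≤ L ξ x + L ξ y := by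
  rw [sub_eq_add_neg, ← L_neg ξ y]; exact L_add_le ξ x (-y)

theorem norm_le_mul_abs_add_L (ξ : ℝ) (x : Fin 4 → ℤ) :
    ‖x‖ ≤ powBound ξ * |(x 0 : ℝ)| + L ξ x := by
  have hM := one_le_powBound ξ
  refine norm_le_of_coord (by positivity [L_nonneg ξ x]) fun k => ?_
  have h1 := abs_sub_le_L ξ x k
  have h2 := abs_pow_le_powBound ξ k
  have h3 : (x k : ℝ) = x 0 * ξ ^ (k : ℕ) - (x 0 * ξ ^ (k : ℕ) - x k) := by ring
  calc |(x k : ℝ)| ≤ |(x 0 : ℝ) * ξ ^ (k : ℕ)| + |(x 0 : ℝ) * ξ ^ (k : ℕ) - x k| := by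
        conv_lhs => rw [h3]
        exact abs_sub _ _
    _ ≤ powBound ξ * |(x 0 : ℝ)| + L ξ x := by
        rw [abs_mul, mul_comm (powBound ξ)]
        gcongr

/-- Two consecutive coordinates of a point are almost in the ratio `ξ`. -/
theorem abs_succ_sub_mul_le (ξ : ℝ) (x : Fin 4 → ℤ) (k : Fin 3) :
    |(x k.succ : ℝ) - ξ * x k.castSucc| ≤ 2 * powBound ξ * L ξ x := by
  have hM := one_le_powBound ξ
  have h1 := abs_sub_le_L ξ x k.succ
  have h2 := abs_sub_le_L ξ x k.castSucc
  have h3 := abs_pow_le_powBound ξ 1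
  have hL := L_nonneg ξ x
  have h4 : (x k.succ : ℝ) - ξ * x k.castSucc =
      ξ * (x 0 * ξ ^ ((k.castSucc : Fin 4) : ℕ) - x k.castSucc)
        - (x 0 * ξ ^ ((k.succ : Fin 4) : ℕ) - x k.succ) := by
    simp only [Fin.val_succ, Fin.val_castSucc, pow_succ]; ring
  rw [h4]
  refine (abs_sub _ _).trans ?_
  rw [abs_mul]
  have h5 : |ξ| ≤ powBound ξ := by simpa using h3
  have : |ξ| * |(x 0 : ℝ) * ξ ^ ((k.castSucc : Fin 4) : ℕ) - x k.castSucc| ≤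
      powBound ξ * L ξ x := mul_le_mul h5 h2 (abs_nonneg _) (by linarith)
  nlinarith

theorem abs_dot_sub_le (ξ : ℝ) (q y : Fin 4 → ℤ) :
    |(y 0 : ℝ) * ∑ k, (q k : ℝ) * ξ ^ (k : ℕ) - ((q ⬝ᵥ y : ℤ) : ℝ)| ≤ 4 * ‖q‖ * L ξ y := by
  have h : (y 0 : ℝ) * ∑ k, (q k : ℝ) * ξ ^ (k : ℕ) - ((q ⬝ᵥ y : ℤ) : ℝ) =
      ∑ k, (q k : ℝ) * ((y 0 : ℝ) * ξ ^ (k : ℕ) - y k) := by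
    simp only [dotProduct, Int.cast_sum, Int.cast_mul, Finset.mul_sum, ← Finset.sum_sub_distrib]
    exact Finset.sum_congr rfl fun k _ => by ring
  rw [h]
  refine (Finset.abs_sum_le_sum_abs _ _).trans ?_
  calc ∑ k, |(q k : ℝ) * ((y 0 : ℝ) * ξ ^ (k : ℕ) - y k)| ≤ ∑ _k : Fin 4, ‖q‖ * L ξ y := by
        refine Finset.sum_le_sum fun k _ => ?_
        rw [abs_mul]
        exact mul_le_mul (abs_coord_le q k) (abs_sub_le_L ξ y k) (abs_nonneg _) (norm_nonneg _)
    _ = 4 * ‖q‖ * L ξ y := by simp; ring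

/-- The basic estimate: an integer linear form that vanishes at a point `z` close to the line
spanned by `(1, ξ, ξ², ξ³)` is small at every other point close to this line. All upper bounds for
determinants come from this one. -/
theorem abs_dot_mul_norm_le (ξ : ℝ) (q y z : Fin 4 → ℤ) (hz : q ⬝ᵥ z = 0) :
    |((q ⬝ᵥ y : ℤ) : ℝ)| * ‖z‖ ≤
      8 * powBound ξ * ‖q‖ * (L ξ y * ‖z‖ + ‖y‖ * L ξ z) := by
  have hM := one_le_powBound ξ
  set e := ∑ k, (q k : ℝ) * ξ ^ (k : ℕ)
  have h1 := abs_dot_sub_le ξ q y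
  have h2 := abs_dot_sub_le ξ q z
  rw [hz, Int.cast_zero, sub_zero, abs_mul] at h2
  have h3 := norm_le_mul_abs_add_L ξ z
  have h4 : |e| ≤ 4 * powBound ξ * ‖q‖ := by
    refine (Finset.abs_sum_le_sum_abs _ _).trans ?_
    calc ∑ k, |(q k : ℝ) * ξ ^ (k : ℕ)| ≤ ∑ _k : Fin 4, ‖q‖ * powBound ξ := by
          refine Finset.sum_le_sum fun k _ => ?_
          rw [abs_mul]
          exact mul_le_mul (abs_coord_le q k) (abs_pow_le_powBound ξ k) (abs_nonneg _)
            (norm_nonneg _)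
      _ = 4 * powBound ξ * ‖q‖ := by simp; ring
  have h5 : |((q ⬝ᵥ y : ℤ) : ℝ)| ≤ |(y 0 : ℝ)| * |e| + 4 * ‖q‖ * L ξ y := by
    rw [← abs_mul]
    have := abs_sub_abs_le_abs_sub ((q ⬝ᵥ y : ℤ) : ℝ) ((y 0 : ℝ) * e)
    rw [abs_sub_comm] at this
    linarith
  have h6 : |e| * ‖z‖ ≤ 8 * powBound ξ * ‖q‖ * L ξ z := by
    have hLz := L_nonneg ξ z
    calc |e| * ‖z‖ ≤ |e| * (powBound ξ * |(z 0 : ℝ)| + L ξ z) := by gcongr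
      _ = powBound ξ * (|(z 0 : ℝ)| * |e|) + |e| * L ξ z := by ring
      _ ≤ powBound ξ * (4 * ‖q‖ * L ξ z) + 4 * powBound ξ * ‖q‖ * L ξ z := by gcongr
      _ = _ := by ring
  have hLy := L_nonneg ξ y
  calc |((q ⬝ᵥ y : ℤ) : ℝ)| * ‖z‖ ≤ (|(y 0 : ℝ)| * |e| + 4 * ‖q‖ * L ξ y) * ‖z‖ := by gcongr
    _ = |(y 0 : ℝ)| * (|e| * ‖z‖) + 4 * 1 * ‖q‖ * (L ξ y * ‖z‖) := by ring
    _ ≤ ‖y‖ * (8 * powBound ξ * ‖q‖ * L ξ z) + 8 * powBound ξ * ‖q‖ * (L ξ y * ‖z‖) := by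
        have := abs_coord_le y 0
        have h7 : (0 : ℝ) ≤ ‖q‖ * (L ξ y * ‖z‖) := by positivity
        gcongr
        linarith
    _ = _ := by ring

/-- The estimate `abs_dot_mul_norm_le` at a point farther out and closer to the line than the
zero of the linear form. -/
theorem abs_dot_mul_norm_le_of_le {ξ : ℝ} {q y z : Fin 4 → ℤ} (hz : q ⬝ᵥ z = 0)
    (hL : L ξ y ≤ L ξ z) (hn : ‖z‖ ≤ ‖y‖) :
    |((q ⬝ᵥ y : ℤ) : ℝ)| * ‖z‖ ≤ 16 * powBound ξ * ‖q‖ * (‖y‖ * L ξ z) := by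
  have hM := one_le_powBound ξ
  refine (abs_dot_mul_norm_le ξ q y z hz).trans ?_
  have : L ξ y * ‖z‖ ≤ ‖y‖ * L ξ z := by
    rw [mul_comm]; exact mul_le_mul hn hL (L_nonneg _ _) (norm_nonneg _)
  calc 8 * powBound ξ * ‖q‖ * (L ξ y * ‖z‖ + ‖y‖ * L ξ z)
      ≤ 8 * powBound ξ * ‖q‖ * (‖y‖ * L ξ z + ‖y‖ * L ξ z) := by gcongr
    _ = _ := by ring

/-- The estimate `abs_dot_mul_norm_le` at a point nearer to the origin and farther from the line
than the zero of the linear form. -/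
theorem abs_dot_le_of_le {ξ : ℝ} {q y z : Fin 4 → ℤ} (hz0 : z ≠ 0) (hz : q ⬝ᵥ z = 0)
    (hL : L ξ z ≤ L ξ y) (hn : ‖y‖ ≤ ‖z‖) :
    |((q ⬝ᵥ y : ℤ) : ℝ)| ≤ 16 * powBound ξ * ‖q‖ * L ξ y := by
  have hM := one_le_powBound ξ
  have hzp : 0 < ‖z‖ := norm_pos_iff.2 hz0
  refine le_of_mul_le_mul_right ((abs_dot_mul_norm_le ξ q y z hz).trans ?_) hzp
  have : ‖y‖ * L ξ z ≤ L ξ y * ‖z‖ := by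
    rw [mul_comm]; exact mul_le_mul hL hn (norm_nonneg _) (L_nonneg _ _)
  calc 8 * powBound ξ * ‖q‖ * (L ξ y * ‖z‖ + ‖y‖ * L ξ z)
      ≤ 8 * powBound ξ * ‖q‖ * (L ξ y * ‖z‖ + L ξ y * ‖z‖) := by gcongr
    _ = _ := by ring

/-- The Plücker coordinates of the plane spanned by two integer points. -/
def plucker (u v : Fin 4 → ℤ) (a b : Fin 4) : ℤ := u a * v b - u b * v a

theorem abs_plucker_le (ξ : ℝ) {u v : Fin 4 → ℤ} (hu : u ≠ 0) (hL : L ξ v ≤ L ξ u)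
    (hn : ‖u‖ ≤ ‖v‖) (a b : Fin 4) :
    |(plucker u v a b : ℝ)| ≤ 32 * powBound ξ * (‖v‖ * L ξ u) := by
  have hM := one_le_powBound ξ
  have hup : 0 < ‖u‖ := norm_pos_iff.2 hu
  -- `q` is the linear form `y ↦ u a * y b - u b * y a`
  set q : Fin 4 → ℤ := u a • Pi.single b 1 - u b • Pi.single a 1 with hq
  have hqy : ∀ y, q ⬝ᵥ y = plucker u y a b := fun y => by
    simp only [hq, plucker, sub_dotProduct, smul_dotProduct, single_dotProduct, one_mul,
      smul_eq_mul]
  have hqn : ‖q‖ ≤ 2 * ‖u‖ := by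
    have h1 : ∀ c d : Fin 4, ‖u c • (Pi.single d 1 : Fin 4 → ℤ)‖ ≤ ‖u‖ := fun c d => by
      refine norm_le_of_coord (norm_nonneg _) fun k => ?_
      by_cases h : k = d
      · subst h; simpa using abs_coord_le u c
      · simp [h]
    calc ‖q‖ ≤ _ := norm_sub_le _ _
      _ ≤ ‖u‖ + ‖u‖ := add_le_add (h1 _ _) (h1 _ _)
      _ = 2 * ‖u‖ := by ring
  have h2 := abs_dot_mul_norm_le_of_le (q := q) (by rw [hqy]; simp [plucker]; ring) hL hn
  rw [hqy] at h2
  have hLu := L_nonneg ξ u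
  refine le_of_mul_le_mul_right (h2.trans ?_) hup
  calc 16 * powBound ξ * ‖q‖ * (‖v‖ * L ξ u) ≤ 16 * powBound ξ * (2 * ‖u‖) * (‖v‖ * L ξ u) := by
        gcongr
    _ = _ := by ring

/-! ### Linear independence of the powers of `ξ` -/

theorem aeval_ne_zero {ξ : ℝ} (hξ : 3 < Module.rank ℚ ℚ⟮ξ⟯) {p : Polynomial ℚ} (hp : p ≠ 0)
    (hd : p.natDegree ≤ 3) : Polynomial.aeval ξ p ≠ 0 := by
  intro h
  have hi : IsIntegral ℚ ξ := IsAlgebraic.isIntegral ⟨p, hp, h⟩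
  have : FiniteDimensional ℚ ℚ⟮ξ⟯ := IntermediateField.adjoin.finiteDimensional hi
  rw [← Module.finrank_eq_rank, IntermediateField.adjoin.finrank hi] at hξ
  have h1 : 3 < (minpoly ℚ ξ).natDegree := by exact_mod_cast hξ
  have h2 := Polynomial.natDegree_le_of_dvd (minpoly.dvd ℚ ξ h) hp
  omega

theorem form_ne_zero {ξ : ℝ} (hξ : 3 < Module.rank ℚ ℚ⟮ξ⟯) {q : Fin 4 → ℤ} (hq : q ≠ 0) :
    ∑ k, (q k : ℝ) * ξ ^ (k : ℕ) ≠ 0 := by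
  set p : Polynomial ℚ := ∑ k : Fin 4, Polynomial.monomial (k : ℕ) (q k : ℚ) with hpdef
  have hc : ∀ k : Fin 4, p.coeff k = q k := fun k => by
    simp [hpdef, Polynomial.finsetSum_coeff, Polynomial.coeff_monomial, Fin.val_inj]
  have hp : p ≠ 0 := by
    obtain ⟨k, hk⟩ := Function.ne_iff.1 hq
    intro h
    have := hc k
    rw [h] at this
    simp only [Polynomial.coeff_zero] at this
    exact hk (by exact_mod_cast this.symm)
  have hd : p.natDegree ≤ 3 := by
    refine Polynomial.natDegree_sum_le_of_forall_le _ _ fun k _ => ?_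
    exact (Polynomial.natDegree_monomial_le _).trans (by omega)
  have := aeval_ne_zero hξ hp hd
  simpa [hpdef, Polynomial.aeval_monomial] using this

theorem irrational_of_rank {ξ : ℝ} (hξ : 3 < Module.rank ℚ ℚ⟮ξ⟯) {p q : ℤ}
    (h : (q : ℝ) * ξ = p) : q = 0 := by
  by_contra hq
  refine form_ne_zero hξ (q := ![-p, q, 0, 0]) (fun h0 => hq ?_) ?_
  · simpa using congrFun h0 1
  · simp [Fin.sum_univ_four]; linarith

theorem L_pos {ξ : ℝ} (hξ : 3 < Module.rank ℚ ℚ⟮ξ⟯) {x : Fin 4 → ℤ} (hx : x ≠ 0) :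
    0 < L ξ x := by
  refine lt_of_le_of_ne (L_nonneg _ _) fun h => hx ?_
  have hk : ∀ k : Fin 4, (x 0 : ℝ) * ξ ^ (k : ℕ) = x k := fun k => by
    have := abs_sub_le_L ξ x k
    rw [← h] at this
    linarith [abs_nonpos_iff.1 this]
  have h0 : x 0 = 0 := irrational_of_rank hξ (p := x 1) (by simpa using hk 1)
  funext k
  have := hk k
  rw [h0] at this
  simpa using this.symm

theorem finite_norm_le (B : ℝ) : {x : Fin 4 → ℤ | ‖x‖ ≤ B}.Finite := by
  have : {x : Fin 4 → ℤ | ‖x‖ ≤ B} = Metric.closedBall 0 B := by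
    ext x; simp
  rw [this]
  exact (isCompact_closedBall (0 : Fin 4 → ℤ) B).finite_of_discrete

theorem exists_L_lower {ξ : ℝ} (hξ : 3 < Module.rank ℚ ℚ⟮ξ⟯) (B : ℝ) :
    ∃ ε : ℝ, 0 < ε ∧ ∀ x : Fin 4 → ℤ, x ≠ 0 → ‖x‖ ≤ B → ε ≤ L ξ x := by
  have hf : ({x : Fin 4 → ℤ | ‖x‖ ≤ B} \ {0}).Finite := (finite_norm_le B).sdiff
  rcases ({x : Fin 4 → ℤ | ‖x‖ ≤ B} \ {0}).eq_empty_or_nonempty with he | hne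
  · refine ⟨1, one_pos, fun x hx hB => ?_⟩
    have : x ∈ ({x : Fin 4 → ℤ | ‖x‖ ≤ B} \ {0}) := ⟨hB, hx⟩
    rw [he] at this
    exact this.elim
  · obtain ⟨z, hz, hmin⟩ := hf.exists_minimalFor (L ξ) _ hne
    refine ⟨L ξ z, L_pos hξ hz.2, fun x hx hB => ?_⟩
    rcases le_total (L ξ z) (L ξ x) with h | h
    · exact h
    · exact hmin ⟨hB, hx⟩ h

/-- Points of a fixed rational hyperplane stay away from the line spanned by
`(1, ξ, ξ², ξ³)`. -/
theorem norm_le_of_dot_eq_zero {ξ : ℝ} (hξ : 3 < Module.rank ℚ ℚ⟮ξ⟯) {q : Fin 4 → ℤ}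
    (hq : q ≠ 0) : ∃ C : ℝ, 0 < C ∧ ∀ z : Fin 4 → ℤ, q ⬝ᵥ z = 0 → ‖z‖ ≤ C * L ξ z := by
  have hM := one_le_powBound ξ
  set e := ∑ k, (q k : ℝ) * ξ ^ (k : ℕ) with he
  have he0 : 0 < |e| := abs_pos.2 (form_ne_zero hξ hq)
  refine ⟨powBound ξ * (4 * ‖q‖ / |e|) + 1, by positivity, fun z hz => ?_⟩
  have h2 := abs_dot_sub_le ξ q z
  rw [hz, Int.cast_zero, sub_zero, abs_mul] at h2
  have h3 : |(z 0 : ℝ)| ≤ 4 * ‖q‖ / |e| * L ξ z := by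
    rw [div_mul_eq_mul_div, le_div_iff₀ he0]; exact h2
  have h4 := norm_le_mul_abs_add_L ξ z
  calc ‖z‖ ≤ _ := h4
    _ ≤ powBound ξ * (4 * ‖q‖ / |e| * L ξ z) + L ξ z := by gcongr
    _ = _ := by ring

/-! ### Normal vectors and heights of hyperplanes -/

theorem toReal_apply {n : ℕ} (x : Fin n → ℤ) (k : Fin n) : toReal n x k = (x k : ℝ) := rfl

/-- The cross product of three integer points of `ℤ⁴`: the coefficients of the linear form
`y ↦ det (y, r 0, r 1, r 2)`. -/
def cross (r : Fin 3 → Fin 4 → ℤ) (k : Fin 4) : ℤ :=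
  (-1) ^ (k : ℕ) * (Matrix.of fun i s => r i (k.succAbove s)).det

theorem cross_dot (r : Fin 3 → Fin 4 → ℤ) (y : Fin 4 → ℤ) :
    cross r ⬝ᵥ y = (Matrix.of (Fin.cons y r : Fin 4 → Fin 4 → ℤ)).det := by
  rw [Matrix.det_succ_row_zero, dotProduct]
  refine Finset.sum_congr rfl fun k _ => ?_
  rw [cross, mul_right_comm]
  rfl

theorem cross_dot_ne_zero_iff (r : Fin 3 → Fin 4 → ℤ) (y : Fin 4 → ℤ) :
    cross r ⬝ᵥ y ≠ 0 ↔
      LinearIndependent ℝ (Fin.cons (toReal 4 y) (fun i => toReal 4 (r i)) :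
        Fin 4 → Fin 4 → ℝ) := by
  have h1 : (Fin.cons (toReal 4 y) (fun i => toReal 4 (r i)) : Fin 4 → Fin 4 → ℝ) =
      ((Matrix.of (Fin.cons y r : Fin 4 → Fin 4 → ℤ)).map (Int.castRingHom ℝ)).row := by
    funext i s
    refine Fin.cases ?_ (fun i => ?_) i <;> simp [Matrix.row, toReal_apply]
  rw [h1, Matrix.linearIndependent_rows_iff_isUnit, Matrix.isUnit_iff_isUnit_det,
    isUnit_iff_ne_zero, ← RingHom.mapMatrix_apply, ← RingHom.map_det, cross_dot]
  simp

theorem cross_dot_eq_zero_iff {r : Fin 3 → Fin 4 → ℤ}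
    (hr : LinearIndependent ℝ fun i => toReal 4 (r i)) (y : Fin 4 → ℤ) :
    cross r ⬝ᵥ y = 0 ↔ toReal 4 y ∈ Submodule.span ℝ (Set.range fun i => toReal 4 (r i)) := by
  rw [← not_iff_not, ← ne_eq, cross_dot_ne_zero_iff, linearIndependent_finCons]
  simp [hr]

theorem cross_ne_zero {r : Fin 3 → Fin 4 → ℤ}
    (hr : LinearIndependent ℝ fun i => toReal 4 (r i)) : cross r ≠ 0 := by
  intro h
  -- every standard basis vector would lie in a subspace of dimension three
  have h1 : ∀ k : Fin 4, (Pi.single k 1 : Fin 4 → ℝ) ∈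
      Submodule.span ℝ (Set.range fun i => toReal 4 (r i)) := fun k => by
    have := (cross_dot_eq_zero_iff hr (Pi.single k 1)).1 (by rw [h, zero_dotProduct])
    convert this using 1
    funext l
    rw [toReal_apply]
    by_cases hl : l = k
    · subst hl; simp
    · simp [hl]
  have h2 : Submodule.span ℝ (Set.range fun i => toReal 4 (r i)) = ⊤ := by
    rw [eq_top_iff, ← (Pi.basisFun ℝ (Fin 4)).span_eq, Submodule.span_le]
    rintro _ ⟨k, rfl⟩
    simpa using h1 k
  have h3 := finrank_span_eq_card hr
  rw [h2, finrank_top] at h3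
  simp at h3

theorem cross_eq_det_smul {r b : Fin 3 → Fin 4 → ℤ} {T : Matrix (Fin 3) (Fin 3) ℤ}
    (h : ∀ i, r i = ∑ j, T i j • b j) : cross r = T.det • cross b := by
  funext k
  have h1 : (Matrix.of fun i s => r i (k.succAbove s)) =
      T * (Matrix.of fun i s => b i (k.succAbove s)) := by
    ext i s
    simp [Matrix.mul_apply, h i, Finset.sum_apply]
  rw [cross, h1, Matrix.det_mul, Pi.smul_apply, cross, smul_eq_mul]
  ring

theorem exists_eq_succAbove (e : Fin 3 ↪o Fin 4) : ∃ k : Fin 4, ⇑e = k.succAbove := by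
  have h1 : ¬ Function.Surjective e := fun h => by
    simpa using Fintype.card_le_of_surjective e h
  obtain ⟨k, hk⟩ := not_forall.1 h1
  refine ⟨k, (StrictMono.range_inj e.strictMono (Fin.strictMono_succAbove k)).1 ?_⟩
  rw [Fin.range_succAbove]
  have h2 : (Finset.univ.image e) = ({k}ᶜ : Finset (Fin 4)) := by
    refine Finset.eq_of_subset_of_card_le (fun l hl => ?_) ?_
    · obtain ⟨m, -, rfl⟩ := Finset.mem_image.1 hl
      simp only [Finset.mem_compl, Finset.mem_singleton]
      rintro rfl
      exact hk ⟨m, rfl⟩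
    · rw [Finset.card_image_of_injective _ e.injective, Finset.card_compl]
      simp
  have h3 := congrArg (fun s : Finset (Fin 4) => (s : Set (Fin 4))) h2
  simpa using h3

theorem wedgeNorm_eq_norm_cross (r : Fin 3 → Fin 4 → ℤ) :
    wedgeNorm (fun i => toReal 4 (r i)) = ‖cross r‖ := by
  have h1 : ∀ k : Fin 4, |(Matrix.of fun i s => toReal 4 (r i) (k.succAbove s)).det| =
      |(cross r k : ℝ)| := fun k => by
    have h2 : (Matrix.of fun i s => toReal 4 (r i) (k.succAbove s)) =
        (Matrix.of fun i s => r i (k.succAbove s)).map (Int.castRingHom ℝ) := by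
      ext i s; simp [toReal_apply]
    rw [h2, ← RingHom.mapMatrix_apply, ← RingHom.map_det, cross]
    simp [abs_mul]
  unfold wedgeNorm
  have : Nonempty (Fin 3 ↪o Fin 4) := ⟨Fin.succAboveOrderEmb 0⟩
  apply le_antisymm
  · refine ciSup_le fun e => ?_
    obtain ⟨k, hk⟩ := exists_eq_succAbove e
    rw [hk, h1]
    exact abs_coord_le _ k
  · refine norm_le_of_coord ?_ fun k => ?_
    · exact Real.iSup_nonneg fun _ => abs_nonneg _
    · rw [← h1]
      exact le_ciSup (f := fun e : Fin 3 ↪o Fin 4 =>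
        |(Matrix.of fun i s => toReal 4 (r i) (e s)).det|) (Set.finite_range _).bddAbove
        (Fin.succAboveOrderEmb k)

theorem finrank_latticePoints {q : Fin 4 → ℤ} (hq : q ≠ 0) {V : Submodule ℝ (Fin 4 → ℝ)}
    (hV : ∀ y, q ⬝ᵥ y = 0 ↔ toReal 4 y ∈ V) : Module.finrank ℤ (latticePoints V) = 3 := by
  set f : (Fin 4 → ℤ) →ₗ[ℤ] ℤ := dotProductBilin ℤ ℤ q with hf
  have h1 : latticePoints V = LinearMap.ker f := by
    ext y
    rw [LinearMap.mem_ker]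
    exact (hV y).symm
  have h2 := LinearMap.rank_range_add_rank_ker f
  simp only [← Module.finrank_eq_rank] at h2
  have h4 : Module.finrank ℤ (LinearMap.range f) + Module.finrank ℤ (LinearMap.ker f) =
      Module.finrank ℤ (Fin 4 → ℤ) := by exact_mod_cast h2
  have h3 : Module.finrank ℤ (LinearMap.range f) = 1 := by
    apply le_antisymm
    · simpa using Submodule.finrank_le (LinearMap.range f)
    · obtain ⟨k, hk⟩ := Function.ne_iff.1 hq
      rw [Nat.one_le_iff_ne_zero, ← Nat.pos_iff_ne_zero, Module.finrank_pos_iff_exists_ne_zero]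
      refine ⟨⟨f (Pi.single k 1), LinearMap.mem_range_self _ _⟩, fun h => hk ?_⟩
      have := congrArg Subtype.val h
      simpa [hf] using this
  rw [h1]
  rw [Module.finrank_fin_fun] at h4
  omega

/-- A rational hyperplane `V` has a normal vector with integer coordinates whose norm is the
height of `V`, and no three independent integer points of `V` have a cross product of smaller
norm. -/
theorem exists_normal {r : Fin 3 → Fin 4 → ℤ} {V : Submodule ℝ (Fin 4 → ℝ)}
    (hr : LinearIndependent ℝ fun i => toReal 4 (r i))
    (hV : V = Submodule.span ℝ (Set.range fun i => toReal 4 (r i))) :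
    1 ≤ height V ∧ height V ≤ ‖cross r‖ ∧
      ∃ q : Fin 4 → ℤ, ‖q‖ = height V ∧ ∀ y, q ⬝ᵥ y = 0 ↔ toReal 4 y ∈ V := by
  subst hV
  set V := Submodule.span ℝ (Set.range fun i => toReal 4 (r i)) with hV
  have h0 : ∀ y, cross r ⬝ᵥ y = 0 ↔ toReal 4 y ∈ V := cross_dot_eq_zero_iff hr
  have hfr := finrank_latticePoints (cross_ne_zero hr) h0
  let b : Module.Basis (Fin 3) ℤ (latticePoints V) := Module.finBasisOfFinrankEq ℤ _ hfr
  have hh : height V = ‖cross fun i => (b i : Fin 4 → ℤ)‖ := by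
    rw [height_eq V b, ← wedgeNorm_eq_norm_cross]
  have hmem : ∀ i, r i ∈ latticePoints V := fun i =>
    show toReal 4 (r i) ∈ V from Submodule.subset_span ⟨i, rfl⟩
  have h1 : ∀ i, r i = ∑ j, (Matrix.of fun i j => b.repr ⟨r i, hmem i⟩ j) i j •
      (b j : Fin 4 → ℤ) := fun i => by
    have := congrArg Subtype.val (b.sum_repr ⟨r i, hmem i⟩)
    rw [Submodule.coe_sum] at this
    exact this.symm
  have h2 := cross_eq_det_smul h1
  set d := (Matrix.of fun i j => b.repr ⟨r i, hmem i⟩ j).det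
  have hc := cross_ne_zero hr
  have hd : d ≠ 0 := fun h => hc (by rw [h2, h, zero_smul])
  have hb : (cross fun i => (b i : Fin 4 → ℤ)) ≠ 0 := fun h => hc (by rw [h2, h, smul_zero])
  rw [hh]
  refine ⟨one_le_norm hb, ?_, _, rfl, fun y => ?_⟩
  · rw [h2, norm_smul, Int.norm_eq_abs]
    refine le_mul_of_one_le_left (norm_nonneg _) ?_
    exact_mod_cast Int.one_le_abs hd
  · rw [← h0, h2, smul_dotProduct, smul_eq_mul, mul_eq_zero, or_iff_right hd]

/-- The cross product of `u`, `v`, `w` is controlled by the Plücker coordinates of `u`, `v` when a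
point `z` of the plane of `u`, `v` lies close to the line spanned by `(1, ξ, ξ², ξ³)`. -/
theorem norm_cross_mul_norm_le {ξ : ℝ} {u v w z : Fin 4 → ℤ}
    (hz : toReal 4 z ∈ Submodule.span ℝ {toReal 4 u, toReal 4 v})
    (hL : L ξ w ≤ L ξ z) (hn : ‖z‖ ≤ ‖w‖) {P : ℝ}
    (hP : ∀ a b, |(plucker u v a b : ℝ)| ≤ P) :
    ‖cross ![u, v, w]‖ * ‖z‖ ≤ 16 * powBound ξ * P * (‖w‖ * L ξ z) := by
  have hM := one_le_powBound ξ
  have hP0 : 0 ≤ P := (abs_nonneg _).trans (hP 0 0)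
  have key : ∀ k, ∃ q : Fin 4 → ℤ, ‖q‖ ≤ P ∧ (∀ y, q ⬝ᵥ y = cross ![u, v, y] k) := by
    intro k
    have hq : ∀ a b c d : ℤ, |(a : ℝ)| ≤ P → |(b : ℝ)| ≤ P → |(c : ℝ)| ≤ P → |(d : ℝ)| ≤ P →
        ‖![a, b, c, d]‖ ≤ P := fun a b c d ha hb hc hd => by
      refine norm_le_of_coord hP0 fun k => ?_
      fin_cases k <;> assumption
    have h00 : |((0 : ℤ) : ℝ)| ≤ P := by simpa using hP0
    have hPn : ∀ a b, |((-plucker u v a b : ℤ) : ℝ)| ≤ P := fun a b => by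
      simpa using hP a b
    fin_cases k
    · refine ⟨![0, plucker u v 2 3, -plucker u v 1 3, plucker u v 1 2], hq _ _ _ _ h00 (hP _ _)
        (hPn _ _) (hP _ _), fun y => ?_⟩
      simp [cross, Matrix.det_fin_three, plucker, dotProduct, Fin.sum_univ_four, Fin.succAbove]
      ring
    · refine ⟨![-plucker u v 2 3, 0, plucker u v 0 3, -plucker u v 0 2], hq _ _ _ _ (hPn _ _) h00
        (hP _ _) (hPn _ _), fun y => ?_⟩
      simp [cross, Matrix.det_fin_three, plucker, dotProduct, Fin.sum_univ_four, Fin.succAbove]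
      ring
    · refine ⟨![plucker u v 1 3, -plucker u v 0 3, 0, plucker u v 0 1], hq _ _ _ _ (hP _ _)
        (hPn _ _) h00 (hP _ _), fun y => ?_⟩
      simp [cross, Matrix.det_fin_three, plucker, dotProduct, Fin.sum_univ_four, Fin.succAbove]
      ring
    · refine ⟨![-plucker u v 1 2, plucker u v 0 2, -plucker u v 0 1, 0], hq _ _ _ _ (hPn _ _)
        (hP _ _) (hPn _ _) h00, fun y => ?_⟩
      simp [cross, Matrix.det_fin_three, plucker, dotProduct, Fin.sum_univ_four, Fin.succAbove]
      ring
  -- the cross product vanishes at `z`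
  have hz0 : ∀ k, cross ![u, v, z] k = 0 := by
    intro k
    obtain ⟨s, t, hst⟩ := Submodule.mem_span_pair.1 hz
    have h1 : (Matrix.of fun i l => ![u, v, z] i (k.succAbove l)).det = 0 := by
      have h3 : ∀ l, (z l : ℝ) = s * u l + t * v l := fun l => by
        have := congrFun hst l
        simpa [toReal_apply] using this.symm
      have h2 : (((Matrix.of fun i l => ![u, v, z] i (k.succAbove l)).det : ℤ) : ℝ) = 0 := by
        simp only [Matrix.det_fin_three, Matrix.of_apply, Matrix.cons_val]
        push_cast
        rw [h3, h3, h3]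
        ring
      exact_mod_cast h2
    rw [cross, h1, mul_zero]
  rcases (norm_nonneg z).eq_or_lt with hzn | hzn
  · rw [← hzn, mul_zero]
    have := L_nonneg ξ z
    positivity
  rw [← le_div_iff₀ hzn]
  have hLz := L_nonneg ξ z
  refine norm_le_of_coord (by positivity) fun k => ?_
  rw [le_div_iff₀ hzn]
  obtain ⟨q, hqn, hq⟩ := key k
  rw [← hq]
  refine (abs_dot_mul_norm_le_of_le (by rw [hq, hz0]) hL hn).trans ?_
  gcongr

/-! ### Linear recurrences of order two -/

/-- The linear form `a₀ x₀ + a₁ x₁ + a₂ x₂`. -/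
def lowForm (a : Fin 3 → ℤ) : Fin 4 → ℤ := ![a 0, a 1, a 2, 0]

/-- The linear form `a₀ x₁ + a₁ x₂ + a₂ x₃`. -/
def highForm (a : Fin 3 → ℤ) : Fin 4 → ℤ := ![0, a 0, a 1, a 2]

/-- The four coordinates of `x` satisfy the linear recurrence with coefficients `a`. -/
def Recurs (a : Fin 3 → ℤ) (x : Fin 4 → ℤ) : Prop := lowForm a ⬝ᵥ x = 0 ∧ highForm a ⬝ᵥ x = 0

/-- The cross product of `(x₀, x₁, x₂)` and `(x₁, x₂, x₃)`. -/
def hankel (x : Fin 4 → ℤ) : Fin 3 → ℤ :=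
  ![x 1 * x 3 - x 2 * x 2, x 2 * x 1 - x 0 * x 3, x 0 * x 2 - x 1 * x 1]

theorem lowForm_dot (a : Fin 3 → ℤ) (x : Fin 4 → ℤ) :
    lowForm a ⬝ᵥ x = a 0 * x 0 + a 1 * x 1 + a 2 * x 2 := by
  simp [lowForm, dotProduct, Fin.sum_univ_four]

theorem highForm_dot (a : Fin 3 → ℤ) (x : Fin 4 → ℤ) :
    highForm a ⬝ᵥ x = a 0 * x 1 + a 1 * x 2 + a 2 * x 3 := by
  simp [highForm, dotProduct, Fin.sum_univ_four]

theorem recurs_iff {a : Fin 3 → ℤ} {x : Fin 4 → ℤ} :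
    Recurs a x ↔ a 0 * x 0 + a 1 * x 1 + a 2 * x 2 = 0 ∧ a 0 * x 1 + a 1 * x 2 + a 2 * x 3 = 0 := by
  rw [Recurs, lowForm_dot, highForm_dot]

theorem abs_coord3_le (a : Fin 3 → ℤ) (k : Fin 3) : |(a k : ℝ)| ≤ ‖a‖ := by
  rw [← Int.norm_eq_abs]; exact norm_le_pi_norm a k

theorem norm_lowForm_le (a : Fin 3 → ℤ) : ‖lowForm a‖ ≤ ‖a‖ := by
  refine norm_le_of_coord (norm_nonneg _) fun k => ?_
  fin_cases k
  · exact abs_coord3_le a 0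
  · exact abs_coord3_le a 1
  · exact abs_coord3_le a 2
  · simp [lowForm]

theorem norm_highForm_le (a : Fin 3 → ℤ) : ‖highForm a‖ ≤ ‖a‖ := by
  refine norm_le_of_coord (norm_nonneg _) fun k => ?_
  fin_cases k
  · simp [highForm]
  · exact abs_coord3_le a 0
  · exact abs_coord3_le a 1
  · exact abs_coord3_le a 2

theorem recurs_hankel (x : Fin 4 → ℤ) : Recurs (hankel x) x := by
  rw [recurs_iff]
  simp only [hankel, Matrix.cons_val]
  constructor <;> ring

theorem norm_hankel_le (ξ : ℝ) (x : Fin 4 → ℤ) :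
    ‖hankel x‖ ≤ 4 * powBound ξ * (‖x‖ * L ξ x) := by
  have hM := one_le_powBound ξ
  have hL := L_nonneg ξ x
  have key : ∀ a b : Fin 3, |((x a.castSucc * x b.succ - x b.castSucc * x a.succ : ℤ) : ℝ)| ≤
      4 * powBound ξ * (‖x‖ * L ξ x) := fun a b => by
    have h : ((x a.castSucc * x b.succ - x b.castSucc * x a.succ : ℤ) : ℝ) =
        x a.castSucc * (x b.succ - ξ * x b.castSucc) -
          x b.castSucc * (x a.succ - ξ * x a.castSucc) := by push_cast; ring
    rw [h]
    refine (abs_sub _ _).trans ?_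
    rw [abs_mul, abs_mul]
    have h1 := mul_le_mul (abs_coord_le x a.castSucc) (abs_succ_sub_mul_le ξ x b) (abs_nonneg _)
      (norm_nonneg _)
    have h2 := mul_le_mul (abs_coord_le x b.castSucc) (abs_succ_sub_mul_le ξ x a) (abs_nonneg _)
      (norm_nonneg _)
    linarith
  refine norm_le_of_coord (by positivity) fun k => ?_
  fin_cases k
  · exact key 1 2
  · have := key 2 0
    rwa [show x (Fin.castSucc 2) * x (Fin.succ 0) - x (Fin.castSucc 0) * x (Fin.succ 2) =
      hankel x 1 from rfl] at this
  · exact key 0 1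

/-- A form `lowForm` and the companion `highForm` have nearly the ratio `1 : ξ` at every point. -/
theorem abs_highForm_sub_le (ξ : ℝ) (a : Fin 3 → ℤ) (y : Fin 4 → ℤ) :
    |((highForm a ⬝ᵥ y : ℤ) : ℝ) - ξ * ((lowForm a ⬝ᵥ y : ℤ) : ℝ)| ≤
      6 * powBound ξ * (‖a‖ * L ξ y) := by
  have h : ((highForm a ⬝ᵥ y : ℤ) : ℝ) - ξ * ((lowForm a ⬝ᵥ y : ℤ) : ℝ) =
      ∑ k : Fin 3, (a k : ℝ) * (y k.succ - ξ * y k.castSucc) := by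
    rw [highForm_dot, lowForm_dot, Fin.sum_univ_three]
    change _ = (a 0 : ℝ) * (y 1 - ξ * y 0) + a 1 * (y 2 - ξ * y 1) + a 2 * (y 3 - ξ * y 2)
    push_cast
    ring
  rw [h]
  refine (Finset.abs_sum_le_sum_abs _ _).trans ?_
  calc ∑ k : Fin 3, |(a k : ℝ) * (y k.succ - ξ * y k.castSucc)|
      ≤ ∑ _k : Fin 3, ‖a‖ * (2 * powBound ξ * L ξ y) := by
        refine Finset.sum_le_sum fun k _ => ?_
        rw [abs_mul]
        exact mul_le_mul (abs_coord3_le a k) (abs_succ_sub_mul_le ξ y k) (abs_nonneg _)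
          (norm_nonneg _)
    _ = _ := by simp; ring

theorem exists_smul_primitive {a : Fin 3 → ℤ} (ha : a ≠ 0) :
    ∃ (d : ℤ) (b r : Fin 3 → ℤ), d ≠ 0 ∧ a = d • b ∧ ∑ k, r k * b k = 1 := by
  obtain ⟨d, hd⟩ := (IsPrincipalIdealRing.principal (Ideal.span (Set.range a))).principal
  have hd' : Ideal.span (Set.range a) = Ideal.span {d} := hd
  have h1 : ∀ k, ∃ c, a k = d * c := fun k => by
    have : a k ∈ Ideal.span {d} := hd' ▸ Ideal.subset_span ⟨k, rfl⟩
    exact Ideal.mem_span_singleton.1 this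
  choose b hb using h1
  have hd0 : d ≠ 0 := fun h => ha (by funext k; rw [hb, h, zero_mul]; rfl)
  have h2 : d ∈ Ideal.span (Set.range a) := by
    rw [hd']; exact Ideal.mem_span_singleton_self d
  obtain ⟨r, hr⟩ := Ideal.mem_span_range_iff_exists_fun.1 h2
  refine ⟨d, b, r, hd0, funext hb, ?_⟩
  refine mul_left_cancel₀ hd0 ?_
  rw [Finset.mul_sum, mul_one]
  conv_rhs => rw [← hr]
  exact Finset.sum_congr rfl fun k _ => by rw [hb]; ring

theorem eq_mul_of_parallel {a r w : Fin 3 → ℤ} (hr : ∑ k, r k * a k = 1)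
    (h : ∀ k l, w k * a l = w l * a k) : ∃ m, ∀ k, w k = m * a k := by
  refine ⟨∑ k, r k * w k, fun l => ?_⟩
  rw [Finset.sum_mul, ← mul_one (w l), ← hr, Finset.mul_sum]
  refine Finset.sum_congr rfl fun k _ => ?_
  linear_combination r k * h l k

theorem eq_mul_of_parallel' {a r : Fin 3 → ℤ} (hr : ∑ k, r k * a k = 1) (w₀ w₁ w₂ : ℤ)
    (h01 : w₀ * a 1 = w₁ * a 0) (h02 : w₀ * a 2 = w₂ * a 0) (h12 : w₁ * a 2 = w₂ * a 1) :
    ∃ m, w₀ = m * a 0 ∧ w₁ = m * a 1 ∧ w₂ = m * a 2 := by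
  obtain ⟨m, hm⟩ := eq_mul_of_parallel (w := ![w₀, w₁, w₂]) hr (fun k l => by
    fin_cases k <;> fin_cases l <;> simp <;> linarith)
  exact ⟨m, hm 0, hm 1, hm 2⟩

/-- The Plücker coordinates of the plane of all solutions of a recurrence are quadratic in the
coefficients: for coprime coefficients `a` they are an integer multiple of
`(a₂², -a₁a₂, a₁² - a₀a₂, a₀a₂, -a₀a₁, a₀²)`. -/
theorem sq_norm_le_of_recurs {a r : Fin 3 → ℤ} (hr : ∑ k, r k * a k = 1) {x y : Fin 4 → ℤ}
    (hx : Recurs a x) (hy : Recurs a y) (hxy : ∃ k l, plucker x y k l ≠ 0) {P : ℝ}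
    (hP : ∀ k l, |(plucker x y k l : ℝ)| ≤ P) : ‖a‖ ^ 2 ≤ 2 * P := by
  have hP0 : 0 ≤ P := (abs_nonneg _).trans (hP 0 0)
  obtain ⟨x1, x2⟩ := recurs_iff.1 hx
  obtain ⟨y1, y2⟩ := recurs_iff.1 hy
  obtain ⟨m, e12, e02, e01⟩ := eq_mul_of_parallel' hr (plucker x y 1 2) (-plucker x y 0 2)
    (plucker x y 0 1)
    (by unfold plucker; linear_combination y 2 * x1 - x 2 * y1)
    (by unfold plucker; linear_combination -y 1 * x1 + x 1 * y1)
    (by unfold plucker; linear_combination y 0 * x1 - x 0 * y1)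
  obtain ⟨n, e23, e13, e12'⟩ := eq_mul_of_parallel' hr (plucker x y 2 3) (-plucker x y 1 3)
    (plucker x y 1 2)
    (by unfold plucker; linear_combination y 3 * x2 - x 3 * y2)
    (by unfold plucker; linear_combination -y 2 * x2 + x 2 * y2)
    (by unfold plucker; linear_combination y 1 * x2 - x 1 * y2)
  obtain ⟨s, e13', e03, e02'⟩ := eq_mul_of_parallel' hr (plucker x y 1 3)
    (-(plucker x y 0 3 + plucker x y 1 2)) (plucker x y 0 2)
    (by unfold plucker; linear_combination y 3 * x1 - x 2 * y2 - x 3 * y1 + y 2 * x2)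
    (by unfold plucker; linear_combination -y 2 * x1 + x 1 * y2 + x 2 * y1 - y 1 * x2)
    (by unfold plucker; linear_combination y 1 * x1 - x 0 * y2 - x 1 * y1 + y 0 * x2)
  -- the multipliers of the three parallel vectors form themselves a multiple of `(a₂, a₁, a₀)`
  obtain ⟨t, f0, f1, f2⟩ := eq_mul_of_parallel' hr n (-s) m
    (by linear_combination -e13 - e13') (by linear_combination -e12' + e12)
    (by linear_combination e02' + e02)
  have ht : t ≠ 0 := by
    rintro rfl
    simp only [zero_mul] at f0 f1 f2
    have hs : s = 0 := by linarith
    subst f0 f2 hs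
    simp only [zero_mul] at *
    have hz : ∀ k l, plucker x y k l = 0 := by
      have hsym : ∀ k l, plucker x y k l = - plucker x y l k := fun k l => by
        unfold plucker; ring
      have hself : ∀ k, plucker x y k k = 0 := fun k => by unfold plucker; ring
      have h10 := hsym 1 0
      have h20 := hsym 2 0
      have h30 := hsym 3 0
      have h21 := hsym 2 1
      have h31 := hsym 3 1
      have h32 := hsym 3 2
      intro k l
      fin_cases k <;> fin_cases l <;> simp only [Fin.zero_eta, Fin.mk_one, Fin.reduceFinMk, hself]
        <;> omega
    obtain ⟨k, l, hkl⟩ := hxy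
    exact hkl (hz k l)
  have ht1 : (1 : ℝ) ≤ |(t : ℝ)| := by exact_mod_cast Int.one_le_abs ht
  have key : ∀ k, (a k : ℝ) ^ 2 ≤ 2 * P := by
    have aux : ∀ (u v : ℤ), t * u ^ 2 = v → |(v : ℝ)| ≤ 2 * P → (u : ℝ) ^ 2 ≤ 2 * P := by
      intro u v h hv
      refine le_trans ?_ hv
      rw [← h]
      push_cast
      rw [abs_mul, abs_of_nonneg (sq_nonneg (u : ℝ))]
      exact le_mul_of_one_le_left (sq_nonneg _) ht1
    intro k
    fin_cases k
    · refine aux (a 0) (plucker x y 2 3) (by rw [e23, f0]; ring) ((hP _ _).trans (by linarith))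
    · refine aux (a 1) (plucker x y 0 3 + plucker x y 1 2) ?_ ?_
      · linear_combination e03 - a 1 * f1
      · push_cast
        refine (abs_add_le _ _).trans ?_
        linarith [hP 0 3, hP 1 2]
    · refine aux (a 2) (plucker x y 0 1) (by rw [e01, f2]; ring) ((hP _ _).trans (by linarith))
  have : ‖a‖ ≤ √(2 * P) :=
    norm_le_of_coord (Real.sqrt_nonneg _) fun k => Real.abs_le_sqrt (key k)
  calc ‖a‖ ^ 2 ≤ √(2 * P) ^ 2 := by gcongr
    _ = 2 * P := Real.sq_sqrt (by linarith)

/-- The solutions of a recurrence of order two form a space of dimension two. -/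
theorem eq_zero_of_recurs {r : Fin 3 → Fin 4 → ℤ}
    (hr : LinearIndependent ℝ fun i => toReal 4 (r i)) {a : Fin 3 → ℤ}
    (h : ∀ i, Recurs a (r i)) : a = 0 := by
  -- a form that vanishes on the three points is parallel to their cross product
  have par : ∀ q : Fin 4 → ℤ, (∀ i, q ⬝ᵥ r i = 0) →
      ∀ k l, q l * cross r k = q k * cross r l := by
    intro q hq k l
    set y : Fin 4 → ℤ := cross r k • Pi.single l 1 - cross r l • Pi.single k 1 with hy
    have hdot : ∀ p : Fin 4 → ℤ, p ⬝ᵥ y = cross r k * p l - cross r l * p k := fun p => by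
      simp only [hy, dotProduct_sub, dotProduct_smul, dotProduct_single, mul_one, smul_eq_mul]
    have h1 : toReal 4 y ∈ Submodule.span ℝ (Set.range fun i => toReal 4 (r i)) := by
      rw [← cross_dot_eq_zero_iff hr, hdot]; ring
    have h2 : ((q ⬝ᵥ y : ℤ) : ℝ) = 0 := by
      have cast : ∀ z : Fin 4 → ℤ, ((q ⬝ᵥ z : ℤ) : ℝ) = toReal 4 q ⬝ᵥ toReal 4 z := fun z => by
        simp [dotProduct, toReal_apply]
      rw [cast]
      refine Submodule.span_induction (p := fun v _ => toReal 4 q ⬝ᵥ v = 0) ?_ ?_ ?_ ?_ h1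
      · rintro _ ⟨i, rfl⟩
        rw [← cast, hq, Int.cast_zero]
      · exact dotProduct_zero _
      · intro u v _ _ hu hv
        rw [dotProduct_add, hu, hv, add_zero]
      · intro c v _ hv
        rw [dotProduct_smul, hv, smul_zero]
    have h3 : q ⬝ᵥ y = 0 := by exact_mod_cast h2
    rw [hdot] at h3
    linarith
  have hlow := par (lowForm a) fun i => (h i).1
  have hhigh := par (highForm a) fun i => (h i).2
  obtain ⟨j, hj⟩ := Function.ne_iff.1 (cross_ne_zero hr)
  have hpar : ∀ k l, lowForm a k * highForm a l = lowForm a l * highForm a k := fun k l => by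
    refine mul_left_cancel₀ (mul_ne_zero hj hj) ?_
    have e1 := hlow j k
    have e2 := hhigh j l
    have e3 := hlow j l
    have e4 := hhigh j k
    linear_combination highForm a l * cross r j * e1 + lowForm a j * cross r k * e2
      - highForm a k * cross r j * e3 - lowForm a j * cross r l * e4
  have e0 := hpar 0 1
  have e1 := hpar 1 2
  have e2 := hpar 2 3
  simp only [lowForm, highForm, Matrix.cons_val, mul_zero, zero_mul] at e0 e1 e2
  have a0 : a 0 = 0 := mul_self_eq_zero.1 e0
  have a2 : a 2 = 0 := mul_self_eq_zero.1 e2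
  have a1 : a 1 = 0 := by
    rw [a0, mul_zero] at e1
    exact mul_self_eq_zero.1 e1
  funext k
  fin_cases k <;> assumption

/-- A point whose coordinates are in geometric progression, of ratio `p / q` in lowest terms, has
a first coordinate divisible by `q³`. This makes `q` so small that any other point `y` yields a
non-zero integer `q yₖ₊₁ - p yₖ` that bounds `L ξ y` from below. -/
theorem one_le_of_hankel_eq_zero {ξ : ℝ} {x y : Fin 4 → ℤ} (hx : hankel x = 0) (hx0 : x 0 ≠ 0)
    (hxL : L ξ x ≤ 1) (hxy : ∃ k, y 0 * x k ≠ y k * x 0) (hL : L ξ x ≤ L ξ y)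
    (hn : ‖y‖ ≤ ‖x‖) : 1 ≤ (4 * powBound ξ) ^ 3 * ‖x‖ * L ξ y ^ 3 := by
  have hM := one_le_powBound ξ
  have hLx := L_nonneg ξ x
  have hLy := L_nonneg ξ y
  have k0 : x 1 * x 3 - x 2 * x 2 = 0 := congrFun hx 0
  have k1 : x 2 * x 1 - x 0 * x 3 = 0 := congrFun hx 1
  have k2 : x 0 * x 2 - x 1 * x 1 = 0 := congrFun hx 2
  have hg : 0 < Int.gcd (x 0) (x 1) := Int.gcd_pos_of_ne_zero_left _ hx0
  obtain ⟨q, p, hco, hq, hp⟩ := Int.exists_gcd_one hg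
  set g : ℤ := ((Int.gcd (x 0) (x 1) : ℕ) : ℤ)
  have hg0 : g ≠ 0 := by positivity
  have hq0 : q ≠ 0 := fun h => hx0 (by rw [hq, h, zero_mul])
  have hcop : IsCoprime q p := Int.isCoprime_iff_gcd_eq_one.2 hco
  have e1 : q * x 2 = p ^ 2 * g := by
    refine mul_left_cancel₀ hg0 ?_
    rw [hq, hp] at k2
    linear_combination k2
  obtain ⟨t, ht⟩ : q ∣ g := (hcop.pow_right (n := 2)).dvd_of_dvd_mul_left ⟨_, e1.symm⟩
  have ht0 : t ≠ 0 := fun h => hg0 (by rw [ht, h, mul_zero])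
  have e2 : x 2 = p ^ 2 * t := by
    refine mul_left_cancel₀ hq0 ?_
    rw [e1, ht]; ring
  have e3 : q * x 3 = p ^ 3 * t := by
    refine mul_left_cancel₀ (mul_ne_zero hq0 ht0) ?_
    rw [e2, hq, hp, ht] at k1
    linear_combination -k1
  obtain ⟨s, hs⟩ : q ∣ t := (hcop.pow_right (n := 3)).dvd_of_dvd_mul_left ⟨_, e3.symm⟩
  have hs0 : s ≠ 0 := fun h => ht0 (by rw [hs, h, mul_zero])
  have hqx : |(q : ℝ)| ^ 3 ≤ |(x 0 : ℝ)| := by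
    have : x 0 = q ^ 3 * s := by rw [hq, ht, hs]; ring
    rw [this]
    push_cast
    rw [abs_mul, abs_pow]
    refine le_mul_of_one_le_right (by positivity) ?_
    exact_mod_cast Int.one_le_abs hs0
  have hqp : q * x 1 = p * x 0 := by rw [hq, hp]; ring
  have hx0R : (1 : ℝ) ≤ |(x 0 : ℝ)| := by exact_mod_cast Int.one_le_abs hx0
  have hxn : ‖x‖ ≤ 2 * powBound ξ * |(x 0 : ℝ)| := by
    have := norm_le_mul_abs_add_L ξ x
    nlinarith
  obtain ⟨k, hk⟩ : ∃ k : Fin 3, q * y k.succ - p * y k.castSucc ≠ 0 := by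
    by_contra! hall
    have z0 : q * y 1 - p * y 0 = 0 := hall 0
    have z1 : q * y 2 - p * y 1 = 0 := hall 1
    have z2 : q * y 3 - p * y 2 = 0 := hall 2
    have e4 : x 3 = p ^ 3 * s := by
      refine mul_left_cancel₀ hq0 ?_
      rw [e3, hs]; ring
    rw [hs] at e2 ht
    obtain ⟨k, hk⟩ := hxy
    apply hk
    fin_cases k
    · rfl
    · change y 0 * x 1 = y 1 * x 0
      rw [hq, hp]; linear_combination -g * z0
    · change y 0 * x 2 = y 2 * x 0
      rw [hq, e2, ht]; linear_combination -q ^ 2 * s * z1 - p * q * s * z0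
    · change y 0 * x 3 = y 3 * x 0
      rw [hq, e4, ht]
      linear_combination -q ^ 2 * s * z2 - p * q * s * z1 - p ^ 2 * s * z0
  have h1 : (1 : ℝ) ≤ |((q * y k.succ - p * y k.castSucc : ℤ) : ℝ)| := by
    exact_mod_cast Int.one_le_abs hk
  have hxp : 0 < |(x 0 : ℝ)| := by linarith
  have h2 : |(q : ℝ) * ξ - p| * |(x 0 : ℝ)| ≤ |(q : ℝ)| * L ξ x := by
    have h3 : ((q : ℝ) * ξ - p) * x 0 = q * (x 0 * ξ - x 1) := by
      have : (q : ℝ) * x 1 = p * x 0 := by exact_mod_cast hqp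
      linear_combination this
    rw [← abs_mul, h3, abs_mul]
    have := abs_sub_le_L ξ x 1
    simp only [Fin.val_one, pow_one] at this
    gcongr
  have h4 : |(q : ℝ) * ξ - p| * ‖y‖ ≤ 2 * powBound ξ * (|(q : ℝ)| * L ξ y) := by
    refine le_of_mul_le_mul_right ?_ hxp
    calc |(q : ℝ) * ξ - p| * ‖y‖ * |(x 0 : ℝ)| = |(q : ℝ) * ξ - p| * |(x 0 : ℝ)| * ‖y‖ := by ring
      _ ≤ |(q : ℝ)| * L ξ y * (2 * powBound ξ * |(x 0 : ℝ)|) := by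
          refine mul_le_mul (h2.trans (by gcongr)) (hn.trans hxn) (norm_nonneg _) (by positivity)
      _ = _ := by ring
  have h5 : (1 : ℝ) ≤ 4 * powBound ξ * (|(q : ℝ)| * L ξ y) := by
    have h6 : ((q * y k.succ - p * y k.castSucc : ℤ) : ℝ) =
        q * (y k.succ - ξ * y k.castSucc) + (q * ξ - p) * y k.castSucc := by push_cast; ring
    have h7 := abs_succ_sub_mul_le ξ y k
    have h8 := abs_coord_le y k.castSucc
    calc (1 : ℝ) ≤ _ := h1
      _ ≤ |(q : ℝ)| * |(y k.succ - ξ * y k.castSucc : ℝ)| + |(q * ξ - p : ℝ)| *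
            |(y k.castSucc : ℝ)| := by
          rw [h6, ← abs_mul, ← abs_mul]; exact abs_add_le _ _
      _ ≤ |(q : ℝ)| * (2 * powBound ξ * L ξ y) + |(q * ξ - p : ℝ)| * ‖y‖ := by gcongr
      _ ≤ |(q : ℝ)| * (2 * powBound ξ * L ξ y) + 2 * powBound ξ * (|(q : ℝ)| * L ξ y) := by
          gcongr
      _ = _ := by ring
  calc (1 : ℝ) ≤ (4 * powBound ξ * (|(q : ℝ)| * L ξ y)) ^ 3 := one_le_pow₀ h5
    _ = (4 * powBound ξ) ^ 3 * |(q : ℝ)| ^ 3 * L ξ y ^ 3 := by ring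
    _ ≤ (4 * powBound ξ) ^ 3 * ‖x‖ * L ξ y ^ 3 := by
        have := hqx.trans (abs_coord_le x 0)
        gcongr

/-! ### Minimal points -/

theorem range_pair {α : Type*} (a b : α) : Set.range ![a, b] = {a, b} := by
  ext v
  simp only [Set.mem_range, Fin.exists_fin_two, Matrix.cons_val_zero, Matrix.cons_val_one,
    Set.mem_insert_iff, Set.mem_singleton_iff, eq_comm]

namespace IsMinimalSeq

variable {ξ : ℝ} {x : ℕ → Fin 4 → ℤ}

theorem one_le_norm (hx : IsMinimalSeq ξ x) {i : ℕ} (hi : 1 ≤ i) : 1 ≤ ‖x i‖ :=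
  CubicApprox.one_le_norm (hx.ne_zero i hi)

theorem norm_lt_norm (hx : IsMinimalSeq ξ x) {i j : ℕ} (hi : 1 ≤ i) (hij : i < j) :
    ‖x i‖ < ‖x j‖ := by
  induction j, hij using Nat.le_induction with
  | base => exact hx.norm_lt i hi
  | succ j hj ih => exact ih.trans (hx.norm_lt j (by omega))

theorem norm_le_norm (hx : IsMinimalSeq ξ x) {i j : ℕ} (hi : 1 ≤ i) (hij : i ≤ j) :
    ‖x i‖ ≤ ‖x j‖ := by
  rcases hij.eq_or_lt with rfl | h
  · exact le_rfl
  · exact (hx.norm_lt_norm hi h).le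

theorem L_lt_L (hx : IsMinimalSeq ξ x) {i j : ℕ} (hi : 1 ≤ i) (hij : i < j) :
    L ξ (x j) < L ξ (x i) := by
  induction j, hij using Nat.le_induction with
  | base => exact hx.L_lt i hi
  | succ j hj ih => exact (hx.L_lt j (by omega)).trans ih

theorem L_le_L (hx : IsMinimalSeq ξ x) {i j : ℕ} (hi : 1 ≤ i) (hij : i ≤ j) :
    L ξ (x j) ≤ L ξ (x i) := by
  rcases hij.eq_or_lt with rfl | h
  · exact le_rfl
  · exact (hx.L_lt_L hi h).le

theorem natCast_le_norm (hx : IsMinimalSeq ξ x) {i : ℕ} (hi : 1 ≤ i) : (i : ℝ) ≤ ‖x i‖ := by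
  induction i, hi using Nat.le_induction with
  | base => simpa using hx.one_le_norm le_rfl
  | succ i hi ih =>
    push_cast
    linarith [norm_add_one_le (hx.norm_lt i hi)]

theorem L_le_one (hx : IsMinimalSeq ξ x) {i : ℕ} (hi : 1 ≤ i) : L ξ (x i) ≤ 1 := by
  by_contra! h
  -- the point `(0, 0, 0, 1)` is too short
  set e : Fin 4 → ℤ := Pi.single 3 1 with he
  have he0 : e ≠ 0 := by simp [he]
  have hL : L ξ e ≤ 1 := L_le_of zero_le_one fun k => by
    fin_cases k <;> simp [he]
  have hn : ‖e‖ ≤ 1 := norm_le_of_coord zero_le_one fun k => by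
    fin_cases k <;> simp [he]
  have h1 := hx.minimal i hi e he0 (hL.trans_lt h)
  linarith [hx.norm_lt i hi, hx.one_le_norm hi]

theorem linearIndependent_pair (hx : IsMinimalSeq ξ x) {i j : ℕ} (hi : 1 ≤ i) (hij : i < j) :
    LinearIndependent ℝ ![toReal 4 (x i), toReal 4 (x j)] := by
  rw [LinearIndependent.pair_iff' (fun h => hx.ne_zero i hi (funext fun k => by
    have := congrFun h k
    simpa [toReal_apply] using this))]
  intro s hs
  have hk : ∀ k, (x j k : ℝ) = s * x i k := fun k => by
    simpa [toReal_apply] using (congrFun hs k).symm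
  have hn : ‖x j‖ ≤ |s| * ‖x i‖ := norm_le_of_coord (by positivity) fun k => by
    rw [hk, abs_mul]
    exact mul_le_mul_of_nonneg_left (abs_coord_le _ _) (abs_nonneg _)
  have hL : |s| * L ξ (x i) ≤ L ξ (x j) := by
    rcases (abs_nonneg s).eq_or_lt with h | h
    · rw [← h, zero_mul]; exact L_nonneg _ _
    · rw [mul_comm, ← le_div_iff₀ h]
      refine L_le_of (div_nonneg (L_nonneg _ _) h.le) fun k => ?_
      rw [le_div_iff₀ h, ← abs_mul]
      have := abs_sub_le_L ξ (x j) k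
      rw [hk, hk] at this
      rwa [show ((x i 0 : ℝ) * ξ ^ (k : ℕ) - x i k) * s = s * x i 0 * ξ ^ (k : ℕ) - s * x i k
        by ring]
  have h1 := hx.norm_lt_norm hi hij
  have h2 := hx.L_lt_L hi hij
  have h3 : |s| ≤ 1 := by
    by_contra! h
    nlinarith [L_nonneg ξ (x i)]
  nlinarith [norm_nonneg (x i)]

theorem exists_plucker_ne_zero (hx : IsMinimalSeq ξ x) {i j : ℕ} (hi : 1 ≤ i) (hij : i < j) :
    ∃ k l, plucker (x i) (x j) k l ≠ 0 := by
  by_contra! h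
  obtain ⟨k, hk⟩ := Function.ne_iff.1 (hx.ne_zero i hi)
  have hli := LinearIndependent.pair_iff.1 (hx.linearIndependent_pair hi hij) (x j k) (-(x i k))
  have := hli (funext fun l => by
    have h1 := h k l
    unfold plucker at h1
    have h2 : (x i k : ℝ) * x j l - x i l * x j k = 0 := by exact_mod_cast h1
    simp only [Pi.add_apply, Pi.smul_apply, toReal_apply, smul_eq_mul, Pi.zero_apply]
    linarith)
  apply hk
  have h3 := this.2
  simpa using h3

theorem finrank_W (hx : IsMinimalSeq ξ x) {i : ℕ} (hi : 2 ≤ i) :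
    Module.finrank ℝ (W x i) = 2 := by
  have h := finrank_span_eq_card (hx.linearIndependent_pair (i := i - 1) (j := i) (by omega)
    (by omega))
  rw [range_pair] at h
  exact h.trans (by simp)

end IsMinimalSeq

theorem mem_W_self (x : ℕ → Fin 4 → ℤ) (i : ℕ) : toReal 4 (x i) ∈ W x i :=
  Submodule.subset_span (by simp)

theorem mem_W_pred (x : ℕ → Fin 4 → ℤ) (i : ℕ) : toReal 4 (x (i - 1)) ∈ W x i :=
  Submodule.subset_span (by simp)

theorem W_succ (x : ℕ → Fin 4 → ℤ) (i : ℕ) :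
    W x (i + 1) = Submodule.span ℝ {toReal 4 (x i), toReal 4 (x (i + 1))} := rfl

theorem W_eq_of_forall_notMem {x : ℕ → Fin 4 → ℤ} {m h : ℕ} (hm : 1 ≤ m) (hmh : m < h)
    (hI : ∀ k, m < k → k < h → k ∉ I x) : W x (m + 1) = W x h := by
  induction h, hmh using Nat.le_induction with
  | base => rfl
  | succ h hh ih =>
    rw [ih fun k h1 h2 => hI k h1 (by omega)]
    by_contra hne
    exact hI h (by omega) (by omega) ⟨by omega, hne⟩

namespace IsMinimalSeq

variable {ξ : ℝ} {x : ℕ → Fin 4 → ℤ}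

theorem notMem_W (hx : IsMinimalSeq ξ x) {h : ℕ} (hh : h ∈ I x) :
    toReal 4 (x (h + 1)) ∉ W x h := by
  intro hmem
  apply hh.2
  have hle : W x (h + 1) ≤ W x h := by
    rw [W_succ, Submodule.span_le]
    rintro _ (rfl | rfl)
    · exact mem_W_self x h
    · exact hmem
  refine (Submodule.eq_of_le_of_finrank_eq hle ?_).symm
  rw [hx.finrank_W hh.1, hx.finrank_W (by have := hh.1; omega)]

theorem linearIndependent_triple (hx : IsMinimalSeq ξ x) {m h : ℕ} (hm : 1 ≤ m)
    (hh : h ∈ I x) (hW : W x (m + 1) = W x h) :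
    LinearIndependent ℝ fun i => toReal 4 (![x m, x (m + 1), x (h + 1)] i) := by
  have h1 : (fun i => toReal 4 (![x m, x (m + 1), x (h + 1)] i)) =
      Fin.snoc ![toReal 4 (x m), toReal 4 (x (m + 1))] (toReal 4 (x (h + 1))) := by
    funext i
    fin_cases i <;> rfl
  rw [h1, linearIndependent_finSnoc]
  refine ⟨hx.linearIndependent_pair hm (by omega), ?_⟩
  have h2 := hx.notMem_W hh
  rw [← hW, W_succ] at h2
  rwa [range_pair]

theorem U_eq_span {m h : ℕ} (hW : W x (m + 1) = W x h) :
    U x h = Submodule.span ℝ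
      (Set.range fun i => toReal 4 (![x m, x (m + 1), x (h + 1)] i)) := by
  have h1 : (Set.range fun i => toReal 4 (![x m, x (m + 1), x (h + 1)] i)) =
      {toReal 4 (x m), toReal 4 (x (m + 1)), toReal 4 (x (h + 1))} := by
    ext v
    simp [Fin.exists_fin_succ, eq_comm]
  have h2 : U x h = W x h ⊔ Submodule.span ℝ {toReal 4 (x (h + 1))} := by
    rw [U, W_succ x h, Submodule.span_insert, ← sup_assoc, sup_eq_left.2
      ((Submodule.span_singleton_le_iff_mem _ _).2 (mem_W_self x h))]
  rw [h1, h2, ← hW, W_succ, ← Submodule.span_union]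
  congr 1
  ext v
  simp only [Set.mem_union, Set.mem_insert_iff, Set.mem_singleton_iff, or_assoc]

/-- A uniform bound for `L` along every sequence of minimal points. -/
theorem exists_L_le {lam : ℝ} (hlam : 0 < lam) (happ : UniformlyApproximable ξ lam) :
    ∃ c : ℝ, 0 < c ∧ ∀ x, IsMinimalSeq ξ x → ∀ i, 1 ≤ i →
      L ξ (x i) ≤ c * ‖x (i + 1)‖ ^ (-lam) := by
  obtain ⟨c, hc, happ⟩ := happ
  obtain ⟨Y, hY⟩ := eventually_atTop.1 happ
  have hM := one_le_powBound ξ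
  set M := powBound ξ
  set Y' := max Y 1
  have hB : 1 ≤ M * Y' + 1 := by
    have : 0 ≤ M * Y' := by positivity
    linarith
  refine ⟨max (c * (2 * M) ^ lam) ((M * Y' + 1) ^ lam), by positivity, fun x hx i hi => ?_⟩
  have hX2 : 2 ≤ ‖x (i + 1)‖ := by
    linarith [norm_add_one_le (hx.norm_lt i hi), hx.one_le_norm hi]
  set X := ‖x (i + 1)‖ with hX
  have hXp : 0 < X := by linarith
  have hpow : 0 < X ^ (-lam) := Real.rpow_pos_of_pos hXp _
  rcases lt_or_ge ((X - 1) / M) Y' with hlt | hge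
  · have h1 : X ≤ M * Y' + 1 := by
      rw [div_lt_iff₀ (by linarith)] at hlt
      linarith
    refine (hx.L_le_one hi).trans ?_
    have h2 : 1 ≤ (M * Y' + 1) ^ lam * X ^ (-lam) := by
      rw [Real.rpow_neg hXp.le, ← div_eq_mul_inv, one_le_div (Real.rpow_pos_of_pos hXp _)]
      exact Real.rpow_le_rpow hXp.le h1 hlam.le
    exact h2.trans (mul_le_mul_of_nonneg_right (le_max_right _ _) hpow.le)
  · obtain ⟨y, hy0, hyX, hyL⟩ := hY ((X - 1) / M) ((le_max_left _ _).trans hge)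
    have h1 : L ξ (x i) ≤ L ξ y := by
      by_contra! hlt
      have h2 := hx.minimal i hi y hy0 hlt
      have h3 := norm_le_mul_abs_add_L ξ y
      have h4 : M * |(y 0 : ℝ)| ≤ X - 1 := by
        rw [le_div_iff₀ (by linarith)] at hyX
        linarith
      linarith [hx.L_le_one hi]
    refine (h1.trans hyL).trans ?_
    have h5 : X / (2 * M) ≤ (X - 1) / M := by
      rw [div_le_div_iff₀ (by linarith) (by linarith)]
      nlinarith
    have h6 : ((X - 1) / M) ^ (-lam) ≤ (2 * M) ^ lam * X ^ (-lam) := by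
      calc ((X - 1) / M) ^ (-lam) ≤ (X / (2 * M)) ^ (-lam) :=
            Real.rpow_le_rpow_of_nonpos (by positivity) h5 (by linarith)
        _ = (2 * M) ^ lam * X ^ (-lam) := by
            rw [Real.div_rpow hXp.le (by positivity), Real.rpow_neg (by positivity : 0 ≤ 2 * M),
              div_inv_eq_mul, mul_comm]
    calc c * ((X - 1) / M) ^ (-lam) ≤ c * ((2 * M) ^ lam * X ^ (-lam)) := by gcongr
      _ = c * (2 * M) ^ lam * X ^ (-lam) := by ring
      _ ≤ _ := mul_le_mul_of_nonneg_right (le_max_left _ _) hpow.le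

end IsMinimalSeq

/-- `c` bounds `L` along all sequences of minimal points, relative to the exponent `lam`. -/
def ApproxBound (ξ lam c : ℝ) : Prop :=
  0 < c ∧ ∀ x, IsMinimalSeq ξ x → ∀ i, 1 ≤ i → L ξ (x i) ≤ c * ‖x (i + 1)‖ ^ (-lam)

/-- Three integer points of `ℤ⁴` lie in a rational hyperplane. -/
theorem exists_form (u v w : Fin 4 → ℤ) :
    ∃ q : Fin 4 → ℤ, q ≠ 0 ∧ q ⬝ᵥ u = 0 ∧ q ⬝ᵥ v = 0 ∧ q ⬝ᵥ w = 0 := by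
  have hdet : (Matrix.of ![u, v, w, 0]).det = 0 :=
    Matrix.det_eq_zero_of_row_eq_zero 3 fun _ => rfl
  obtain ⟨q, hq, h⟩ := Matrix.exists_mulVec_eq_zero_iff.2 hdet
  refine ⟨q, hq, ?_, ?_, ?_⟩ <;> rw [dotProduct_comm]
  · exact congrFun h 0
  · exact congrFun h 1
  · exact congrFun h 2

theorem dot_eq_zero_of_mem_span {q u v z : Fin 4 → ℤ} (hu : q ⬝ᵥ u = 0) (hv : q ⬝ᵥ v = 0)
    (hz : toReal 4 z ∈ Submodule.span ℝ {toReal 4 u, toReal 4 v}) : q ⬝ᵥ z = 0 := by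
  obtain ⟨s, t, hst⟩ := Submodule.mem_span_pair.1 hz
  have hk : ∀ k, (z k : ℝ) = s * u k + t * v k := fun k => by
    simpa [toReal_apply] using (congrFun hst k).symm
  have hu' : ((q ⬝ᵥ u : ℤ) : ℝ) = 0 := by rw [hu, Int.cast_zero]
  have hv' : ((q ⬝ᵥ v : ℤ) : ℝ) = 0 := by rw [hv, Int.cast_zero]
  have : ((q ⬝ᵥ z : ℤ) : ℝ) = 0 := by
    simp only [dotProduct, Fin.sum_univ_four, Int.cast_add, Int.cast_mul] at hu' hv' ⊢
    rw [hk, hk, hk, hk]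
    linear_combination s * hu' + t * hv'
  exact_mod_cast this

theorem Recurs.of_mem_span {a : Fin 3 → ℤ} {u v z : Fin 4 → ℤ} (hu : Recurs a u) (hv : Recurs a v)
    (hz : toReal 4 z ∈ Submodule.span ℝ {toReal 4 u, toReal 4 v}) : Recurs a z :=
  ⟨dot_eq_zero_of_mem_span hu.1 hv.1 hz, dot_eq_zero_of_mem_span hu.2 hv.2 hz⟩

theorem ApproxBound.exists_norm_succ_le {ξ lam c : ℝ} (hξ : 3 < Module.rank ℚ ℚ⟮ξ⟯)
    (hlam : 0 < lam) (hc : ApproxBound ξ lam c) (B : ℝ) :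
    ∃ B' : ℝ, ∀ x, IsMinimalSeq ξ x → ∀ i, 1 ≤ i → ‖x i‖ ≤ B → ‖x (i + 1)‖ ≤ B' := by
  obtain ⟨ε, hε, h⟩ := exists_L_lower hξ B
  refine ⟨(c / ε) ^ lam⁻¹, fun x hx i hi hB => ?_⟩
  have h1 := (h _ (hx.ne_zero i hi) hB).trans (hc.2 x hx i hi)
  have hX : 0 < ‖x (i + 1)‖ := by linarith [hx.one_le_norm (i := i + 1) (by omega)]
  rw [Real.rpow_neg hX.le, ← div_eq_mul_inv, le_div_iff₀ (Real.rpow_pos_of_pos hX _),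
    ← le_div_iff₀' hε] at h1
  exact (Real.le_rpow_inv_iff_of_pos hX.le (div_nonneg hc.1.le hε.le) hlam).2 h1

/-- The minimal points in a plane spanned by two consecutive minimal points of bounded norm are
bounded, uniformly over all sequences of minimal points; hence so are their successors. -/
theorem ApproxBound.exists_norm_succ_le_of_mem_span {ξ lam c : ℝ}
    (hξ : 3 < Module.rank ℚ ℚ⟮ξ⟯) (hlam : 0 < lam) (hc : ApproxBound ξ lam c) (B : ℝ) :
    ∃ B' : ℝ, ∀ x, IsMinimalSeq ξ x → ∀ m, 1 ≤ m → ‖x m‖ ≤ B → ∀ i, 1 ≤ i →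
      toReal 4 (x i) ∈ W x (m + 1) → ‖x (i + 1)‖ ≤ B' := by
  obtain ⟨B₁, hB₁⟩ := hc.exists_norm_succ_le hξ hlam B
  have hC : ∀ p : (Fin 4 → ℤ) × (Fin 4 → ℤ), ∃ C : ℝ, 0 < C ∧ ∀ z : Fin 4 → ℤ,
      toReal 4 z ∈ Submodule.span ℝ {toReal 4 p.1, toReal 4 p.2} → ‖z‖ ≤ C * L ξ z := by
    intro p
    obtain ⟨q, hq, h1, h2, -⟩ := exists_form p.1 p.2 0
    obtain ⟨C, hC0, hC⟩ := norm_le_of_dot_eq_zero hξ hq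
    exact ⟨C, hC0, fun z hz => hC z (dot_eq_zero_of_mem_span h1 h2 hz)⟩
  choose C hC0 hC using hC
  obtain ⟨D, hD⟩ := (((finite_norm_le B).prod (finite_norm_le B₁)).image C).bddAbove
  obtain ⟨B₂, hB₂⟩ := hc.exists_norm_succ_le hξ hlam D
  refine ⟨B₂, fun x hx m hm hmB i hi hmem => hB₂ x hx i hi ?_⟩
  have h1 : C (x m, x (m + 1)) ≤ D := hD (Set.mem_image_of_mem C
    (show (x m, x (m + 1)) ∈ {x | ‖x‖ ≤ B} ×ˢ {x | ‖x‖ ≤ B₁} from ⟨hmB, hB₁ x hx m hm hmB⟩))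
  have h2 := hC (x m, x (m + 1)) (x i) hmem
  nlinarith [hx.L_le_one hi, hC0 (x m, x (m + 1)), L_nonneg ξ (x i)]

/-! ### The set `I` -/

theorem consecutive_iff {x : ℕ → Fin 4 → ℤ} {i j : ℕ} :
    Consecutive x i j ↔ i ∈ I x ∧ j ∈ I x ∧ i < j ∧ ∀ k, i < k → k < j → k ∉ I x := by
  constructor
  · rintro ⟨hi, ⟨hj, hij⟩, hmin⟩
    exact ⟨hi, hj, hij, fun k h1 h2 hk => absurd (hmin ⟨hk, h1⟩) (by omega)⟩
  · rintro ⟨hi, hj, hij, h⟩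
    exact ⟨hi, ⟨hj, hij⟩, fun k hk => by by_contra! hlt; exact h k hk.2 hlt hk.1⟩

theorem Consecutive.two_le {x : ℕ → Fin 4 → ℤ} {i j : ℕ} (h : Consecutive x i j) : 2 ≤ i :=
  h.1.1

theorem Consecutive.lt {x : ℕ → Fin 4 → ℤ} {i j : ℕ} (h : Consecutive x i j) : i < j :=
  h.2.1.2

theorem Consecutive.mem_right {x : ℕ → Fin 4 → ℤ} {i j : ℕ} (h : Consecutive x i j) : j ∈ I x :=
  h.2.1.1

theorem Consecutive.unique {x : ℕ → Fin 4 → ℤ} {i j k : ℕ} (h : Consecutive x i j)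
    (h' : Consecutive x i k) : j = k := h.2.unique h'.2

theorem Consecutive.W_eq {x : ℕ → Fin 4 → ℤ} {i j : ℕ} (h : Consecutive x i j) :
    W x (i + 1) = W x j := by
  obtain ⟨hi, -, hij, hk⟩ := consecutive_iff.1 h
  exact W_eq_of_forall_notMem (by have := hi.1; omega) hij hk

theorem exists_pred_of_mem {x : ℕ → Fin 4 → ℤ} {i m : ℕ} (hi : i ∈ I x) (hm : m ∈ I x)
    (hmi : m < i) : ∃ h, m ≤ h ∧ Consecutive x h i := by
  classical
  set h := Nat.findGreatest (fun k => k ∈ I x) (i - 1) with hh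
  have h1 : h ∈ I x := Nat.findGreatest_spec (P := fun k => k ∈ I x) (m := m) (by omega) hm
  have h2 : h ≤ i - 1 := Nat.findGreatest_le _
  refine ⟨h, Nat.le_findGreatest (by omega) hm, consecutive_iff.2 ⟨h1, hi, by omega, ?_⟩⟩
  intro k hk hki
  exact Nat.findGreatest_is_greatest hk (by omega)

theorem exists_succ_of_infinite {x : ℕ → Fin 4 → ℤ} (hI : (I x).Infinite) {i : ℕ}
    (hi : i ∈ I x) : ∃ j, Consecutive x i j := by
  classical
  obtain ⟨k, hk, hik⟩ := hI.exists_gt i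
  have hex : ∃ k, k ∈ I x ∧ i < k := ⟨k, hk, hik⟩
  exact ⟨Nat.find hex, hi, Nat.find_spec hex, fun k hk => Nat.find_min' hex hk⟩

/-! ### Growth of the minimal points at the elements of `I` -/

/-- The logarithm of `‖x i‖`. -/
noncomputable def logN (x : ℕ → Fin 4 → ℤ) (i : ℕ) : ℝ := Real.log ‖x i‖

/-- The logarithm of `L ξ (x i)`. -/
noncomputable def logL (ξ : ℝ) (x : ℕ → Fin 4 → ℤ) (i : ℕ) : ℝ := Real.log (L ξ (x i))

theorem log_nonneg_of_one_le_mul {K A B : ℝ} (hK : 0 < K) (hA : 0 < A) (hB : 0 < B)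
    (h : 1 ≤ K * (A * B)) : 0 ≤ Real.log K + (Real.log A + Real.log B) := by
  rw [← Real.log_mul hA.ne' hB.ne', ← Real.log_mul hK.ne' (mul_pos hA hB).ne']
  exact Real.log_nonneg h

namespace IsMinimalSeq

variable {ξ : ℝ} {x : ℕ → Fin 4 → ℤ}

theorem norm_pos (hx : IsMinimalSeq ξ x) {i : ℕ} (hi : 1 ≤ i) : 0 < ‖x i‖ := by
  linarith [hx.one_le_norm hi]

theorem logN_nonneg (hx : IsMinimalSeq ξ x) {i : ℕ} (hi : 1 ≤ i) : 0 ≤ logN x i :=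
  Real.log_nonneg (hx.one_le_norm hi)

theorem logN_le_logN (hx : IsMinimalSeq ξ x) {i j : ℕ} (hi : 1 ≤ i) (hij : i ≤ j) :
    logN x i ≤ logN x j :=
  Real.log_le_log (hx.norm_pos hi) (hx.norm_le_norm hi hij)

theorem L_pos (hx : IsMinimalSeq ξ x) (hξ : 3 < Module.rank ℚ ℚ⟮ξ⟯) {i : ℕ} (hi : 1 ≤ i) :
    0 < L ξ (x i) := CubicApprox.L_pos hξ (hx.ne_zero i hi)

end IsMinimalSeq

variable {ξ lam θ c : ℝ}

theorem ApproxBound.logL_le (hc : ApproxBound ξ lam c) (hξ : 3 < Module.rank ℚ ℚ⟮ξ⟯)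
    {x : ℕ → Fin 4 → ℤ} (hx : IsMinimalSeq ξ x) {i : ℕ} (hi : 1 ≤ i) :
    logL ξ x i ≤ Real.log c - lam * logN x (i + 1) := by
  have hX := hx.norm_pos (i := i + 1) (by omega)
  refine (Real.log_le_log (hx.L_pos hξ hi) (hc.2 x hx i hi)).trans ?_
  rw [Real.log_mul hc.1.ne' (Real.rpow_pos_of_pos hX _).ne', Real.log_rpow hX, logN]
  linarith

/-- For large `i`, the coordinates of `x i` are not in geometric progression. -/
theorem ApproxBound.exists_hankel_ne_zero (hc : ApproxBound ξ lam c)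
    (hξ : 3 < Module.rank ℚ ℚ⟮ξ⟯) (hlam : 1 / 3 < lam) :
    ∃ B : ℝ, ∀ x, IsMinimalSeq ξ x → ∀ i, 2 ≤ i → B ≤ logN x i → hankel (x i) ≠ 0 := by
  have hM := one_le_powBound ξ
  set κ := Real.log ((4 * powBound ξ) ^ 3) + 3 * Real.log c
  refine ⟨max 1 (κ / (3 * lam - 1) + 1), fun x hx i hi hB h0 => ?_⟩
  have h1 : 1 ≤ logN x i := (le_max_left _ _).trans hB
  have h2 : κ / (3 * lam - 1) + 1 ≤ logN x i := (le_max_right _ _).trans hB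
  obtain ⟨m, rfl⟩ : ∃ m, i = m + 1 := ⟨i - 1, by omega⟩
  have hx0 : x (m + 1) 0 ≠ 0 := by
    intro h
    have h3 := norm_le_mul_abs_add_L ξ (x (m + 1))
    rw [h, Int.cast_zero, abs_zero, mul_zero, zero_add] at h3
    have := Real.log_nonpos (norm_nonneg _) (h3.trans (hx.L_le_one (by omega)))
    unfold logN at h1
    linarith
  have hxy : ∃ k, x m 0 * x (m + 1) k ≠ x m k * x (m + 1) 0 := by
    by_contra! hall
    have hli := LinearIndependent.pair_iff.1
      (hx.linearIndependent_pair (i := m) (j := m + 1) (by omega) (by omega))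
      (x (m + 1) 0) (-(x m 0))
    have := (hli (funext fun l => by
      have h4 : (x m 0 : ℝ) * x (m + 1) l = x m l * x (m + 1) 0 := by exact_mod_cast hall l
      simp only [Pi.add_apply, Pi.smul_apply, toReal_apply, smul_eq_mul, Pi.zero_apply]
      linarith)).1
    exact hx0 (by exact_mod_cast this)
  have h5 := one_le_of_hankel_eq_zero h0 hx0 (hx.L_le_one (by omega)) hxy
    (hx.L_le_L (i := m) (by omega) (by omega)) (hx.norm_le_norm (by omega) (by omega))
  have hLp := hx.L_pos hξ (i := m) (by omega)
  have h6 := log_nonneg_of_one_le_mul (K := (4 * powBound ξ) ^ 3) (by positivity)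
    (hx.norm_pos (i := m + 1) (by omega)) (pow_pos hLp 3) (by rwa [← mul_assoc])
  rw [Real.log_pow (L ξ (x m)) 3] at h6
  have h7 := hc.logL_le hξ hx (i := m) (by omega)
  unfold logL at h7
  have h8 : (3 * lam - 1) * logN x (m + 1) ≤ κ := by
    unfold logN at h7 ⊢
    push_cast at h6
    linarith
  have h9 : 0 < 3 * lam - 1 := by linarith
  have h10 : logN x (m + 1) ≤ κ / (3 * lam - 1) := by
    rw [le_div_iff₀ h9]; linarith
  linarith

theorem one_le_of_not_recurs {a : Fin 3 → ℤ} {y z : Fin 4 → ℤ} (hy : ¬ Recurs a y)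
    (hz : Recurs a z) (hz0 : z ≠ 0) (hL : L ξ z ≤ L ξ y) (hn : ‖y‖ ≤ ‖z‖) :
    1 ≤ 16 * powBound ξ * ‖a‖ * L ξ y := by
  have hM := one_le_powBound ξ
  have hLy := L_nonneg ξ y
  have key : ∀ q : Fin 4 → ℤ, ‖q‖ ≤ ‖a‖ → q ⬝ᵥ z = 0 → q ⬝ᵥ y ≠ 0 →
      1 ≤ 16 * powBound ξ * ‖a‖ * L ξ y := fun q hq hqz hqy => by
    have h1 : (1 : ℝ) ≤ |((q ⬝ᵥ y : ℤ) : ℝ)| := by exact_mod_cast Int.one_le_abs hqy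
    refine (h1.trans (abs_dot_le_of_le hz0 hqz hL hn)).trans ?_
    gcongr
  rw [Recurs, not_and_or] at hy
  rcases hy with h | h
  · exact key _ (norm_lowForm_le a) hz.1 h
  · exact key _ (norm_highForm_le a) hz.2 h

theorem ApproxBound.exists_mul_logN_succ_le (hc : ApproxBound ξ lam c)
    (hξ : 3 < Module.rank ℚ ℚ⟮ξ⟯) :
    ∃ κ : ℝ, ∀ x, IsMinimalSeq ξ x → ∀ i, 1 ≤ i → ¬ Recurs (hankel (x (i + 1))) (x i) →
      lam * logN x (i + 2) ≤ (1 - lam) * logN x (i + 1) + κ := by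
  have hM := one_le_powBound ξ
  refine ⟨Real.log (64 * powBound ξ ^ 2) + 2 * Real.log c, fun x hx i hi hr => ?_⟩
  have h1 := one_le_of_not_recurs hr (recurs_hankel _) (hx.ne_zero _ (by omega))
    (hx.L_le_L hi (by omega)) (hx.norm_le_norm hi (by omega))
  have hLp := hx.L_pos hξ hi
  have hLp' := hx.L_pos hξ (i := i + 1) (by omega)
  have hXp := hx.norm_pos (i := i + 1) (by omega)
  have h2 : 1 ≤ 64 * powBound ξ ^ 2 * (‖x (i + 1)‖ * (L ξ (x (i + 1)) * L ξ (x i))) := by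
    calc (1 : ℝ) ≤ _ := h1
      _ ≤ 16 * powBound ξ * (4 * powBound ξ * (‖x (i + 1)‖ * L ξ (x (i + 1)))) * L ξ (x i) := by
        gcongr
        exact norm_hankel_le ξ _
      _ = _ := by ring
  have h3 := log_nonneg_of_one_le_mul (by positivity) hXp (mul_pos hLp' hLp) h2
  rw [Real.log_mul hLp'.ne' hLp.ne'] at h3
  have h4 := hc.logL_le hξ hx hi
  have h5 := hc.logL_le hξ hx (i := i + 1) (by omega)
  unfold logL logN at *
  linarith

/-- For large `h` in `I`, the points `x h` and `x (h + 1)` do not satisfy a common linear recurrence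
of order two. Otherwise, for primitive coefficients `a`, the point `x (h - 1)` violates the
recurrence, whence `1 ≪ ‖a‖ L_{h-1}`, and `‖a‖ ^ 2` is at most of the size of the Plücker
coordinates of `x h` and `x (h + 1)`. Since `hankel (x h)` is a multiple of `a`, it follows moreover that
`X_{h+1} ≪ X_h ^ θ`, and these estimates are incompatible when `θ ^ 2 < 2`. -/
theorem ApproxBound.exists_eq_zero_of_recurs (hc : ApproxBound ξ lam c)
    (hξ : 3 < Module.rank ℚ ℚ⟮ξ⟯) (hlam : 0 < lam) (hθ : lam * (1 + θ) = 1) (hθ0 : 0 < θ)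
    (hθ2 : θ ^ 2 < 2) :
    ∃ B : ℝ, ∀ x, IsMinimalSeq ξ x → ∀ h, h ∈ I x → B ≤ logN x h →
      ∀ a, Recurs a (x h) → Recurs a (x (h + 1)) → a = 0 := by
  have hM := one_le_powBound ξ
  have hlam3 : 1 / 3 < lam := by nlinarith
  obtain ⟨B₀, hB₀⟩ := hc.exists_hankel_ne_zero hξ hlam3
  obtain ⟨κ, hκ⟩ := hc.exists_mul_logN_succ_le hξ
  set κ₁ := Real.log ((16 * powBound ξ) ^ 2 * (64 * powBound ξ)) + 3 * Real.log c + θ * κ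
  refine ⟨max B₀ (κ₁ / (lam * (2 - θ ^ 2)) + 1), fun x hx h hh hB a ha ha' => ?_⟩
  by_contra ha0
  obtain ⟨m, rfl⟩ : ∃ m, h = m + 1 := ⟨h - 1, by have := hh.1; omega⟩
  have hm : 1 ≤ m := by have := hh.1; omega
  obtain ⟨d, b, r, hd, rfl, hr⟩ := exists_smul_primitive ha0
  have hsmul : ∀ z, Recurs (d • b) z → Recurs b z := fun z hz => by
    rw [recurs_iff] at hz ⊢
    simp only [Pi.smul_apply, smul_eq_mul] at hz
    constructor
    · refine mul_left_cancel₀ hd ?_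
      linear_combination hz.1
    · refine mul_left_cancel₀ hd ?_
      linear_combination hz.2
  have hb := hsmul _ ha
  have hb' := hsmul _ ha'
  have hnot : ¬ Recurs b (x m) := fun hbm => by
    have := eq_zero_of_recurs (hx.linearIndependent_triple hm hh rfl) (a := b) (fun i => by
      fin_cases i
      · exact hbm
      · exact hb
      · exact hb')
    rw [this] at hr
    simp at hr
  -- the vector `hankel (x h)` is a multiple of `b`
  have hne := hB₀ x hx (m + 1) (by omega) ((le_max_left _ _).trans hB)
  have hnot' : ¬ Recurs (hankel (x (m + 1))) (x m) := fun hrec => by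
    obtain ⟨b1, b2⟩ := recurs_iff.1 hb
    obtain ⟨t, e0, e1, e2⟩ := eq_mul_of_parallel' hr (hankel (x (m + 1)) 0)
      (hankel (x (m + 1)) 1) (hankel (x (m + 1)) 2)
      (by simp only [hankel, Matrix.cons_val]
          linear_combination x (m + 1) 3 * b1 - x (m + 1) 2 * b2)
      (by simp only [hankel, Matrix.cons_val]
          linear_combination -x (m + 1) 2 * b1 + x (m + 1) 1 * b2)
      (by simp only [hankel, Matrix.cons_val]
          linear_combination x (m + 1) 1 * b1 - x (m + 1) 0 * b2)
    have ht : t ≠ 0 := by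
      rintro rfl
      simp only [zero_mul] at e0 e1 e2
      exact hne (funext fun k => by fin_cases k <;> assumption)
    apply hnot
    rw [recurs_iff] at hrec ⊢
    rw [e0, e1, e2] at hrec
    constructor
    · refine mul_left_cancel₀ ht ?_
      linear_combination hrec.1
    · refine mul_left_cancel₀ ht ?_
      linear_combination hrec.2
  have h1 := hκ x hx m hm hnot'
  have h2 := one_le_of_not_recurs hnot hb (hx.ne_zero _ (by omega))
    (hx.L_le_L hm (by omega)) (hx.norm_le_norm hm (by omega))
  have h3 := sq_norm_le_of_recurs hr hb hb'
    (hx.exists_plucker_ne_zero (i := m + 1) (j := m + 1 + 1) (by omega) (by omega))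
    (abs_plucker_le ξ (hx.ne_zero _ (by omega))
      (hx.L_le_L (i := m + 1) (j := m + 1 + 1) (by omega) (by omega))
      (hx.norm_le_norm (i := m + 1) (j := m + 1 + 1) (by omega) (by omega)))
  have hLp := hx.L_pos hξ hm
  have hLp' := hx.L_pos hξ (i := m + 1) (by omega)
  have hXp := hx.norm_pos (i := m + 2) (by omega)
  have h4 : 1 ≤ ((16 * powBound ξ) ^ 2 * (64 * powBound ξ)) *
      (‖x (m + 2)‖ * (L ξ (x (m + 1)) * L ξ (x m) ^ 2)) := by
    calc (1 : ℝ) ≤ (16 * powBound ξ * ‖b‖ * L ξ (x m)) ^ 2 := one_le_pow₀ h2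
      _ = (16 * powBound ξ) ^ 2 * L ξ (x m) ^ 2 * ‖b‖ ^ 2 := by ring
      _ ≤ (16 * powBound ξ) ^ 2 * L ξ (x m) ^ 2 *
          (2 * (32 * powBound ξ * (‖x (m + 2)‖ * L ξ (x (m + 1))))) := by gcongr
      _ = _ := by ring
  have h5 := log_nonneg_of_one_le_mul (by positivity) hXp (mul_pos hLp' (pow_pos hLp 2)) h4
  rw [Real.log_mul hLp'.ne' (pow_pos hLp 2).ne', Real.log_pow] at h5
  have h6 := hc.logL_le hξ hx hm
  have h7 := hc.logL_le hξ hx (i := m + 1) (by omega)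
  have h8 : lam * (2 - θ ^ 2) * logN x (m + 1) ≤ κ₁ := by
    have e1 : 1 - lam = lam * θ := by linarith
    rw [e1] at h1
    have h9 : lam * logN x (m + 2) * θ ≤ (lam * θ * logN x (m + 1) + κ) * θ :=
      mul_le_mul_of_nonneg_right h1 hθ0.le
    have h10 : logN x (m + 2) - lam * logN x (m + 2) = lam * logN x (m + 2) * θ := by
      linear_combination logN x (m + 2) * e1
    unfold logL at *
    unfold logN at *
    push_cast at h5
    simp only [κ₁]
    nlinarith
  have h11 : 0 < lam * (2 - θ ^ 2) := mul_pos hlam (by linarith)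
  have h12 : logN x (m + 1) ≤ κ₁ / (lam * (2 - θ ^ 2)) := by
    rw [le_div_iff₀ h11]; linarith
  have := (le_max_right _ _).trans hB
  linarith

/-- A sequence of minimal points that starts far from the origin can be extended backwards. -/
theorem ApproxBound.exists_extend (hc : ApproxBound ξ lam c) (hξ : 3 < Module.rank ℚ ℚ⟮ξ⟯)
    (hlam : 0 < lam) :
    ∃ B : ℝ, ∀ x, IsMinimalSeq ξ x → B ≤ ‖x 1‖ →
      ∃ x', IsMinimalSeq ξ x' ∧ ‖x' 1‖ < ‖x 1‖ ∧ ∀ i, 1 ≤ i → x' (i + 1) = x i := by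
  refine ⟨max 2 ((4 * c) ^ lam⁻¹), fun x hx hB => ?_⟩
  have hx2 : 2 ≤ ‖x 1‖ := (le_max_left _ _).trans hB
  have hx1 : 0 < ‖x 1‖ := by linarith
  have hL1 : L ξ (x 1) ≤ 1 / 4 := by
    have h1 := hc.2 x hx 1 le_rfl
    have hXp := hx.norm_pos (i := 1 + 1) (by omega)
    have h2 : (4 * c) ^ lam⁻¹ ≤ ‖x (1 + 1)‖ :=
      ((le_max_right _ _).trans hB).trans (hx.norm_lt 1 le_rfl).le
    have h3 : 4 * c ≤ ‖x (1 + 1)‖ ^ lam :=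
      (Real.rpow_inv_le_iff_of_pos (by have := hc.1; positivity) hXp.le hlam).1 h2
    rw [Real.rpow_neg hXp.le, ← div_eq_mul_inv] at h1
    refine h1.trans ?_
    rw [div_le_div_iff₀ (Real.rpow_pos_of_pos hXp _) (by norm_num)]
    linarith
  -- the new point minimizes `L` among the points shorter than `x 1`
  set S : Set (Fin 4 → ℤ) := {z | z ≠ 0 ∧ ‖z‖ < ‖x 1‖} with hS
  have hSfin : S.Finite := (finite_norm_le ‖x 1‖).subset fun z hz => hz.2.le
  have hSne : S.Nonempty := by
    refine ⟨Pi.single 3 1, by simp, lt_of_le_of_lt ?_ (by linarith : (1 : ℝ) < ‖x 1‖)⟩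
    exact norm_le_of_coord zero_le_one fun k => by fin_cases k <;> simp
  obtain ⟨z, hz, hmin⟩ := hSfin.exists_minimalFor (L ξ) S hSne
  have hmin' : ∀ y ∈ S, L ξ z ≤ L ξ y := fun y hy => by
    rcases le_total (L ξ z) (L ξ y) with h | h
    · exact h
    · exact hmin hy h
  have hlt : L ξ (x 1) < L ξ z := by
    by_contra! hle
    have hge : L ξ (x 1) ≤ L ξ z := by
      by_contra! h
      linarith [hx.minimal 1 le_rfl z hz.1 h, hx.norm_lt 1 le_rfl, hz.2]
    have heq : L ξ z = L ξ (x 1) := le_antisymm hle hge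
    -- a point with first coordinate zero has `L ≥ 1`
    have hzero : ∀ w : Fin 4 → ℤ, w 0 = 0 → L ξ w < 1 → w = 0 := fun w hw0 hwL => by
      by_contra hw
      have h1 := norm_le_mul_abs_add_L ξ w
      rw [hw0, Int.cast_zero, abs_zero, mul_zero, zero_add] at h1
      linarith [CubicApprox.one_le_norm hw]
    have hx0 : x 1 0 ≠ 0 := fun h => hx.ne_zero 1 le_rfl (hzero _ h (by linarith))
    -- the maximum in `L` is attained at some coordinate, for both points
    have hatt : ∀ w : Fin 4 → ℤ, ∃ k : Fin 3,
        L ξ w = |(w 0 : ℝ) * ξ ^ ((k : ℕ) + 1) - w k.succ| := fun w => by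
      obtain ⟨k, -, hk⟩ := Finset.exists_mem_eq_sup' (s := (Finset.univ : Finset (Fin 3)))
        ⟨0, Finset.mem_univ _⟩ (fun k : Fin 3 => |(w 0 : ℝ) * ξ ^ ((k : ℕ) + 1) - w k.succ|)
      refine ⟨k, le_antisymm ?_ (by simpa using abs_sub_le_L ξ w k.succ)⟩
      rw [← hk]
      refine L_le_of ((abs_nonneg _).trans (Finset.le_sup' (fun k : Fin 3 =>
        |(w 0 : ℝ) * ξ ^ ((k : ℕ) + 1) - w k.succ|) (Finset.mem_univ 0))) fun l => ?_
      refine Fin.cases ?_ (fun l => ?_) l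
      · simp only [Fin.val_zero, pow_zero, mul_one, sub_self, abs_zero]
        exact (abs_nonneg _).trans (Finset.le_sup' (fun k : Fin 3 =>
          |(w 0 : ℝ) * ξ ^ ((k : ℕ) + 1) - w k.succ|) (Finset.mem_univ 0))
      · exact Finset.le_sup' (fun k : Fin 3 =>
          |(w 0 : ℝ) * ξ ^ ((k : ℕ) + 1) - w k.succ|) (Finset.mem_univ l)
    obtain ⟨k, hk⟩ := hatt (x 1)
    obtain ⟨l, hl⟩ := hatt z
    have hsame : |(z 0 : ℝ)| = |(x 1 0 : ℝ)| := by
      rw [hk, hl] at heq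
      have key : ∀ s : ℤ, (s = 1 ∨ s = -1) → ((z 0 : ℝ) * ξ ^ ((l : ℕ) + 1) - z l.succ) =
          s * ((x 1 0 : ℝ) * ξ ^ ((k : ℕ) + 1) - x 1 k.succ) → z 0 = s * x 1 0 := by
        intro s hs h
        set q : Fin 4 → ℤ := z 0 • Pi.single l.succ 1 - (s * x 1 0) • Pi.single k.succ 1
          - (z l.succ - s * x 1 k.succ) • Pi.single 0 1 with hq
        have hq0 : q = 0 := by
          by_contra hne
          refine form_ne_zero hξ hne ?_
          have hsum : ∀ (n : ℤ) (j : Fin 4), ∑ i : Fin 4,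
              ((n • (Pi.single j 1 : Fin 4 → ℤ)) i : ℝ) * ξ ^ (i : ℕ) = n * ξ ^ (j : ℕ) := by
            intro n j
            rw [Finset.sum_eq_single j (fun i _ hij => by simp [hij]) (by simp)]
            simp
          simp only [hq, Pi.sub_apply, Int.cast_sub, sub_mul, Finset.sum_sub_distrib, hsum]
          push_cast
          simp only [Fin.val_succ, Fin.val_zero, pow_zero]
          linarith
        have h1 := congrFun hq0 l.succ
        have h2 := congrFun hq0 k.succ
        by_cases hkl : l = k
        · subst hkl
          simp [hq] at h1
          linarith
        · have hx10 : s * x 1 0 = 0 := by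
            have hkl' : k ≠ l := fun h => hkl h.symm
            simpa [hq, hkl, hkl'] using h2
          rcases hs with rfl | rfl <;> simp at hx10 <;> exact absurd hx10 hx0
      rcases abs_eq_abs.1 heq with h | h
      · have := key 1 (Or.inl rfl) (by rw [h]; simp)
        rw [this]; simp
      · have := key (-1) (Or.inr rfl) (by rw [h]; simp)
        rw [this]; simp
    have hzx : z = x 1 ∨ z = -x 1 := by
      rcases abs_eq_abs.1 hsame with h | h
      · left
        have h0 : z 0 = x 1 0 := by exact_mod_cast h
        refine sub_eq_zero.1 (hzero (z - x 1) (by simp [h0]) ?_)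
        linarith [L_sub_le ξ z (x 1)]
      · right
        have h0 : z 0 = -x 1 0 := by exact_mod_cast h
        refine eq_neg_of_add_eq_zero_left (hzero (z + x 1) (by simp [h0]) ?_)
        linarith [L_add_le ξ z (x 1)]
    have hzn : ‖z‖ = ‖x 1‖ := by
      rcases hzx with h | h
      · rw [h]
      · rw [h, norm_neg]
    linarith [hz.2]
  set x' : ℕ → Fin 4 → ℤ := fun i => if i ≤ 1 then z else x (i - 1) with hx'
  have f1 : x' 1 = z := rfl
  have f2 : ∀ i, 1 ≤ i → x' (i + 1) = x i := fun i hi => by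
    simp only [hx', Nat.add_sub_cancel]
    rw [if_neg (by omega)]
  have hcases : ∀ i, 1 ≤ i → i = 1 ∨ ∃ n, 1 ≤ n ∧ i = n + 1 := fun i hi => by
    rcases hi.eq_or_lt with h | h
    · exact Or.inl h.symm
    · exact Or.inr ⟨i - 1, by omega, by omega⟩
  refine ⟨x', ⟨fun i hi => ?_, fun i hi => ?_, fun i hi => ?_, fun i hi y hy hyL => ?_⟩,
    by rw [f1]; exact hz.2, f2⟩
  · rcases hcases i hi with rfl | ⟨n, hn, rfl⟩
    · exact hz.1
    · rw [f2 n hn]; exact hx.ne_zero n hn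
  · rcases hcases i hi with rfl | ⟨n, hn, rfl⟩
    · rw [f2 1 le_rfl]; exact hz.2
    · rw [f2 n hn, f2 (n + 1) (by omega)]; exact hx.norm_lt n hn
  · rcases hcases i hi with rfl | ⟨n, hn, rfl⟩
    · rw [f2 1 le_rfl]; exact hlt
    · rw [f2 n hn, f2 (n + 1) (by omega)]; exact hx.L_lt n hn
  · rcases hcases i hi with rfl | ⟨n, hn, rfl⟩
    · rw [f2 1 le_rfl]
      by_contra! hn
      exact absurd (hmin' y ⟨hy, hn⟩) (not_le.2 hyL)
    · rw [f2 n hn] at hyL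
      rw [f2 (n + 1) (by omega)]
      exact hx.minimal n hn y hy hyL

/-- The estimate `X_{i+1} ≪ X_i ^ θ` for `i` in `I`, uniformly over all sequences of minimal
points. It comes from the non-zero integers `lowForm (hankel (x i)) ⬝ᵥ x (i - 1)` or
`highForm (hankel (x i)) ⬝ᵥ x (i - 1)`. If `i` is the first element of `I`, they may both vanish,
and the sequence is extended backwards, by induction on its first norm. -/
theorem ApproxBound.exists_logN_succ_le (hc : ApproxBound ξ lam c)
    (hξ : 3 < Module.rank ℚ ℚ⟮ξ⟯) (hlam : 0 < lam) (hθ : lam * (1 + θ) = 1) (hθ0 : 0 < θ)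
    (hθ2 : θ ^ 2 < 2) :
    ∃ κ : ℝ, ∀ x, IsMinimalSeq ξ x → ∀ i, i ∈ I x →
      logN x (i + 1) ≤ θ * logN x i + κ := by
  obtain ⟨B₁, hB₁⟩ := hc.exists_eq_zero_of_recurs hξ hlam hθ hθ0 hθ2
  obtain ⟨B₂, hB₂⟩ := hc.exists_hankel_ne_zero hξ (by nlinarith)
  obtain ⟨B₃, hB₃⟩ := hc.exists_extend hξ hlam
  obtain ⟨κ, hκ⟩ := hc.exists_mul_logN_succ_le hξ
  set B := max (Real.exp (max B₁ B₂)) B₃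
  obtain ⟨B', hB'⟩ := hc.exists_norm_succ_le_of_mem_span hξ hlam B
  have hbdd : ∀ x, IsMinimalSeq ξ x → ∀ m, 1 ≤ m → ‖x m‖ ≤ B → ∀ i, 1 ≤ i →
      toReal 4 (x i) ∈ W x (m + 1) →
      logN x (i + 1) ≤ θ * logN x i + max (Real.log B') (κ / lam) := by
    intro x hx m hm hmB i hi hmem
    have h1 := Real.log_le_log (hx.norm_pos (i := i + 1) (by omega)) (hB' x hx m hm hmB i hi hmem)
    have h2 := mul_nonneg hθ0.le (hx.logN_nonneg hi)
    have h3 := le_max_left (Real.log B') (κ / lam)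
    rw [logN]
    linarith
  have main : ∀ n : ℕ, ∀ x, IsMinimalSeq ξ x → ‖x 1‖ ≤ n → ∀ i, i ∈ I x →
      logN x (i + 1) ≤ θ * logN x i + max (Real.log B') (κ / lam) := by
    intro n
    induction n with
    | zero =>
      intro x hx h1
      have := hx.one_le_norm le_rfl
      push_cast at h1
      linarith
    | succ n ih =>
      intro x hx hn i hi
      have hi2 := hi.1
      by_cases hpred : ∃ m ∈ I x, m < i
      · obtain ⟨m, hm, hmi⟩ := hpred
        obtain ⟨h, -, hh⟩ := exists_pred_of_mem hi hm hmi
        have hh2 := hh.two_le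
        rcases le_or_gt ‖x h‖ B with hle | hgt
        · refine hbdd x hx h (by omega) hle i (by omega) ?_
          rw [hh.W_eq]
          exact mem_W_self x i
        · have h1 : max B₁ B₂ ≤ logN x h := by
            rw [logN, Real.le_log_iff_exp_le (hx.norm_pos (by omega))]
            exact (le_max_left _ _).trans hgt.le
          have h2 := hB₂ x hx i hi2 (((le_max_right _ _).trans h1).trans
            (hx.logN_le_logN (by omega) hh.lt.le))
          obtain ⟨p, rfl⟩ : ∃ p, i = p + 1 := ⟨i - 1, by omega⟩
          have h3 : ¬ Recurs (hankel (x (p + 1))) (x p) := by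
            intro hrec
            refine h2 (hB₁ x hx h hh.1 ((le_max_left _ _).trans h1) _ ?_ ?_)
            · refine Recurs.of_mem_span hrec (recurs_hankel _) ?_
              rw [← W_succ, ← hh.W_eq]
              exact mem_W_pred x (h + 1)
            · refine Recurs.of_mem_span hrec (recurs_hankel _) ?_
              rw [← W_succ, ← hh.W_eq]
              exact mem_W_self x (h + 1)
          have h4 := hκ x hx p (by omega) h3
          have h5 : logN x (p + 2) ≤ θ * logN x (p + 1) + κ / lam := by
            have e1 : 1 - lam = lam * θ := by linarith
            rw [e1] at h4
            refine le_of_mul_le_mul_left (h4.trans ?_) hlam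
            rw [mul_add, mul_div_cancel₀ _ hlam.ne']
            linarith
          exact h5.trans (by linarith [le_max_right (Real.log B') (κ / lam)])
      · push Not at hpred
        have hW : W x (1 + 1) = W x i := W_eq_of_forall_notMem le_rfl (by omega)
          fun k _ hk hkI => absurd (hpred k hkI) (by omega)
        rcases le_or_gt ‖x 1‖ B with hle | hgt
        · refine hbdd x hx 1 le_rfl hle i (by omega) ?_
          rw [hW]
          exact mem_W_self x i
        · obtain ⟨x', hx', hlt, hshift⟩ := hB₃ x hx ((le_max_right _ _).trans hgt.le)
          have hI' : i + 1 ∈ I x' := by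
            refine ⟨by omega, fun hWW => hi.2 ?_⟩
            have e : i = (i - 1) + 1 := by omega
            rw [W, W, Nat.add_sub_cancel, Nat.add_sub_cancel, hshift i (by omega),
              hshift (i + 1) (by omega)] at hWW
            nth_rw 1 [e] at hWW
            rw [hshift (i - 1) (by omega)] at hWW
            exact hWW
          have h1 := norm_add_one_le hlt
          have h2 := ih x' hx' (by push_cast at hn; linarith) (i + 1) hI'
          rwa [logN, logN, hshift i (by omega), hshift (i + 1) (by omega)] at h2
  refine ⟨max (Real.log B') (κ / lam), fun x hx i hi => ?_⟩
  obtain ⟨n, hn⟩ := exists_norm_eq (x 1)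
  exact main n x hx hn.le i hi

/-! ### Heights of the spaces `U` -/

theorem W_le_U (x : ℕ → Fin 4 → ℤ) (i : ℕ) : W x i ≤ U x i := le_sup_left

theorem W_succ_le_U (x : ℕ → Fin 4 → ℤ) (i : ℕ) : W x (i + 1) ≤ U x i := le_sup_right

namespace IsMinimalSeq

variable {x : ℕ → Fin 4 → ℤ}

theorem exists_normal_U (hx : IsMinimalSeq ξ x) {i : ℕ} (hi : i ∈ I x) :
    1 ≤ height (U x i) ∧
      ∃ q : Fin 4 → ℤ, ‖q‖ = height (U x i) ∧ ∀ y, q ⬝ᵥ y = 0 ↔ toReal 4 y ∈ U x i := by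
  have hi2 := hi.1
  have hW : W x (i - 1 + 1) = W x i := by congr 1; omega
  obtain ⟨h1, -, h2⟩ := exists_normal (hx.linearIndependent_triple (by omega) hi hW)
    (U_eq_span hW)
  exact ⟨h1, h2⟩

theorem height_pos (hx : IsMinimalSeq ξ x) {i : ℕ} (hi : i ∈ I x) : 0 < height (U x i) := by
  linarith [(hx.exists_normal_U hi).1]

theorem finrank_U (hx : IsMinimalSeq ξ x) {i : ℕ} (hi : i ∈ I x) :
    Module.finrank ℝ (U x i) = 3 := by
  have hi2 := hi.1
  have hW : W x (i - 1 + 1) = W x i := by congr 1; omega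
  rw [U_eq_span hW, finrank_span_eq_card (hx.linearIndependent_triple (by omega) hi hW)]
  rfl

/-- If `i ∈ J` has successor `j` in `I`, a normal vector of `U x i` takes a non-zero integer value
at `x (j + 1)`, whence `X_j ≪ H(U_i) X_{j+1} L_j`. -/
theorem logN_le_of_mem_J (hx : IsMinimalSeq ξ x) (hξ : 3 < Module.rank ℚ ℚ⟮ξ⟯) {i j : ℕ}
    (hij : Consecutive x i j) (hiJ : i ∈ J x) :
    logN x j ≤ Real.log (height (U x i)) + logN x (j + 1) + logL ξ x j +
      Real.log (16 * powBound ξ) := by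
  have hM := one_le_powBound ξ
  have hi2 := hij.two_le
  have hlt := hij.lt
  obtain ⟨hh, q, hqn, hq⟩ := hx.exists_normal_U hij.1
  have hqj : q ⬝ᵥ x j = 0 := by
    rw [hq]
    refine W_succ_le_U x i ?_
    rw [hij.W_eq]
    exact mem_W_self x j
  have hqj1 : q ⬝ᵥ x (j + 1) ≠ 0 := by
    intro h0
    obtain ⟨-, k, hk, hU⟩ := hiJ
    obtain rfl := hij.unique hk
    apply hU
    have hle : U x j ≤ U x i := by
      refine sup_le ?_ ?_
      · rw [← hij.W_eq]; exact W_succ_le_U x i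
      · rw [W_succ, Submodule.span_le]
        rintro _ (rfl | rfl)
        · exact (hq _).1 hqj
        · exact (hq _).1 h0
    refine (Submodule.eq_of_le_of_finrank_eq hle ?_).symm
    rw [hx.finrank_U hij.1, hx.finrank_U hij.mem_right]
  have h1 : (1 : ℝ) ≤ |((q ⬝ᵥ x (j + 1) : ℤ) : ℝ)| := by exact_mod_cast Int.one_le_abs hqj1
  have h2 := abs_dot_mul_norm_le_of_le hqj (hx.L_lt j (by omega)).le (hx.norm_lt j (by omega)).le
  have hXj := hx.norm_pos (i := j) (by omega)
  have hXj1 := hx.norm_pos (i := j + 1) (by omega)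
  have hLj := hx.L_pos hξ (i := j) (by omega)
  have hHp : 0 < height (U x i) := by linarith
  rw [hqn] at h2
  have h3 : ‖x j‖ ≤ 16 * powBound ξ * height (U x i) * (‖x (j + 1)‖ * L ξ (x j)) := by
    refine le_trans ?_ h2
    exact le_mul_of_one_le_left hXj.le h1
  have h4 := Real.log_le_log hXj h3
  rw [Real.log_mul (by positivity) (by positivity), Real.log_mul (by positivity) hHp.ne',
    Real.log_mul hXj1.ne' hLj.ne'] at h4
  unfold logN logL
  linarith

/-- If `W_h` is spanned by `x m` and `x (m + 1)`, then
`H(U_h) ≪ X_{m+1} L_m X_{h+1} L_h / X_h`. -/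
theorem log_height_le (hx : IsMinimalSeq ξ x) (hξ : 3 < Module.rank ℚ ℚ⟮ξ⟯) {m h : ℕ}
    (hm : 1 ≤ m) (hh : h ∈ I x) (hW : W x (m + 1) = W x h) :
    Real.log (height (U x h)) ≤ logN x (m + 1) + logL ξ x m + logN x (h + 1) + logL ξ x h -
      logN x h + Real.log (512 * powBound ξ ^ 2) := by
  have hM := one_le_powBound ξ
  have hh2 := hh.1
  obtain ⟨h1, h2, -⟩ := exists_normal (hx.linearIndependent_triple hm hh hW) (U_eq_span hW)
  have h3 := norm_cross_mul_norm_le (ξ := ξ) (u := x m) (v := x (m + 1)) (w := x (h + 1))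
    (z := x h) (by rw [← W_succ, hW]; exact mem_W_self x h) (hx.L_lt h (by omega)).le
    (hx.norm_lt h (by omega)).le
    (abs_plucker_le ξ (hx.ne_zero m hm) (hx.L_lt m hm).le (hx.norm_lt m hm).le)
  have hX := hx.norm_pos (i := h) (by omega)
  have hX1 := hx.norm_pos (i := h + 1) (by omega)
  have hXm := hx.norm_pos (i := m + 1) (by omega)
  have hLh := hx.L_pos hξ (i := h) (by omega)
  have hLm := hx.L_pos hξ (i := m) (by omega)
  have hHp : 0 < height (U x h) := by linarith
  have h4 : height (U x h) * ‖x h‖ ≤ 512 * powBound ξ ^ 2 *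
      ((‖x (m + 1)‖ * L ξ (x m)) * (‖x (h + 1)‖ * L ξ (x h))) := by
    refine (mul_le_mul_of_nonneg_right h2 hX.le).trans (h3.trans (le_of_eq ?_))
    ring
  have h5 := Real.log_le_log (by positivity) h4
  rw [Real.log_mul hHp.ne' hX.ne',
    Real.log_mul (by positivity : 512 * powBound ξ ^ 2 ≠ 0) (by positivity),
    Real.log_mul (mul_pos hXm hLm).ne' (mul_pos hX1 hLh).ne', Real.log_mul hXm.ne' hLm.ne',
    Real.log_mul hX1.ne' hLh.ne'] at h5
  unfold logN logL
  linarith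

/-! ### The sets `I` and `J` are infinite -/

/-- Infinitely many minimal points do not lie in a common rational hyperplane. -/
theorem false_of_dot_eq_zero (hx : IsMinimalSeq ξ x) (hξ : 3 < Module.rank ℚ ℚ⟮ξ⟯)
    {q : Fin 4 → ℤ} (hq : q ≠ 0) {S : Set ℕ} (hS : S.Infinite)
    (h : ∀ i ∈ S, q ⬝ᵥ x i = 0) : False := by
  obtain ⟨C, hC0, hC⟩ := norm_le_of_dot_eq_zero hξ hq
  obtain ⟨n, hn⟩ := exists_nat_gt C
  obtain ⟨i, hi, hni⟩ := hS.exists_gt n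
  have h1 := hC _ (h i hi)
  have h2 := hx.natCast_le_norm (i := i) (by omega)
  have h3 := hx.L_le_one (i := i) (by omega)
  have h4 : (n : ℝ) < i := by exact_mod_cast hni
  nlinarith

theorem infinite_I (hx : IsMinimalSeq ξ x) (hξ : 3 < Module.rank ℚ ℚ⟮ξ⟯) : (I x).Infinite := by
  intro hfin
  obtain ⟨N, hN⟩ := hfin.bddAbove
  obtain ⟨q, hq, h1, h2, -⟩ := exists_form (x (N + 1)) (x (N + 1 + 1)) 0
  refine hx.false_of_dot_eq_zero hξ hq (Set.Ioi_infinite (N + 1)) fun i hi => ?_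
  refine dot_eq_zero_of_mem_span h1 h2 ?_
  rw [← W_succ, W_eq_of_forall_notMem (x := x) (h := i) (by omega) hi
    fun k hk _ hkI => absurd (hN hkI) (by omega)]
  exact mem_W_self x i

end IsMinimalSeq

theorem U_eq_of_notMem_J {x : ℕ → Fin 4 → ℤ} {i j : ℕ} (h : Consecutive x i j) (hi : i ∉ J x) :
    U x i = U x j := by
  by_contra hne
  exact hi ⟨h.1, j, h, hne⟩

/-- Induction along the elements of `I` that are at least `m ∈ I`. -/
theorem induction_I {x : ℕ → Fin 4 → ℤ} {m : ℕ} (hm : m ∈ I x) {P : ℕ → Prop} (base : P m)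
    (step : ∀ i j, m ≤ i → Consecutive x i j → P i → P j) : ∀ i ∈ I x, m ≤ i → P i := by
  intro i
  induction i using Nat.strong_induction_on with
  | _ i ih =>
    intro hi hmi
    rcases hmi.eq_or_lt with rfl | hlt
    · exact base
    · obtain ⟨h, hmh, hhi⟩ := exists_pred_of_mem hi hm hlt
      exact step h i hmh hhi (ih h hhi.lt hhi.1 hmh)

theorem IsMinimalSeq.infinite_J {x : ℕ → Fin 4 → ℤ} (hx : IsMinimalSeq ξ x)
    (hξ : 3 < Module.rank ℚ ℚ⟮ξ⟯) : (J x).Infinite := by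
  intro hfin
  obtain ⟨N, hN⟩ := hfin.bddAbove
  obtain ⟨m, hm, hNm⟩ := (hx.infinite_I hξ).exists_gt N
  have hU := induction_I (P := fun i => U x i = U x m) hm rfl fun i j hmi hij hi => by
    rw [← U_eq_of_notMem_J hij fun hJ => absurd (hN hJ) (by omega), hi]
  obtain ⟨h1, q, hqn, hq⟩ := hx.exists_normal_U hm
  have hq0 : q ≠ 0 := by
    rintro rfl
    rw [norm_zero] at hqn
    linarith
  have hinf : (I x ∩ Set.Ici m).Infinite := by
    have : I x \ Set.Iio m = I x ∩ Set.Ici m := by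
      ext k; simp
    rw [← this]
    exact (hx.infinite_I hξ).sdiff (Set.finite_Iio m)
  refine hx.false_of_dot_eq_zero hξ hq0 hinf fun i hi => ?_
  rw [hq, ← hU i hi.1 hi.2]
  exact W_le_U x i (mem_W_self x i)

/-! ### Infinitely many elements of `I` lie outside `J` -/

/-- The second coefficient `v` of `x k` in the basis `x i`, `x (i + 1)` of its plane is
comparable to `X_k / X_{i+1}` or larger. -/
theorem IsMinimalSeq.exists_coeff {x : ℕ → Fin 4 → ℤ} (hx : IsMinimalSeq ξ x)
    (hξ : 3 < Module.rank ℚ ℚ⟮ξ⟯) {i k : ℕ} (hi : 1 ≤ i) (hik : i < k)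
    (hmem : toReal 4 (x k) ∈ W x (i + 1)) :
    ∃ v : ℝ, (∀ q : Fin 4 → ℤ, q ⬝ᵥ x i = 0 →
        ((q ⬝ᵥ x k : ℤ) : ℝ) = v * ((q ⬝ᵥ x (i + 1) : ℤ) : ℝ)) ∧
      ‖x k‖ ≤ 20 * |v| * ‖x (i + 1)‖ := by
  rw [W_succ] at hmem
  obtain ⟨u, v, huv⟩ := Submodule.mem_span_pair.1 hmem
  have hc : ∀ l, (x k l : ℝ) = u * x i l + v * x (i + 1) l := fun l => by
    simpa [toReal_apply] using (congrFun huv l).symm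
  have hXi := hx.norm_pos hi
  have hXlt := hx.norm_lt i hi
  have hLi := hx.L_pos hξ hi
  have hLlt := hx.L_lt i hi
  have hLk := hx.L_lt_L hi hik
  have hXk : ‖x (i + 1)‖ ≤ ‖x k‖ := hx.norm_le_norm (by omega) hik
  refine ⟨v, fun q hq => ?_, ?_⟩
  · have hq' : ((q ⬝ᵥ x i : ℤ) : ℝ) = 0 := by rw [hq, Int.cast_zero]
    simp only [dotProduct, Fin.sum_univ_four, Int.cast_add, Int.cast_mul] at hq' ⊢
    rw [hc, hc, hc, hc]
    linear_combination u * hq'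
  have hn : ‖x k‖ ≤ |u| * ‖x i‖ + |v| * ‖x (i + 1)‖ := by
    refine norm_le_of_coord (by positivity) fun l => ?_
    rw [hc]
    refine (abs_add_le _ _).trans ?_
    rw [abs_mul, abs_mul]
    have h1 := abs_coord_le (x i) l
    have h2 := abs_coord_le (x (i + 1)) l
    gcongr
  have hu : |u| ≤ 1 + |v| := by
    have h1 : |u| * L ξ (x i) ≤ (1 + |v|) * L ξ (x i) := by
      rcases (abs_nonneg u).eq_or_lt with h | h
      · rw [← h, zero_mul]; positivity
      · rw [mul_comm, ← le_div_iff₀ h]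
        refine L_le_of (by positivity) fun l => ?_
        rw [le_div_iff₀ h, ← abs_mul]
        have e1 : ((x i 0 : ℝ) * ξ ^ (l : ℕ) - x i l) * u =
            ((x k 0 : ℝ) * ξ ^ (l : ℕ) - x k l) -
              v * ((x (i + 1) 0 : ℝ) * ξ ^ (l : ℕ) - x (i + 1) l) := by
          rw [hc, hc]; ring
        rw [e1]
        refine (abs_sub _ _).trans ?_
        rw [abs_mul]
        have h2 := (abs_sub_le_L ξ (x k) l).trans hLk.le
        have h3 := (abs_sub_le_L ξ (x (i + 1)) l).trans hLlt.le
        have h4 := mul_le_mul_of_nonneg_left h3 (abs_nonneg v)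
        linarith
    exact le_of_mul_le_mul_right h1 hLi
  rcases le_or_gt (1 / 10) |v| with hv | hv
  · have h1 : |u| * ‖x i‖ ≤ (1 + |v|) * ‖x (i + 1)‖ :=
      mul_le_mul hu hXlt.le (norm_nonneg _) (by positivity)
    nlinarith [norm_nonneg (x (i + 1))]
  · -- a small coefficient would make one of `x k ± x i` too good an approximation
    exfalso
    have h1 : |v| * ‖x (i + 1)‖ ≤ 1 / 10 * ‖x (i + 1)‖ := by gcongr
    have h2 : 9 / 10 ≤ |u| := by
      have : |u| * ‖x i‖ ≤ |u| * ‖x (i + 1)‖ := by gcongr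
      by_contra! h
      nlinarith
    obtain ⟨s, hs, hus⟩ : ∃ s : ℤ, (s = 1 ∨ s = -1) ∧ |u - s| ≤ 1 / 10 := by
      rcases le_total 0 u with h | h
      · refine ⟨1, Or.inl rfl, ?_⟩
        rw [abs_of_nonneg h] at h2 hu
        rw [abs_le]; push_cast; constructor <;> linarith
      · refine ⟨-1, Or.inr rfl, ?_⟩
        rw [abs_of_nonpos h] at h2 hu
        rw [abs_le]; push_cast; constructor <;> linarith
    set z : Fin 4 → ℤ := x k - s • x i with hz
    have hzc : ∀ l, (z l : ℝ) = (u - s) * x i l + v * x (i + 1) l := fun l => by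
      simp only [hz, Pi.sub_apply, Pi.smul_apply, smul_eq_mul, Int.cast_sub, Int.cast_mul, hc]
      ring
    have hzn : ‖z‖ ≤ 1 / 10 * ‖x i‖ + 1 / 10 * ‖x (i + 1)‖ := by
      refine norm_le_of_coord (by positivity) fun l => ?_
      rw [hzc]
      refine (abs_add_le _ _).trans ?_
      rw [abs_mul, abs_mul]
      have h3 := abs_coord_le (x i) l
      have h4 := abs_coord_le (x (i + 1)) l
      gcongr
    have hzL : L ξ z ≤ 1 / 10 * L ξ (x i) + 1 / 10 * L ξ (x (i + 1)) := by
      refine L_le_of (by have := L_nonneg ξ (x (i + 1)); positivity) fun l => ?_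
      have e1 : (z 0 : ℝ) * ξ ^ (l : ℕ) - z l =
          (u - s) * ((x i 0 : ℝ) * ξ ^ (l : ℕ) - x i l) +
            v * ((x (i + 1) 0 : ℝ) * ξ ^ (l : ℕ) - x (i + 1) l) := by
        rw [hzc, hzc]; ring
      rw [e1]
      refine (abs_add_le _ _).trans ?_
      rw [abs_mul, abs_mul]
      have h3 := abs_sub_le_L ξ (x i) l
      have h4 := abs_sub_le_L ξ (x (i + 1)) l
      gcongr
    have hz0 : z ≠ 0 := by
      intro h0
      have h3 : x k = s • x i := sub_eq_zero.1 h0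
      have h4 : ‖x k‖ = ‖x i‖ := by
        rw [h3]
        rcases hs with rfl | rfl <;> simp
      linarith
    have := hx.minimal i hi z hz0 (by linarith)
    linarith

/-- The growth of `X_{i+1}` in terms of `X_i`, for consecutive `g < h < i` in `I` with `h ∈ J`; here
`a_k` and `b_k` stand for `log X_k` and `log X_{k+1}`. -/
theorem growth_one {lam θ κ bg ah bh ai bi : ℝ} (hθ : lam * (1 + θ) = 1) (h1 : 4 / 3 ≤ θ)
    (hstar : ah + ai ≤ (1 - lam) * (bg + bh + bi) + κ) (hbg : bg ≤ ah) (hbh : bh ≤ ai)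
    (hβ : bh ≤ θ * ah + κ) :
    (1 + θ) * ai - (θ * (1 + θ) + 1) * κ ≤ θ ^ 2 * bi := by
  have e1 : (1 + θ) * (1 - lam) = θ := by linarith
  have h2 : (1 + θ) * (ah + ai) ≤ θ * (bg + bh + bi) + (1 + θ) * κ := by
    calc (1 + θ) * (ah + ai) ≤ (1 + θ) * ((1 - lam) * (bg + bh + bi) + κ) := by gcongr
      _ = (1 + θ) * (1 - lam) * (bg + bh + bi) + (1 + θ) * κ := by ring
      _ = _ := by rw [e1]
  have h3 : θ * bg ≤ θ * ah := by gcongr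
  have h4 : θ * ((1 + θ) * (ah + ai)) ≤ θ * (θ * (bg + bh + bi) + (1 + θ) * κ) := by gcongr
  have h5 : θ * (θ * bg) ≤ θ * (θ * ah) := by gcongr
  have h6 : (θ ^ 2 - 1) * bh ≤ (θ ^ 2 - 1) * ai :=
    mul_le_mul_of_nonneg_left hbh (by nlinarith)
  linarith

/-- The growth of `X_{j+1}` in terms of `X_i` and `X_{i+1}`, for consecutive `h < i < j` in `I` with
`i ∈ J`. -/
theorem growth_two {lam θ κ bh ai bi aj bj : ℝ} (hθ : lam * (1 + θ) = 1) (h1 : 4 / 3 ≤ θ)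
    (hstar : ai + aj ≤ (1 - lam) * (bh + bi + bj) + κ) (hbh : bh ≤ ai) (hbi : bi ≤ aj) :
    ai + bi - (1 + θ) * κ ≤ θ * bj := by
  have e1 : (1 + θ) * (1 - lam) = θ := by linarith
  have h2 : (1 + θ) * (ai + aj) ≤ θ * (bh + bi + bj) + (1 + θ) * κ := by
    calc (1 + θ) * (ai + aj) ≤ (1 + θ) * ((1 - lam) * (bh + bi + bj) + κ) := by gcongr
      _ = (1 + θ) * (1 - lam) * (bh + bi + bj) + (1 + θ) * κ := by ring
      _ = _ := by rw [e1]
  have h3 : θ * bh ≤ θ * ai := by gcongr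
  have h4 : (1 + θ) * bi ≤ (1 + θ) * aj := by gcongr
  linarith

/-- For large `ai`, the two terms in the determinant of consecutive approximations to `ξ` are
small. -/
theorem exists_det_terms_neg {lam θ κ κ' : ℝ} (hθ : lam * (1 + θ) = 1) (h1 : 4 / 3 ≤ θ)
    (h2 : θ ≤ 1.356) :
    ∃ B : ℝ, ∀ bh ai bi aj bj ak bk : ℝ, B ≤ ai → B ≤ aj → bh ≤ ai → bi ≤ aj → bj ≤ ak →
      (1 + θ) * ai - κ ≤ θ ^ 2 * bi → (1 + θ) * aj - κ ≤ θ ^ 2 * bj →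
      ai + aj ≤ (1 - lam) * (bh + bi + bj) + κ →
      aj + ak ≤ (1 - lam) * (bi + bj + bk) + κ →
      (1 - lam) * bi + ai - aj + (1 - 3 * lam) * bj + κ' < 0 ∧
        (1 - 2 * lam) * bi + aj + (1 - lam) * bj - lam * bk - ak + κ' < 0 := by
  have hθ0 : 0 < θ := by linarith
  -- The two coefficients that have to be positive. The first one vanishes near `θ = 1.3576`.
  have p1 : 0 < -θ ^ 4 - 2 * θ ^ 3 + 2 * θ ^ 2 + 2 * θ + 2 := by
    have h3 : θ ^ 2 ≤ 1.356 ^ 2 := by gcongr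
    have h4 : θ ^ 3 ≤ 1.356 ^ 3 := by gcongr
    nlinarith [mul_nonneg hθ0.le (sub_nonneg.2 h2), mul_nonneg (sub_nonneg.2 h1) (sub_nonneg.2 h2),
      mul_nonneg (pow_nonneg hθ0.le 2) (sub_nonneg.2 h2),
      mul_nonneg (pow_nonneg hθ0.le 3) (sub_nonneg.2 h2)]
  have p2 : 0 < (1 + θ) ^ 2 - θ ^ 2 * (2 * θ ^ 2 - 1) := by
    have h3 : θ ^ 2 ≤ 1.84 := by nlinarith
    nlinarith [mul_nonneg (sub_nonneg.2 h3) (sq_nonneg θ)]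
  set P := -θ ^ 4 - 2 * θ ^ 3 + 2 * θ ^ 2 + 2 * θ + 2
  set Q := (1 + θ) ^ 2 - θ ^ 2 * (2 * θ ^ 2 - 1)
  set E := θ * (1 + θ) * κ'
  set E₁ := θ ^ 2 * (2 - θ) * (1 + θ) * κ + 2 * κ + θ ^ 2 * E
  set E₂ := θ ^ 2 * ((1 + θ) * κ + E) + (1 + θ) * κ
  refine ⟨max (E₁ / P + 1) (E₂ / Q + 1), ?_⟩
  intro bh ai bi aj bj ak bk hBi hBj hbh hbi hbj hgi hgj hs1 hs2
  have e1 : (1 + θ) * (1 - lam) = θ := by linarith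
  have hBi' : E₁ < P * ai := by
    have := (le_max_left _ _).trans hBi
    rw [← div_lt_iff₀' p1]; linarith
  have hBj' : E₂ < Q * aj := by
    have := (le_max_right _ _).trans hBj
    rw [← div_lt_iff₀' p2]; linarith
  have hlam : lam = 1 / (1 + θ) := by field_simp; linarith
  constructor
  · have g2 := growth_two hθ h1 hs1 hbh hbi
    have key : (θ ^ 2 * θ * (1 + θ)) *
        ((1 - lam) * bi + ai - aj + (1 - 3 * lam) * bj + κ') < 0 := by
      have e2 : (θ ^ 2 * θ * (1 + θ)) *
          ((1 - lam) * bi + ai - aj + (1 - 3 * lam) * bj + κ') =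
          θ ^ 2 * (θ * (θ * bi + (1 + θ) * ai - (1 + θ) * aj + (θ - 2) * bj) + E) := by
        simp only [E]
        linear_combination (θ ^ 3 * (-bi - 3 * bj)) * hθ
      rw [e2]
      have h3 : (2 - θ) * (ai + bi - (1 + θ) * κ) ≤ (2 - θ) * (θ * bj) := by
        apply mul_le_mul_of_nonneg_left g2; linarith
      have h4 : θ * ((1 + θ) * bi) ≤ θ * ((1 + θ) * aj) := by gcongr
      have h5 : θ * (θ * bi + (1 + θ) * ai - (1 + θ) * aj + (θ - 2) * bj) ≤
          (θ * (1 + θ) - (2 - θ)) * ai - 2 * bi + (2 - θ) * (1 + θ) * κ := by linarith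
      have h6 : θ ^ 2 * (θ * (θ * bi + (1 + θ) * ai - (1 + θ) * aj + (θ - 2) * bj) + E) ≤
          θ ^ 2 * ((θ * (1 + θ) - (2 - θ)) * ai - 2 * bi + (2 - θ) * (1 + θ) * κ + E) := by
        gcongr
      refine lt_of_le_of_lt h6 ?_
      simp only [P, E₁] at hBi'
      linarith
    by_contra! hcon
    have : 0 ≤ (θ ^ 2 * θ * (1 + θ)) *
        ((1 - lam) * bi + ai - aj + (1 - 3 * lam) * bj + κ') :=
      mul_nonneg (by positivity) hcon
    linarith
  · have key : (θ ^ 2 * θ * (1 + θ)) *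
        ((1 - 2 * lam) * bi + aj + (1 - lam) * bj - lam * bk - ak + κ') < 0 := by
      have e2 : (θ ^ 2 * θ * (1 + θ)) *
          ((1 - 2 * lam) * bi + aj + (1 - lam) * bj - lam * bk - ak + κ') =
          θ ^ 2 * (θ * ((θ - 1) * bi + (1 + θ) * aj + θ * bj - bk - (1 + θ) * ak) + E) := by
        simp only [E]
        linear_combination (θ ^ 3 * (-2 * bi - bj - bk)) * hθ
      rw [e2]
      have h3 : (1 + θ) * (aj + ak) ≤ θ * (bi + bj + bk) + (1 + θ) * κ := by
        calc (1 + θ) * (aj + ak) ≤ (1 + θ) * ((1 - lam) * (bi + bj + bk) + κ) := by gcongr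
          _ = (1 + θ) * (1 - lam) * (bi + bj + bk) + (1 + θ) * κ := by ring
          _ = _ := by rw [e1]
      have h4 : (1 + θ) ^ 2 * bj ≤ (1 + θ) ^ 2 * ak := by gcongr
      have h5 : θ ^ 2 * bi ≤ θ ^ 2 * aj := by gcongr
      have h6 : θ * ((θ - 1) * bi + (1 + θ) * aj + θ * bj - bk - (1 + θ) * ak) ≤
          (2 * θ ^ 2 - 1) * aj - (1 + θ) * bj + (1 + θ) * κ := by linarith
      have h7 : θ ^ 2 * (θ * ((θ - 1) * bi + (1 + θ) * aj + θ * bj - bk - (1 + θ) * ak) + E) ≤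
          θ ^ 2 * ((2 * θ ^ 2 - 1) * aj - (1 + θ) * bj + (1 + θ) * κ + E) := by gcongr
      refine lt_of_le_of_lt h7 ?_
      have h8 : (1 + θ) * ((1 + θ) * aj - κ) ≤ (1 + θ) * (θ ^ 2 * bj) := by gcongr
      simp only [Q, E₂] at hBj'
      linarith
    by_contra! hcon
    have : 0 ≤ (θ ^ 2 * θ * (1 + θ)) *
        ((1 - 2 * lam) * bi + aj + (1 - lam) * bj - lam * bk - ak + κ') :=
      mul_nonneg (by positivity) hcon
    linarith

/-- First coordinate of the integer approximation `(p, q)` to `(1, ξ)` attached to `x i` and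
`x (i + 1)`. -/
def approxDen (x : ℕ → Fin 4 → ℤ) (i : ℕ) : ℤ := lowForm (hankel (x i)) ⬝ᵥ x (i + 1)

/-- Second coordinate of the integer approximation `(p, q)` to `(1, ξ)` attached to `x i` and
`x (i + 1)`. -/
def approxNum (x : ℕ → Fin 4 → ℤ) (i : ℕ) : ℤ := highForm (hankel (x i)) ⬝ᵥ x (i + 1)

namespace IsMinimalSeq

variable {x : ℕ → Fin 4 → ℤ}

theorem abs_approxDen_le (hx : IsMinimalSeq ξ x) {i : ℕ} (hi : 1 ≤ i) :
    |(approxDen x i : ℝ)| ≤ 64 * powBound ξ ^ 2 * (‖x (i + 1)‖ * L ξ (x i) ^ 2) := by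
  have hM := one_le_powBound ξ
  have hX := hx.norm_pos hi
  have hL := L_nonneg ξ (x i)
  have h1 := abs_dot_mul_norm_le_of_le (recurs_hankel (x i)).1 (hx.L_lt i hi).le
    (hx.norm_lt i hi).le
  have h2 := (norm_lowForm_le (hankel (x i))).trans (norm_hankel_le ξ (x i))
  refine le_of_mul_le_mul_right (h1.trans ?_) hX
  calc 16 * powBound ξ * ‖lowForm (hankel (x i))‖ * (‖x (i + 1)‖ * L ξ (x i))
      ≤ 16 * powBound ξ * (4 * powBound ξ * (‖x i‖ * L ξ (x i))) *
        (‖x (i + 1)‖ * L ξ (x i)) := by gcongr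
    _ = _ := by ring

theorem abs_approxNum_sub_le (hx : IsMinimalSeq ξ x) {i : ℕ} (hi : 1 ≤ i) :
    |(approxNum x i : ℝ) - ξ * approxDen x i| ≤
      24 * powBound ξ ^ 2 * (‖x i‖ * L ξ (x i) ^ 2) := by
  have hM := one_le_powBound ξ
  have hL := L_nonneg ξ (x i)
  have hL' := L_nonneg ξ (x (i + 1))
  refine (abs_highForm_sub_le ξ _ _).trans ?_
  calc 6 * powBound ξ * (‖hankel (x i)‖ * L ξ (x (i + 1)))
      ≤ 6 * powBound ξ * (4 * powBound ξ * (‖x i‖ * L ξ (x i)) * L ξ (x i)) := by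
        gcongr
        · exact norm_hankel_le ξ _
        · exact (hx.L_lt i hi).le
    _ = _ := by ring

/-- The approximation attached to `x i` improves when the plane of `x i` and `x (i + 1)` contains
a minimal point `x k` with large `k`. -/
theorem abs_approxNum_sub_mul_le (hx : IsMinimalSeq ξ x) (hξ : 3 < Module.rank ℚ ℚ⟮ξ⟯) {i k : ℕ}
    (hi : 1 ≤ i) (hik : i < k) (hmem : toReal 4 (x k) ∈ W x (i + 1)) :
    |(approxNum x i : ℝ) - ξ * approxDen x i| * ‖x k‖ ≤
      480 * powBound ξ ^ 2 * (‖x i‖ * L ξ (x i) * L ξ (x k) * ‖x (i + 1)‖) := by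
  have hM := one_le_powBound ξ
  have hL := L_nonneg ξ (x i)
  have hL' := L_nonneg ξ (x k)
  obtain ⟨v, hv, hvn⟩ := hx.exists_coeff hξ hi hik hmem
  have h1 := abs_highForm_sub_le ξ (hankel (x i)) (x k)
  rw [hv _ (recurs_hankel (x i)).1, hv _ (recurs_hankel (x i)).2] at h1
  have h2 : |v| * |(approxNum x i : ℝ) - ξ * approxDen x i| ≤
      24 * powBound ξ ^ 2 * (‖x i‖ * L ξ (x i) * L ξ (x k)) := by
    rw [← abs_mul]
    calc |v * ((approxNum x i : ℝ) - ξ * approxDen x i)| ≤ _ := by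
          refine le_trans (le_of_eq ?_) h1
          congr 1
          rw [approxNum, approxDen]
          ring
      _ ≤ 6 * powBound ξ * (4 * powBound ξ * (‖x i‖ * L ξ (x i)) * L ξ (x k)) := by
          gcongr
          exact norm_hankel_le ξ _
      _ = _ := by ring
  calc |(approxNum x i : ℝ) - ξ * approxDen x i| * ‖x k‖
      ≤ |(approxNum x i : ℝ) - ξ * approxDen x i| * (20 * |v| * ‖x (i + 1)‖) := by gcongr
    _ = 20 * ‖x (i + 1)‖ * (|v| * |(approxNum x i : ℝ) - ξ * approxDen x i|) := by ring
    _ ≤ 20 * ‖x (i + 1)‖ * (24 * powBound ξ ^ 2 * (‖x i‖ * L ξ (x i) * L ξ (x k))) := by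
        gcongr
    _ = _ := by ring

/-- If the approximations attached to consecutive elements `i < j` of `I` are not proportional,
their determinant is a non-zero integer, and one of the two products that bound it is not small. -/
theorem det_terms (hx : IsMinimalSeq ξ x) (hξ : 3 < Module.rank ℚ ℚ⟮ξ⟯) {i j k : ℕ}
    (hij : Consecutive x i j) (hjk : Consecutive x j k)
    (hdet : approxDen x i * approxNum x j ≠ approxNum x i * approxDen x j) :
    0 ≤ logN x (j + 1) + 3 * logL ξ x j + logN x i + logL ξ x i + logN x (i + 1) - logN x j +
        Real.log (61440 * powBound ξ ^ 4) ∨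
      0 ≤ logN x (i + 1) + 2 * logL ξ x i + logN x j + logL ξ x j + logL ξ x k +
        logN x (j + 1) - logN x k + Real.log (61440 * powBound ξ ^ 4) := by
  have hM := one_le_powBound ξ
  have hi2 := hij.two_le
  have hlt := hij.lt
  have hlt' := hjk.lt
  have h1 : (1 : ℝ) ≤
      |((approxDen x i * approxNum x j - approxNum x i * approxDen x j : ℤ) : ℝ)| := by
    exact_mod_cast Int.one_le_abs (sub_ne_zero.2 hdet)
  have h2 : ((approxDen x i * approxNum x j - approxNum x i * approxDen x j : ℤ) : ℝ) =
      approxDen x i * (approxNum x j - ξ * approxDen x j) -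
        approxDen x j * (approxNum x i - ξ * approxDen x i) := by push_cast; ring
  rw [h2] at h1
  have h3 := h1.trans (abs_sub _ _)
  rw [abs_mul, abs_mul] at h3
  have bi := hx.abs_approxDen_le (i := i) (by omega)
  have bj := hx.abs_approxDen_le (i := j) (by omega)
  have ci := hx.abs_approxNum_sub_mul_le hξ (i := i) (k := j) (by omega) hlt
    (by rw [hij.W_eq]; exact mem_W_self x j)
  have cj := hx.abs_approxNum_sub_mul_le hξ (i := j) (k := k) (by omega) hlt'
    (by rw [hjk.W_eq]; exact mem_W_self x k)
  have Xi := hx.norm_pos (i := i) (by omega)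
  have Xi1 := hx.norm_pos (i := i + 1) (by omega)
  have Xj := hx.norm_pos (i := j) (by omega)
  have Xj1 := hx.norm_pos (i := j + 1) (by omega)
  have Xk := hx.norm_pos (i := k) (by omega)
  have Li := hx.L_pos hξ (i := i) (by omega)
  have Lj := hx.L_pos hξ (i := j) (by omega)
  have Lk := hx.L_pos hξ (i := k) (by omega)
  have hK : (0 : ℝ) < 61440 * powBound ξ ^ 4 := by positivity
  have hhalf : 1 / 2 ≤ |(approxDen x j : ℝ)| * |(approxNum x i : ℝ) - ξ * approxDen x i| ∨
      1 / 2 ≤ |(approxDen x i : ℝ)| * |(approxNum x j : ℝ) - ξ * approxDen x j| := by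
    by_contra! h
    linarith
  rcases hhalf with h | h
  · left
    have h4 : ‖x j‖ ≤ 61440 * powBound ξ ^ 4 *
        ((‖x (j + 1)‖ * L ξ (x j) ^ 3) * ((‖x i‖ * L ξ (x i)) * ‖x (i + 1)‖)) := by
      have h5 := mul_le_mul bj ci (by positivity) (by positivity)
      have h6 := mul_le_mul_of_nonneg_right h Xj.le
      linarith
    have h7 := Real.log_le_log Xj h4
    rw [Real.log_mul hK.ne' (by positivity),
      Real.log_mul (mul_pos Xj1 (pow_pos Lj 3)).ne' (mul_pos (mul_pos Xi Li) Xi1).ne',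
      Real.log_mul Xj1.ne' (pow_pos Lj 3).ne', Real.log_mul (mul_pos Xi Li).ne' Xi1.ne',
      Real.log_mul Xi.ne' Li.ne', Real.log_pow (L ξ (x j)) 3] at h7
    push_cast at h7
    unfold logN logL
    linarith
  · right
    have h4 : ‖x k‖ ≤ 61440 * powBound ξ ^ 4 *
        ((‖x (i + 1)‖ * L ξ (x i) ^ 2) * ((‖x j‖ * L ξ (x j)) * (L ξ (x k) * ‖x (j + 1)‖))) := by
      have h5 := mul_le_mul bi cj (by positivity) (by positivity)
      have h6 := mul_le_mul_of_nonneg_right h Xk.le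
      linarith
    have h7 := Real.log_le_log Xk h4
    rw [Real.log_mul hK.ne' (by positivity),
      Real.log_mul (mul_pos Xi1 (pow_pos Li 2)).ne'
        (mul_pos (mul_pos Xj Lj) (mul_pos Lk Xj1)).ne',
      Real.log_mul Xi1.ne' (pow_pos Li 2).ne',
      Real.log_mul (mul_pos Xj Lj).ne' (mul_pos Lk Xj1).ne',
      Real.log_mul Xj.ne' Lj.ne', Real.log_mul Lk.ne' Xj1.ne', Real.log_pow (L ξ (x i)) 2] at h7
    push_cast at h7
    unfold logN logL
    linarith

theorem exists_le_logN (hx : IsMinimalSeq ξ x) (B : ℝ) :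
    ∃ N : ℕ, 1 ≤ N ∧ ∀ i, N ≤ i → B ≤ logN x i := by
  obtain ⟨n, hn⟩ := exists_nat_ge (Real.exp B)
  refine ⟨max n 1, le_max_right _ _, fun i hi => ?_⟩
  have hi1 : 1 ≤ i := (le_max_right _ _).trans hi
  have h1 : (n : ℝ) ≤ i := by exact_mod_cast (le_max_left _ _).trans hi
  rw [logN, Real.le_log_iff_exp_le (hx.norm_pos hi1)]
  linarith [hx.natCast_le_norm hi1]

end IsMinimalSeq

/-- The relation between three consecutive elements `h < i < j` of `I` with `i ∈ J`. -/
theorem ApproxBound.logN_add_le (hc : ApproxBound ξ lam c) (hξ : 3 < Module.rank ℚ ℚ⟮ξ⟯)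
    {x : ℕ → Fin 4 → ℤ} (hx : IsMinimalSeq ξ x) {h i j : ℕ} (hhi : Consecutive x h i)
    (hij : Consecutive x i j) (hi : i ∈ J x) :
    logN x i + logN x j ≤
      (1 - lam) * (logN x (h + 1) + logN x (i + 1) + logN x (j + 1)) +
        (3 * Real.log c + Real.log (512 * powBound ξ ^ 2) + Real.log (16 * powBound ξ)) := by
  have h2 := hhi.two_le
  have h3 := hhi.lt
  have h4 := hij.lt
  have e1 := hx.logN_le_of_mem_J hξ hij hi
  have e2 := hx.log_height_le hξ (by omega) hhi.mem_right hhi.W_eq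
  have e3 := hc.logL_le hξ hx (i := h) (by omega)
  have e4 := hc.logL_le hξ hx (i := i) (by omega)
  have e5 := hc.logL_le hξ hx (i := j) (by omega)
  linarith

/-- If all large elements of `I` belonged to `J`, the integer approximations to `(1, ξ)` attached
to them would eventually all be proportional to a fixed one, although they converge to `ξ`. -/
theorem ApproxBound.exists_notMem_J (hc : ApproxBound ξ lam c) (hξ : 3 < Module.rank ℚ ℚ⟮ξ⟯)
    (hlam : 0 < lam) (hθ : lam * (1 + θ) = 1) (h1 : 4 / 3 ≤ θ) (h2 : θ ≤ 1.356)
    {x : ℕ → Fin 4 → ℤ} (hx : IsMinimalSeq ξ x) (N : ℕ) : ∃ h ∈ I x, N ≤ h ∧ h ∉ J x := by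
  by_contra! hJ
  have hM := one_le_powBound ξ
  have hθ0 : 0 < θ := by linarith
  have hθ2 : θ ^ 2 < 2 := by nlinarith
  obtain ⟨B₁, hB₁⟩ := hc.exists_eq_zero_of_recurs hξ hlam hθ hθ0 hθ2
  obtain ⟨B₂, hB₂⟩ := hc.exists_hankel_ne_zero hξ (by nlinarith)
  obtain ⟨κ₀, hκ₀⟩ := hc.exists_logN_succ_le hξ hlam hθ hθ0 hθ2
  set κs := 3 * Real.log c + Real.log (512 * powBound ξ ^ 2) + Real.log (16 * powBound ξ) with hκs
  set κ := max (max κs κ₀) 0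
  have hκ1 : κs ≤ κ := (le_max_left _ _).trans (le_max_left _ _)
  have hκ2 : κ₀ ≤ κ := (le_max_right _ _).trans (le_max_left _ _)
  have hκ3 : 0 ≤ κ := le_max_right _ _
  set κ₁ := (θ * (1 + θ) + 1) * κ
  have hκ₁ : κ ≤ κ₁ := by
    have : 0 ≤ θ * (1 + θ) * κ := by positivity
    simp only [κ₁]
    linarith
  obtain ⟨B₃, hB₃⟩ := exists_det_terms_neg (κ := κ₁)
    (κ' := 4 * Real.log c + Real.log (61440 * powBound ξ ^ 4)) hθ h1 h2
  obtain ⟨N', hN'1, hN'⟩ := hx.exists_le_logN (max (max B₁ B₂) B₃)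
  -- elements of `I` that are large and have two predecessors that are large
  have hIinf := hx.infinite_I hξ
  obtain ⟨m₀, hm₀, hm₀N⟩ := hIinf.exists_gt (max N N')
  obtain ⟨m₁, hm₁⟩ := exists_succ_of_infinite hIinf hm₀
  obtain ⟨m₂, hm₂⟩ := exists_succ_of_infinite hIinf hm₁.mem_right
  have hm₁lt := hm₁.lt
  have hm₂lt := hm₂.lt
  have hN0 : N < m₀ := (le_max_left _ _).trans_lt hm₀N
  have hN0' : N' < m₀ := (le_max_right _ _).trans_lt hm₀N
  have hpreds : ∀ i ∈ I x, m₂ ≤ i → ∃ g h, m₀ ≤ g ∧ Consecutive x g h ∧ Consecutive x h i := by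
    intro i hi hmi
    obtain ⟨h, hh, hhi⟩ := exists_pred_of_mem hi hm₂.1 (by omega)
    obtain ⟨g, hg, hgh⟩ := exists_pred_of_mem hhi.1 hm₀ (by omega)
    exact ⟨g, h, hg, hgh, hhi⟩
  have hmono : ∀ i j, Consecutive x i j → logN x (i + 1) ≤ logN x j := fun i j hij => by
    have := hij.lt
    exact hx.logN_le_logN (by omega) (by omega)
  have hstar : ∀ h i j, m₀ ≤ h → Consecutive x h i → Consecutive x i j →
      logN x i + logN x j ≤
        (1 - lam) * (logN x (h + 1) + logN x (i + 1) + logN x (j + 1)) + κ := by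
    intro h i j hh hhi hij
    have := hhi.lt
    exact (hc.logN_add_le hξ hx hhi hij (hJ i hij.1 (by omega))).trans (by linarith)
  have hgrow : ∀ i ∈ I x, m₂ ≤ i → (1 + θ) * logN x i - κ₁ ≤ θ ^ 2 * logN x (i + 1) := by
    intro i hi hmi
    obtain ⟨g, h, hg, hgh, hhi⟩ := hpreds i hi hmi
    exact growth_one hθ h1 (hstar g h i hg hgh hhi) (hmono g h hgh) (hmono h i hhi)
      ((hκ₀ x hx h hhi.1).trans (by linarith))
  have hprop : ∀ i j, m₂ ≤ i → Consecutive x i j →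
      approxDen x i * approxNum x j = approxNum x i * approxDen x j := by
    intro i j hmi hij
    by_contra hdet
    have hijlt := hij.lt
    obtain ⟨k, hjk⟩ := exists_succ_of_infinite hIinf hij.mem_right
    have hjklt := hjk.lt
    obtain ⟨g, h, hg, hgh, hhi⟩ := hpreds i hij.1 hmi
    have hghlt := hgh.lt
    have hs1 := hstar h i j (by omega) hhi hij
    have hs2 := hstar i j k (by omega) hij hjk
    obtain ⟨t1, t2⟩ := hB₃ (logN x (h + 1)) (logN x i) (logN x (i + 1)) (logN x j)
      (logN x (j + 1)) (logN x k) (logN x (k + 1))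
      ((le_max_right _ _).trans (hN' i (by omega))) ((le_max_right _ _).trans (hN' j (by omega)))
      (hmono h i hhi) (hmono i j hij) (hmono j k hjk) (hgrow i hij.1 hmi)
      (hgrow j hjk.1 (by omega)) (by linarith) (by linarith)
    have l1 := hc.logL_le hξ hx (i := i) (by omega)
    have l2 := hc.logL_le hξ hx (i := j) (by omega)
    have l3 := hc.logL_le hξ hx (i := k) (by omega)
    rcases hx.det_terms hξ hij hjk hdet with h | h
    · linarith
    · linarith
  have hne : ∀ i ∈ I x, m₂ ≤ i → approxDen x i ≠ 0 ∨ approxNum x i ≠ 0 := by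
    intro i hi hmi
    by_contra! h0
    have hB := hN' i (by omega)
    refine hB₂ x hx i hi.1 (((le_max_right _ _).trans (le_max_left _ _)).trans hB) ?_
    exact hB₁ x hx i hi (((le_max_left _ _).trans (le_max_left _ _)).trans hB) _
      (recurs_hankel _) h0
  -- all approximations are proportional to the one at `m₂`
  have hall : ∀ i ∈ I x, m₂ ≤ i →
      approxDen x m₂ * approxNum x i = approxNum x m₂ * approxDen x i := by
    refine induction_I hm₂.mem_right (mul_comm _ _) fun i j hmi hij hi => ?_
    have h3 := hprop i j hmi hij
    rcases hne i hij.1 hmi with h | h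
    · refine mul_left_cancel₀ h ?_
      linear_combination approxDen x m₂ * h3 + approxDen x j * hi
    · refine mul_left_cancel₀ h ?_
      linear_combination approxNum x m₂ * h3 + approxNum x j * hi
  set D := (approxNum x m₂ : ℝ) - ξ * approxDen x m₂ with hD
  have hD0 : 0 < |D| := by
    refine abs_pos.2 fun h0 => ?_
    have h3 : (approxDen x m₂ : ℝ) * ξ = approxNum x m₂ := by rw [hD] at h0; linarith
    have h4 := irrational_of_rank hξ h3
    rw [h4, Int.cast_zero, zero_mul] at h3
    have h5 : approxNum x m₂ = 0 := by exact_mod_cast h3.symm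
    rcases hne m₂ hm₂.mem_right le_rfl with h | h
    · exact h h4
    · exact h h5
  set R := |(approxDen x m₂ : ℝ)| + |(approxNum x m₂ : ℝ)|
  have hlow : ∀ i ∈ I x, m₂ ≤ i →
      |D| ≤ R * |(approxNum x i : ℝ) - ξ * approxDen x i| := by
    intro i hi hmi
    have h3 : (approxDen x m₂ : ℝ) * approxNum x i = approxNum x m₂ * approxDen x i := by
      exact_mod_cast hall i hi hmi
    set E := (approxNum x i : ℝ) - ξ * approxDen x i with hE
    have h4 : (approxDen x m₂ : ℝ) * E = approxDen x i * D := by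
      rw [hE, hD]; linear_combination h3
    have h5 : (approxNum x m₂ : ℝ) * E = approxNum x i * D := by
      rw [hE, hD]; linear_combination ξ * h3
    have key : ∀ (p : ℤ) (r : ℝ), p ≠ 0 → r * E = p * D → |D| ≤ |r| * |E| := by
      intro p r hp h
      rw [← abs_mul, h, abs_mul]
      refine le_mul_of_one_le_left (abs_nonneg _) ?_
      exact_mod_cast Int.one_le_abs hp
    have h6 := mul_nonneg (abs_nonneg (approxDen x m₂ : ℝ)) (abs_nonneg E)
    have h7 := mul_nonneg (abs_nonneg (approxNum x m₂ : ℝ)) (abs_nonneg E)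
    simp only [R]
    rw [add_mul]
    rcases hne i hi hmi with h | h
    · linarith [key _ _ h h4]
    · linarith [key _ _ h h5]
  -- but they converge to `ξ`
  have hR : 0 < R := by
    have h3 := hlow m₂ hm₂.mem_right le_rfl
    by_contra! h4
    have : R * |D| ≤ 0 := mul_nonpos_of_nonpos_of_nonneg h4 (abs_nonneg _)
    linarith
  set κ₂ := Real.log (24 * powBound ξ ^ 2) + 2 * Real.log c + 2 * lam * κ₁ / θ ^ 2
  have hpos : 0 < 2 - θ ^ 2 := by linarith
  obtain ⟨N'', hN''1, hN''⟩ := hx.exists_le_logN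
    (θ ^ 2 * (κ₂ - Real.log (|D| / R) + 1) / (2 - θ ^ 2))
  obtain ⟨i, hi, hiN⟩ := hIinf.exists_gt (max N'' m₂)
  have hmi : m₂ ≤ i := (le_max_right _ _).trans hiN.le
  have h3 := hlow i hi hmi
  have hi1 : 1 ≤ i := by omega
  have h4 := hx.abs_approxNum_sub_le hi1
  have hXp := hx.norm_pos hi1
  have hLp := hx.L_pos hξ hi1
  have h5 : |D| / R ≤ 24 * powBound ξ ^ 2 * (‖x i‖ * L ξ (x i) ^ 2) := by
    rw [div_le_iff₀' hR]
    exact h3.trans (by gcongr)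
  have h6 := Real.log_le_log (div_pos hD0 hR) h5
  rw [Real.log_mul (by positivity : 24 * powBound ξ ^ 2 ≠ 0) (by positivity),
    Real.log_mul hXp.ne' (pow_pos hLp 2).ne', Real.log_pow (L ξ (x i)) 2] at h6
  push_cast at h6
  have h7 := hc.logL_le hξ hx hi1
  have h8 := hgrow i hi hmi
  have h9 := hN'' i ((le_max_left _ _).trans hiN.le)
  rw [div_le_iff₀ hpos] at h9
  have h10 : (2 * logN x i - 2 * lam * κ₁) / θ ^ 2 ≤ 2 * lam * logN x (i + 1) := by
    rw [div_le_iff₀ (by positivity)]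
    have : 2 * lam * ((1 + θ) * logN x i - κ₁) ≤ 2 * lam * (θ ^ 2 * logN x (i + 1)) := by
      gcongr
    have e : 2 * lam * ((1 + θ) * logN x i - κ₁) = 2 * logN x i - 2 * lam * κ₁ := by
      linear_combination 2 * logN x i * hθ
    linarith
  rw [sub_div] at h10
  have h11 : Real.log (|D| / R) ≤ κ₂ + logN x i - 2 * logN x i / θ ^ 2 := by
    unfold logL logN at *
    simp only [κ₂]
    linarith
  have h12 : θ ^ 2 * Real.log (|D| / R) ≤ θ ^ 2 * (κ₂ + logN x i) - 2 * logN x i := by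
    calc θ ^ 2 * Real.log (|D| / R) ≤ θ ^ 2 * (κ₂ + logN x i - 2 * logN x i / θ ^ 2) := by gcongr
      _ = _ := by field_simp
  have h13 : 0 < θ ^ 2 := by positivity
  linarith

/-! ### Runs of consecutive elements of `I` -/

/-- There are runs arbitrarily far in `I`. -/
theorem exists_isRun {x : ℕ → Fin 4 → ℤ} (hI : (I x).Infinite) (hJ : (J x).Infinite)
    (hIJ : ∀ N, ∃ h ∈ I x, N ≤ h ∧ h ∉ J x) (N : ℕ) :
    ∃ g h i j, N ≤ h ∧ IsRun x g h i j := by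
  classical
  obtain ⟨m, hm⟩ := hI.nonempty
  obtain ⟨h₀, hh₀, hN, hh₀J⟩ := hIJ (max N (m + 1))
  have hex : ∃ k, k ∈ J x ∧ h₀ < k := by
    obtain ⟨k, hk, hlt⟩ := hJ.exists_gt h₀
    exact ⟨k, hk, hlt⟩
  set i := Nat.find hex
  obtain ⟨hiJ, hhi⟩ : i ∈ J x ∧ h₀ < i := Nat.find_spec hex
  obtain ⟨h, hh, hch⟩ := exists_pred_of_mem hiJ.1 hh₀ hhi
  have hhJ : h ∉ J x := by
    rcases hh.eq_or_lt with rfl | hlt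
    · exact hh₀J
    · exact fun hc => Nat.find_min hex hch.lt ⟨hc, hlt⟩
  have h1 := (le_max_left N (m + 1)).trans hN
  have h2 := (le_max_right N (m + 1)).trans hN
  obtain ⟨g, -, hg⟩ := exists_pred_of_mem hch.1 hm (by omega)
  obtain ⟨j, hj⟩ := exists_succ_of_infinite hI hiJ.1
  exact ⟨g, h, i, j, by omega, hg, hch, hj, hhJ, hiJ⟩

/-- A lower bound of slack `A₁ ≥ 0` and two upper bounds of slack `A₂, A₃ ≥ 0` for a quantity `H` in
terms of `aj` and `bh` are compatible only if `A₁`, `A₂`, `A₃` are bounded: eliminating `H` and `aj`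
leaves a relation in which `bh` has a non-negative coefficient. With `u = θ² - 1`, the number
`(θ - u) - u² / θ` vanishes when `u = θ / φ` and is positive when `u < θ / φ`. -/
theorem slack_bounded {lam θ κ : ℝ} (hlam : 0 < lam) (hθ : lam * (1 + θ) = 1) (h1 : 4 / 3 ≤ θ)
    (h2 : θ ≤ 1.356) (hu : θ ^ 2 - 1 ≤ θ / φ) :
    ∃ C : ℝ, 0 ≤ C ∧ ∀ H aj bh A₁ A₂ A₃ : ℝ, 0 ≤ A₁ → 0 ≤ A₂ → 0 ≤ A₃ → 0 ≤ bh →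
      H = (1 - lam * θ ^ 2) * aj + A₁ - (3 - lam) * κ →
      H = (1 - lam - lam / θ) * bh - A₂ + (3 + lam / θ) * κ →
      H = (1 - lam) * aj - lam * bh - A₃ + 3 * κ →
      ((θ - (θ ^ 2 - 1)) - (θ ^ 2 - 1) ^ 2 / θ) * bh ≤ C ∧ A₁ ≤ C ∧ A₂ ≤ C ∧ A₃ ≤ C ∧
      |(θ ^ 2 - 1) * aj - bh| ≤ C ∧ |H - (lam * θ * aj - lam * bh)| ≤ C := by
  have hθ0 : 0 < θ := by linarith
  have hφ := Real.goldenRatio_pos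
  have hlam1 : lam ≤ 1 / 2 := by nlinarith
  obtain ⟨u, hudef⟩ : ∃ u, u = θ ^ 2 - 1 := ⟨_, rfl⟩
  have e1 : lam * θ = 1 - lam := by linarith
  have e2 : 1 - lam * θ ^ 2 = lam * (θ - u) := by rw [hudef]; linarith
  have e3 : 1 - lam - lam / θ = lam * (u / θ) := by
    field_simp
    rw [hudef]
    linear_combination -θ * e1
  rw [e2, e3]
  have hu0 : 0 < u := by rw [hudef]; nlinarith
  have huθ : 0 < θ - u := by rw [hudef]; nlinarith
  simp only [← hudef] at hu ⊢
  have hcoef : 0 ≤ (θ - u) - u ^ 2 / θ := by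
    have h3 : u * φ ≤ θ := by rwa [le_div_iff₀ hφ] at hu
    have h5 := Real.goldenRatio_sq
    rw [sub_nonneg, div_le_iff₀ hθ0]
    have h4 : φ * u ^ 2 + φ * (u * θ) ≤ φ * θ ^ 2 := by
      have h6 : φ * u ≤ θ := by linarith
      have h7 : φ * u * u ≤ θ * u := by gcongr
      have h8 : (φ + 1) * (u * θ) ≤ φ * (θ * θ) := by
        rw [← h5]
        have : φ * (φ * u) * θ ≤ φ * θ * θ := by gcongr
        linarith
      linarith
    have : φ * (u ^ 2) ≤ φ * ((θ - u) * θ) := by linarith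
    exact le_of_mul_le_mul_left this hφ
  clear hudef hu h1 h2 hφ e2 e3
  obtain ⟨c₁, hc₁⟩ : ∃ z, z = lam * (θ - u) := ⟨_, rfl⟩
  obtain ⟨c₂, hc₂⟩ : ∃ z, z = lam * u := ⟨_, rfl⟩
  have hc₁0 : 0 < c₁ := hc₁ ▸ mul_pos hlam huθ
  have hc₂0 : 0 < c₂ := hc₂ ▸ mul_pos hlam hu0
  obtain ⟨C₀, hC₀⟩ : ∃ z, z = |(c₁ * (6 - lam) + c₂ * (6 - lam + lam / θ)) * κ| := ⟨_, rfl⟩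
  have hC₀0 : 0 ≤ C₀ := hC₀ ▸ abs_nonneg _
  obtain ⟨C₁, hC₁⟩ : ∃ z, z = C₀ / c₁ + C₀ / c₂ := ⟨_, rfl⟩
  have d1 : C₀ / c₁ ≤ C₁ := hC₁ ▸ le_add_of_nonneg_right (by positivity)
  have d2 : C₀ / c₂ ≤ C₁ := hC₁ ▸ le_add_of_nonneg_left (by positivity)
  have hC₁0 : 0 ≤ C₁ := le_trans (by positivity) d1
  have t1 : 0 ≤ C₀ / lam ^ 2 := by positivity
  have t3 : 0 ≤ (2 * C₁ + 6 * |κ|) / lam := by positivity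
  have κ1 := le_abs_self κ
  have κ2 := neg_abs_le κ
  refine ⟨C₀ / lam ^ 2 + C₁ + 3 * |κ| + (2 * C₁ + 6 * |κ|) / lam, by positivity, ?_⟩
  intro H aj bh A₁ A₂ A₃ hA₁0 hA₂0 hA₃0 hbh E1 E2 E3
  rw [← hc₁] at E1
  have e4 : 1 - lam - c₁ = c₂ := by rw [hc₁, hc₂]; linarith
  have F3 : c₂ * aj = lam * bh + A₃ + A₁ - (6 - lam) * κ := by
    rw [← e4]; linear_combination E1 - E3
  have F2 : c₁ * aj = lam * (u / θ) * bh - A₂ - A₁ + (6 - lam + lam / θ) * κ := by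
    linear_combination E2 - E1
  have F : lam ^ 2 * ((θ - u) - u ^ 2 / θ) * bh + c₁ * (A₃ + A₁) + c₂ * (A₁ + A₂) =
      (c₁ * (6 - lam) + c₂ * (6 - lam + lam / θ)) * κ := by
    have e5 : c₂ * (lam * (u / θ)) = lam ^ 2 * (u ^ 2 / θ) := by rw [hc₂]; ring
    have e6 : c₁ * lam = lam ^ 2 * (θ - u) := by rw [hc₁]; ring
    linear_combination c₂ * F2 - c₁ * F3 - bh * e6 + bh * e5
  have G : (c₁ * (6 - lam) + c₂ * (6 - lam + lam / θ)) * κ ≤ C₀ := hC₀ ▸ le_abs_self _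
  rw [← F] at G
  have q0 : 0 ≤ lam ^ 2 * ((θ - u) - u ^ 2 / θ) * bh := by positivity
  have q1 := mul_nonneg hc₁0.le hA₃0
  have q2 := mul_nonneg hc₁0.le hA₁0
  have q3 := mul_nonneg hc₂0.le hA₁0
  have q4 := mul_nonneg hc₂0.le hA₂0
  have B₁ : A₁ ≤ C₁ := le_trans (by rw [le_div_iff₀ hc₁0]; linarith only [G, q0, q1, q2, q3, q4]) d1
  have B₃ : A₃ ≤ C₁ := le_trans (by rw [le_div_iff₀ hc₁0]; linarith only [G, q0, q1, q2, q3, q4]) d1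
  have B₂ : A₂ ≤ C₁ := le_trans (by rw [le_div_iff₀ hc₂0]; linarith only [G, q0, q1, q2, q3, q4]) d2
  have κ0 := abs_nonneg κ
  refine ⟨?_, by linarith only [B₁, t1, t3, κ0], by linarith only [B₂, t1, t3, κ0],
    by linarith only [B₃, t1, t3, κ0], ?_, ?_⟩
  · have : ((θ - u) - u ^ 2 / θ) * bh ≤ C₀ / lam ^ 2 := by
      rw [le_div_iff₀ (by positivity)]; linarith only [G, q1, q2, q3, q4]
    linarith only [this, t3, κ0, hC₁0]
  · have h3 : |lam * (u * aj - bh)| ≤ 2 * C₁ + 6 * |κ| := by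
      have h4 : lam * (u * aj - bh) = A₃ + A₁ - (6 - lam) * κ := by
        rw [hc₂] at F3; linear_combination F3
      have h5 : |(6 - lam) * κ| ≤ 6 * |κ| := by
        rw [abs_mul, abs_of_pos (by linarith only [hlam1])]
        gcongr
        linarith only [hlam]
      rw [h4]
      obtain ⟨h6, h7⟩ := abs_le.1 h5
      rw [abs_le]
      constructor
      · linarith only [h7, hA₃0, hA₁0, hC₁0]
      · linarith only [h6, B₁, B₃]
    rw [abs_mul, abs_of_pos hlam] at h3
    have : |u * aj - bh| ≤ (2 * C₁ + 6 * |κ|) / lam := by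
      rw [le_div_iff₀ hlam]; linarith only [h3]
    linarith only [this, t1, κ0, hC₁0]
  · rw [e1, E3, abs_le]
    constructor
    · linarith only [κ2, B₃, t1, t3]
    · linarith only [κ1, hA₃0, hC₁0, t1, t3]

/-- The estimates along a run, in logarithmic form. Here `a_k` and `b_k` stand for `log X_k` and
`log X_{k+1}`, and the conclusion says that all estimates used are sharp up to a bounded error. -/
theorem run_slack {lam θ κ : ℝ} (hlam : 0 < lam) (hθ : lam * (1 + θ) = 1) (h1 : 4 / 3 ≤ θ)
    (h2 : θ ≤ 1.356) (hu : θ ^ 2 - 1 ≤ θ / φ) :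
    ∃ C : ℝ, ∀ H bg lg ah bh lh ai bi li aj bj lj : ℝ,
      aj ≤ H + bj + lj + κ → H ≤ bg + lg + bh + lh - ah + κ → H ≤ bh + lh + bi + li - ai + κ →
      lg ≤ κ - lam * bg → lh ≤ κ - lam * bh → li ≤ κ - lam * bi → lj ≤ κ - lam * bj →
      bh ≤ θ * ah + κ → bj ≤ θ * aj + κ → bg ≤ ah → bh ≤ ai → bi ≤ aj → 0 ≤ bh →
      ((θ - (θ ^ 2 - 1)) - (θ ^ 2 - 1) ^ 2 / θ) * bh ≤ C ∧
      ah ≤ bg + C ∧ ai ≤ bh + C ∧ aj ≤ bi + C ∧ θ * ah ≤ bh + C ∧ θ * aj ≤ bj + C ∧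
      -lam * bg ≤ lg + C ∧ -lam * bh ≤ lh + C ∧ -lam * bi ≤ li + C ∧ -lam * bj ≤ lj + C ∧
      |(θ ^ 2 - 1) * aj - bh| ≤ C ∧ |H - (lam * θ * aj - lam * bh)| ≤ C := by
  have hθ0 : 0 < θ := by linarith
  have hlam1 : lam ≤ 1 / 2 := by nlinarith
  have e1 : lam * θ = 1 - lam := by linarith
  obtain ⟨C₁, hC₁, key⟩ := slack_bounded (κ := κ) hlam hθ h1 h2 hu
  clear h1 h2 hu hθ
  refine ⟨2 * C₁ + θ / lam * C₁ + |κ|, ?_⟩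
  intro H bg lg ah bh lh ai bi li aj bj lj r1 r2 r3 lg' lh' li' lj' βh βj mg mh mi hbh
  have p1 : 0 ≤ (1 - lam) * (θ * aj + κ - bj) :=
    mul_nonneg (by linarith only [hlam1]) (by linarith only [βj])
  have p2 : 0 ≤ lam / θ * (θ * ah + κ - bh) := mul_nonneg (by positivity) (by linarith only [βh])
  have p3 : 0 ≤ (1 - lam) * (ah - bg) :=
    mul_nonneg (by linarith only [hlam1]) (by linarith only [mg])
  have p4 : 0 ≤ (1 - lam) * (aj - bi) :=
    mul_nonneg (by linarith only [hlam1]) (by linarith only [mi])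
  obtain ⟨K0, K1, K2, K3, K4, K5⟩ := key H aj bh
    ((H + bj + lj + κ - aj) + (κ - lam * bj - lj) + (1 - lam) * (θ * aj + κ - bj))
    (lam / θ * (θ * ah + κ - bh) + (1 - lam) * (ah - bg) +
      (bg + lg + bh + lh - ah + κ - H) + (κ - lam * bg - lg) + (κ - lam * bh - lh))
    ((1 - lam) * (aj - bi) + (ai - bh) + (bh + lh + bi + li - ai + κ - H) +
      (κ - lam * bh - lh) + (κ - lam * bi - li))
    (by linarith only [r1, lj', p1]) (by linarith only [r2, lg', lh', p2, p3])
    (by linarith only [r3, lh', li', mh, p4]) hbh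
    (by linear_combination θ * aj * e1) (by field_simp; ring) (by ring)
  clear key
  have κ1 := le_abs_self κ
  have κ0 := abs_nonneg κ
  have t2 : 0 ≤ θ / lam * C₁ := by positivity
  have half : ∀ z : ℝ, (1 - lam) * z ≤ C₁ → 0 ≤ z → z ≤ 2 * C₁ := fun z hz hz0 => by
    nlinarith only [hz, hz0, hlam1]
  refine ⟨?_, ?_, ?_, ?_, ?_, ?_, ?_, ?_, ?_, ?_, ?_, ?_⟩
  · linarith only [K0, t2, κ0, hC₁]
  · have := half (ah - bg) (by linarith only [K2, r2, lg', lh', p2]) (by linarith only [mg])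
    linarith only [this, t2, κ0]
  · linarith only [K3, r3, lh', li', mh, p4, t2, κ0, hC₁]
  · have := half (aj - bi) (by linarith only [K3, r3, lh', li', mh]) (by linarith only [mi])
    linarith only [this, t2, κ0]
  · have h3 : lam / θ * (θ * ah + κ - bh) ≤ C₁ := by linarith only [K2, r2, lg', lh', p3]
    have h4 : θ * ah + κ - bh ≤ θ / lam * C₁ := by
      calc θ * ah + κ - bh = θ / lam * (lam / θ * (θ * ah + κ - bh)) := by field_simp
        _ ≤ θ / lam * C₁ := by gcongr
    linarith only [h4, neg_abs_le κ, hC₁]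
  · have := half (θ * aj + κ - bj) (by linarith only [K1, r1, lj']) (by linarith only [βj])
    linarith only [this, t2, neg_abs_le κ]
  · linarith only [K2, r2, lh', p2, p3, neg_abs_le κ, hC₁, t2]
  · linarith only [K2, r2, lg', p2, p3, neg_abs_le κ, hC₁, t2]
  · linarith only [K3, r3, lh', mh, p4, neg_abs_le κ, hC₁, t2]
  · linarith only [K1, r1, p1, neg_abs_le κ, hC₁, t2]
  · linarith only [K4, t2, κ0, hC₁]
  · linarith only [K5, t2, κ0, hC₁]

/-- The number `(θ - u) - u² / θ` with `u = θ² - 1` is non-positive only if `u ≥ θ / φ`. -/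
theorem eq_div_goldenRatio {θ : ℝ} (h1 : 4 / 3 ≤ θ) (hu : θ ^ 2 - 1 ≤ θ / φ)
    (h : (θ - (θ ^ 2 - 1)) - (θ ^ 2 - 1) ^ 2 / θ ≤ 0) : θ ^ 2 - 1 = θ / φ := by
  have hθ0 : 0 < θ := by linarith
  have hφ := Real.goldenRatio_pos
  have hsq := Real.goldenRatio_sq
  refine le_antisymm hu ?_
  set u := θ ^ 2 - 1
  have hu0 : 0 < u := by nlinarith
  rw [sub_nonpos, le_div_iff₀ hθ0] at h
  rw [div_le_iff₀ hφ]
  by_contra! hlt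
  have h3 : 0 < (θ - u * φ) * (θ * φ + u) := mul_pos (by linarith) (by positivity)
  have h4 : (θ - u * φ) * (θ * φ + u) = φ * ((θ - u) * θ - u ^ 2) := by
    linear_combination -(θ * u) * hsq
  rw [h4] at h3
  linarith [(pos_iff_pos_of_mul_pos h3).1 hφ]

/-! ### Existence of sequences of minimal points -/

theorem UniformlyApproximable.mono {lam' : ℝ} (h : UniformlyApproximable ξ lam) (hle : lam' ≤ lam) :
    UniformlyApproximable ξ lam' := by
  obtain ⟨c, hc, h⟩ := h
  refine ⟨c, hc, ?_⟩
  filter_upwards [h, eventually_ge_atTop 1] with X hX hX1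
  obtain ⟨y, hy, h1, h2⟩ := hX
  refine ⟨y, hy, h1, h2.trans ?_⟩
  gcongr

theorem UniformlyApproximable.exists_L_lt (h : UniformlyApproximable ξ lam) (hlam : 0 < lam)
    {ε : ℝ} (hε : 0 < ε) : ∃ y : Fin 4 → ℤ, y ≠ 0 ∧ L ξ y < ε := by
  obtain ⟨c, hc, h⟩ := h
  have h1 : ∀ᶠ X : ℝ in atTop, c * X ^ (-lam) < ε := by
    have := (tendsto_rpow_neg_atTop hlam).const_mul c
    rw [mul_zero] at this
    exact this.eventually_lt_const hε
  obtain ⟨X, ⟨y, hy, -, hyL⟩, hX⟩ := (h.and h1).exists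
  exact ⟨y, hy, hyL.trans_lt hX⟩

/-- A nonempty set of integer points has an element of least norm with, among those, the least
value of `L`. -/
theorem exists_minimal_point (ξ : ℝ) {S : Set (Fin 4 → ℤ)} (hS : S.Nonempty) :
    ∃ z ∈ S, ∀ w ∈ S, ‖z‖ ≤ ‖w‖ ∧ (‖w‖ = ‖z‖ → L ξ z ≤ L ξ w) := by
  obtain ⟨y, hy⟩ := hS
  have hmin : ∀ (T : Set (Fin 4 → ℤ)) (f : (Fin 4 → ℤ) → ℝ), T.Finite → T.Nonempty →
      ∃ z ∈ T, ∀ w ∈ T, f z ≤ f w := fun T f hT hne => by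
    obtain ⟨z, hz, h⟩ := hT.exists_minimalFor f T hne
    refine ⟨z, hz, fun w hw => ?_⟩
    rcases le_total (f z) (f w) with h' | h'
    · exact h'
    · exact h hw h'
  obtain ⟨z₁, hz₁, h1⟩ := hmin (S ∩ {w | ‖w‖ ≤ ‖y‖}) (fun w => ‖w‖)
    ((finite_norm_le _).inter_of_right _) ⟨y, hy, le_refl ‖y‖⟩
  have h1' : ∀ w ∈ S, ‖z₁‖ ≤ ‖w‖ := fun w hw => by
    rcases le_total ‖w‖ ‖y‖ with h | h
    · exact h1 w ⟨hw, h⟩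
    · exact le_trans hz₁.2 h
  obtain ⟨z, hz, h2⟩ := hmin (S ∩ {w | ‖w‖ ≤ ‖z₁‖}) (L ξ)
    ((finite_norm_le _).inter_of_right _) ⟨z₁, hz₁.1, le_refl ‖z₁‖⟩
  refine ⟨z, hz.1, fun w hw => ⟨le_trans hz.2 (h1' w hw), fun hwz => h2 w ⟨hw, ?_⟩⟩⟩
  exact hwz.le.trans hz.2

theorem exists_isMinimalSeq (hξ : 3 < Module.rank ℚ ℚ⟮ξ⟯) (hlam : 0 < lam)
    (happ : UniformlyApproximable ξ lam) : ∃ x, IsMinimalSeq ξ x := by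
  set P : (Fin 4 → ℤ) → Prop := fun y => y ≠ 0 ∧ ∀ w, w ≠ 0 → L ξ w < L ξ y → ‖y‖ < ‖w‖
  obtain ⟨y₀, hy₀, hy₀'⟩ := exists_minimal_point ξ (S := {y | y ≠ 0})
    ⟨Pi.single 0 1, by simp⟩
  have hP₀ : P y₀ := ⟨hy₀, fun w hw hwL => by
    obtain ⟨h1, h2⟩ := hy₀' w hw
    refine lt_of_le_of_ne h1 fun h => ?_
    exact absurd (h2 h.symm) (not_le.2 hwL)⟩
  have hstep : ∀ y : {y // P y}, ∃ z : {z // P z}, ‖y.1‖ < ‖z.1‖ ∧ L ξ z.1 < L ξ y.1 ∧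
      ∀ w, w ≠ 0 → L ξ w < L ξ y.1 → ‖z.1‖ ≤ ‖w‖ := by
    rintro ⟨y, hy⟩
    obtain ⟨z, ⟨hz0, hzL⟩, hz⟩ := exists_minimal_point ξ (S := {z | z ≠ 0 ∧ L ξ z < L ξ y})
      (by
        obtain ⟨w, hw, hwL⟩ := happ.exists_L_lt hlam (L_pos hξ hy.1)
        exact ⟨w, hw, hwL⟩)
    refine ⟨⟨z, hz0, fun w hw hwL => ?_⟩, hy.2 z hz0 hzL, hzL, fun w hw hwL => (hz w ⟨hw, hwL⟩).1⟩
    obtain ⟨h1, h2⟩ := hz w ⟨hw, hwL.trans hzL⟩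
    refine lt_of_le_of_ne h1 fun h => ?_
    exact absurd (h2 h.symm) (not_le.2 hwL)
  choose f hf1 hf2 hf3 using hstep
  set s : ℕ → {y // P y} := fun n => f^[n] ⟨y₀, hP₀⟩
  have hs : ∀ n, s (n + 1) = f (s n) := fun n => Function.iterate_succ_apply' f n _
  refine ⟨fun n => (s n).1, fun i _ => (s i).2.1, fun i _ => ?_, fun i _ => ?_,
    fun i _ y hy hyL => ?_⟩
  · rw [hs]; exact hf1 _
  · rw [hs]; exact hf2 _
  · rw [hs]; exact hf3 _ y hy hyL

/-! ### Estimates along a run -/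

/-- The estimates along a run that do not use that `θ² - 1 = θ / φ`. -/
theorem ApproxBound.exists_run_slack (hc : ApproxBound ξ lam c) (hξ : 3 < Module.rank ℚ ℚ⟮ξ⟯)
    (hlam : 0 < lam) (hθ : lam * (1 + θ) = 1) (h1 : 4 / 3 ≤ θ) (h2 : θ ≤ 1.356)
    (hu : θ ^ 2 - 1 ≤ θ / φ) :
    ∃ C : ℝ, ∀ x, IsMinimalSeq ξ x → ∀ g h i j, IsRun x g h i j →
      ((θ - (θ ^ 2 - 1)) - (θ ^ 2 - 1) ^ 2 / θ) * logN x (h + 1) ≤ C ∧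
      |logN x (g + 1) - logN x h| ≤ C ∧ |logN x (h + 1) - logN x i| ≤ C ∧
      |logN x (i + 1) - logN x j| ≤ C ∧ |logN x (h + 1) - θ * logN x h| ≤ C ∧
      |logN x (j + 1) - θ * logN x j| ≤ C ∧
      |logL ξ x g + lam * logN x (g + 1)| ≤ C ∧ |logL ξ x h + lam * logN x (h + 1)| ≤ C ∧
      |logL ξ x i + lam * logN x (i + 1)| ≤ C ∧ |logL ξ x j + lam * logN x (j + 1)| ≤ C ∧
      |(θ ^ 2 - 1) * logN x j - logN x (h + 1)| ≤ C ∧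
      |Real.log (height (U x h)) - (lam * θ * logN x j - lam * logN x (h + 1))| ≤ C := by
  obtain ⟨κ₁, hκ₁⟩ := hc.exists_logN_succ_le hξ hlam hθ (by linarith) (by nlinarith)
  obtain ⟨κ, k1, k2, k3, k4⟩ : ∃ κ : ℝ, κ₁ ≤ κ ∧ Real.log c ≤ κ ∧
      Real.log (16 * powBound ξ) ≤ κ ∧ Real.log (512 * powBound ξ ^ 2) ≤ κ :=
    ⟨max (max κ₁ (Real.log c)) (max (Real.log (16 * powBound ξ)) (Real.log (512 * powBound ξ ^ 2))),
      by simp, by simp, by simp, by simp⟩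
  obtain ⟨C, hC⟩ := run_slack (κ := κ) hlam hθ h1 h2 hu
  refine ⟨max C (max κ 0), fun x hx g h i j ⟨hgh, hhi, hij, hhJ, hiJ⟩ => ?_⟩
  have m1 : C ≤ max C (max κ 0) := le_max_left _ _
  have m2 : κ ≤ max C (max κ 0) := (le_max_left _ _).trans (le_max_right _ _)
  have m3 : 0 ≤ max C (max κ 0) := (le_max_right _ _).trans (le_max_right _ _)
  generalize max C (max κ 0) = C' at m1 m2 m3
  have hg1 : 1 ≤ g := by have := hgh.two_le; omega
  have hh1 : 1 ≤ h := by have := hgh.lt; omega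
  have hi1 : 1 ≤ i := by have := hhi.lt; omega
  have hj1 : 1 ≤ j := by have := hij.lt; omega
  have lg := hc.logL_le hξ hx hg1
  have lh := hc.logL_le hξ hx hh1
  have li := hc.logL_le hξ hx hi1
  have lj := hc.logL_le hξ hx hj1
  have βh := hκ₁ x hx h hhi.1
  have βj := hκ₁ x hx j hij.mem_right
  have mg := hx.logN_le_logN (Nat.le_add_left 1 g) hgh.lt
  have mh := hx.logN_le_logN (Nat.le_add_left 1 h) hhi.lt
  have mi := hx.logN_le_logN (Nat.le_add_left 1 i) hij.lt
  have hb := hx.logN_nonneg (Nat.le_add_left 1 h)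
  have r1 := hx.logN_le_of_mem_J hξ hij hiJ
  have r2 := hx.log_height_le hξ hg1 hhi.1 hgh.W_eq
  have r3 := hx.log_height_le hξ hh1 hij.1 hhi.W_eq
  rw [← U_eq_of_notMem_J hhi hhJ] at r1 r3
  obtain ⟨c1, c2, c3, c4, c5, c6, c7, c8, c9, c10, c11, c12⟩ := hC (Real.log (height (U x h)))
    (logN x (g + 1)) (logL ξ x g) (logN x h) (logN x (h + 1)) (logL ξ x h) (logN x i)
    (logN x (i + 1)) (logL ξ x i) (logN x j) (logN x (j + 1)) (logL ξ x j)
    (by linarith only [r1, k3]) (by linarith only [r2, k4]) (by linarith only [r3, k4])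
    (by linarith only [lg, k2]) (by linarith only [lh, k2]) (by linarith only [li, k2])
    (by linarith only [lj, k2]) (by linarith only [βh, k1]) (by linarith only [βj, k1]) mg mh mi hb
  refine ⟨c1.trans m1, ?_, ?_, ?_, ?_, ?_, ?_, ?_, ?_, ?_, c11.trans m1, c12.trans m1⟩
  · exact abs_le.2 ⟨by linarith only [c2, m1], by linarith only [mg, m3]⟩
  · exact abs_le.2 ⟨by linarith only [c3, m1], by linarith only [mh, m3]⟩
  · exact abs_le.2 ⟨by linarith only [c4, m1], by linarith only [mi, m3]⟩
  · exact abs_le.2 ⟨by linarith only [c5, m1], by linarith only [βh, k1, m2]⟩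
  · exact abs_le.2 ⟨by linarith only [c6, m1], by linarith only [βj, k1, m2]⟩
  · exact abs_le.2 ⟨by linarith only [c7, m1], by linarith only [lg, k2, m2]⟩
  · exact abs_le.2 ⟨by linarith only [c8, m1], by linarith only [lh, k2, m2]⟩
  · exact abs_le.2 ⟨by linarith only [c9, m1], by linarith only [li, k2, m2]⟩
  · exact abs_le.2 ⟨by linarith only [c10, m1], by linarith only [lj, k2, m2]⟩

/-- The estimates along a run in the extremal case `θ² - 1 = θ / φ`. -/
theorem ApproxBound.exists_run_estimates (hc : ApproxBound ξ lam c)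
    (hξ : 3 < Module.rank ℚ ℚ⟮ξ⟯) (hlam : 0 < lam) (hθ : lam * (1 + θ) = 1) (h1 : 4 / 3 ≤ θ)
    (h2 : θ ≤ 1.356) (hu : θ ^ 2 - 1 = θ / φ) :
    ∃ C : ℝ, ∀ x, IsMinimalSeq ξ x → ∀ g h i j, IsRun x g h i j →
      |logN x (g + 1) - logN x h| ≤ C ∧ |logN x (h + 1) - logN x i| ≤ C ∧
      |logN x i - θ * logN x h| ≤ C ∧ |logN x (i + 1) - logN x j| ≤ C ∧
      |logN x j - φ / θ * logN x i| ≤ C ∧ |logN x (j + 1) - θ * logN x j| ≤ C ∧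
      |logL ξ x g - -lam * logN x (g + 1)| ≤ C ∧ |logL ξ x h - -lam * logN x (h + 1)| ≤ C ∧
      |logL ξ x i - -lam * logN x (i + 1)| ≤ C ∧ |logL ξ x j - -lam * logN x (j + 1)| ≤ C ∧
      |Real.log (height (U x h)) - lam / φ * logN x (h + 1)| ≤ C := by
  obtain ⟨C, hC⟩ := hc.exists_run_slack hξ hlam hθ h1 h2 hu.le
  have hθ0 : 0 < θ := by linarith
  have hφ := Real.goldenRatio_pos
  have hφθ : 0 < φ / θ := by positivity
  have hφi : lam / φ = lam * φ - lam := by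
    rw [div_eq_iff hφ.ne']
    linear_combination -lam * Real.goldenRatio_sq
  refine ⟨2 * |C| + 2 * (φ / θ) * |C| + lam * φ * |C|, fun x hx g h i j hr => ?_⟩
  obtain ⟨-, c2, c3, c4, c5, c6, c7, c8, c9, c10, c11, c12⟩ := hC x hx g h i j hr
  have hC0 := abs_nonneg C
  have hC1 := le_abs_self C
  have t1 : 0 ≤ φ / θ * |C| := by positivity
  have t2 : 0 ≤ lam * φ * |C| := by positivity
  have hle : ∀ z : ℝ, z ≤ C → z ≤ 2 * |C| + 2 * (φ / θ) * |C| + lam * φ * |C| := fun z hz => by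
    linarith only [hz, hC0, hC1, t1, t2]
  rw [hu] at c11
  simp only [neg_mul, sub_neg_eq_add]
  refine ⟨hle _ c2, hle _ c3, ?_, hle _ c4, ?_, hle _ c6, hle _ c7, hle _ c8, hle _ c9,
    hle _ c10, ?_⟩
  · rw [abs_le] at c3 c5 ⊢
    constructor
    · linarith only [c3.2, c5.1, hC1, t1, t2]
    · linarith only [c3.1, c5.2, hC1, t1, t2]
  · have e : logN x j - φ / θ * logN x i = φ / θ * ((θ / φ * logN x j - logN x (h + 1)) +
        (logN x (h + 1) - logN x i)) := by
      field_simp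
      ring
    rw [e, abs_mul, abs_of_pos hφθ]
    calc _ ≤ φ / θ * (|C| + |C|) := by
          refine mul_le_mul_of_nonneg_left ((abs_add_le _ _).trans ?_) hφθ.le
          exact add_le_add (c11.trans hC1) (c3.trans hC1)
      _ ≤ _ := by linarith only [hC0, t2]
  · have e : Real.log (height (U x h)) - lam / φ * logN x (h + 1) =
        (Real.log (height (U x h)) - (lam * θ * logN x j - lam * logN x (h + 1))) +
          lam * φ * (θ / φ * logN x j - logN x (h + 1)) := by
      rw [hφi]
      field_simp
      ring
    have h3 : |lam * φ * (θ / φ * logN x j - logN x (h + 1))| ≤ lam * φ * |C| := by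
      rw [abs_mul, abs_of_pos (by positivity : 0 < lam * φ)]
      exact mul_le_mul_of_nonneg_left (c11.trans hC1) (by positivity)
    rw [e]
    refine (abs_add_le _ _).trans ?_
    linarith only [c12, h3, hC0, hC1, t1]

/-- The first element `g` of a run belongs to `J`, and then `X_g` is small, unless the run lies
in a bounded region. -/
theorem ApproxBound.exists_first_estimates (hc : ApproxBound ξ lam c)
    (hξ : 3 < Module.rank ℚ ℚ⟮ξ⟯) (hlam : 0 < lam) (hθ : lam * (1 + θ) = 1) (h1 : 4 / 3 ≤ θ)
    (h2 : θ ≤ 1.356) (hu : θ ^ 2 - 1 = θ / φ) :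
    ∃ C : ℝ, ∀ x, IsMinimalSeq ξ x → ∀ g h i j, IsRun x g h i j →
      (g ∈ J x → logN x g ≤ θ / φ * logN x h + C) ∧ (g ∉ J x → logN x h ≤ C) := by
  obtain ⟨κ, hκ⟩ := hc.exists_logN_succ_le hξ hlam hθ (by linarith) (by nlinarith)
  obtain ⟨C, hC⟩ := hc.exists_run_estimates hξ hlam hθ h1 h2 hu
  have hθ0 : 0 < θ := by linarith
  have hφ := Real.goldenRatio_pos
  have hlam1 : lam ≤ 1 / 2 := by nlinarith
  have e1 : lam * θ = 1 - lam := by linarith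
  have e2 : 1 - lam - lam / θ = lam / φ := by
    have h3 : lam * (θ ^ 2 - 1) / θ = lam / φ := by rw [hu]; field_simp
    rw [← h3]
    field_simp
    linear_combination -θ * e1
  obtain ⟨κ₁, hκ₁⟩ : ∃ κ₁, κ₁ = 2 * Real.log c + Real.log (512 * powBound ξ ^ 2) := ⟨_, rfl⟩
  obtain ⟨C₁, hC₁⟩ : ∃ z, z = (κ₁ + Real.log c + Real.log (16 * powBound ξ) + lam * θ * κ) / lam :=
    ⟨_, rfl⟩
  obtain ⟨C₂, hC₂⟩ : ∃ z, z = (κ₁ + lam / θ * κ + C + lam / φ * (2 * C)) / (lam / φ * (θ - 1)) :=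
    ⟨_, rfl⟩
  refine ⟨max C₁ C₂, fun x hx g h i j hr => ?_⟩
  have hest := hC x hx g h i j hr
  obtain ⟨hgh, hhi, hij, hhJ, hiJ⟩ := hr
  have hg2 := hgh.two_le
  have hh1 : 1 ≤ h := by have := hgh.lt; omega
  have hm : g - 1 + 1 = g := by omega
  have hg1 : 1 ≤ g - 1 := by omega
  have mg := hx.logN_le_logN (Nat.le_add_left 1 g) hgh.lt
  -- the height of `U_g` in terms of the plane `W_g` through the points before `x_g`
  have hH : Real.log (height (U x g)) ≤ (1 - lam) * logN x (g + 1) - lam * logN x g + κ₁ := by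
    have h3 := hx.log_height_le hξ hg1 hgh.1 (by rw [hm])
    have h4 := hc.logL_le hξ hx hg1
    have h5 := hc.logL_le hξ hx (by omega : 1 ≤ g)
    rw [hm] at h3 h4
    linarith
  refine ⟨fun hgJ => ?_, fun hgJ => ?_⟩
  · have h3 := hx.logN_le_of_mem_J hξ hgh hgJ
    have h4 := hc.logL_le hξ hx hh1
    have h5 := mul_le_mul_of_nonneg_left (hκ x hx h hhi.1) (by positivity : 0 ≤ lam * θ)
    have h6 := mul_le_mul_of_nonneg_left mg (by linarith : 0 ≤ 1 - lam)
    have h7 : lam * logN x g ≤ lam * ((θ ^ 2 - 1) * logN x h + C₁) := by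
      have h8 : lam * C₁ = κ₁ + Real.log c + Real.log (16 * powBound ξ) + lam * θ * κ := by
        rw [hC₁]; field_simp
      have h9 : lam * θ * logN x (h + 1) = (1 - lam) * logN x (h + 1) := by rw [e1]
      linarith
    rw [← hu]
    linarith [le_of_mul_le_mul_left h7 hlam, le_max_left C₁ C₂]
  · rw [U_eq_of_notMem_J hgh hgJ] at hH
    obtain ⟨-, c2, c3, -, -, -, -, -, -, -, c10⟩ := hest
    have h3 := (abs_le.1 c10).1
    have h4 := mul_le_mul_of_nonneg_left (hκ x hx g hgh.1) (by positivity : 0 ≤ lam / θ)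
    have h5 := mul_le_mul_of_nonneg_left mg (by positivity : 0 ≤ lam / φ)
    have h6 : θ * logN x h - 2 * C ≤ logN x (h + 1) := by
      linarith [(abs_le.1 c2).1, (abs_le.1 c3).1]
    have h7 := mul_le_mul_of_nonneg_left h6 (by positivity : 0 ≤ lam / φ)
    have h8 : lam / θ * (θ * logN x g + κ) = lam * logN x g + lam / θ * κ := by field_simp
    have h9 : (1 - lam) * logN x (g + 1) = lam / φ * logN x (g + 1) + lam / θ * logN x (g + 1) := by
      rw [← e2]; ring
    have h10 : logN x h ≤ C₂ := by
      rw [hC₂, le_div_iff₀ (mul_pos (by positivity) (by linarith))]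
      linarith
    exact h10.trans (le_max_right _ _)

/-! ### The exponent `λ₃` -/

/-- For `0 < t ≤ 3/7`, the polynomial `T² - φ³ T + φ` changes sign at `λ₃` only. -/
theorem lambda3_sign : lambda3 < 3 / 7 ∧ ∀ t, lambda3 ≤ t → t ≤ 3 / 7 →
    t ^ 2 - φ ^ 3 * t + φ ≤ 0 ∧ (t ^ 2 - φ ^ 3 * t + φ = 0 → t = lambda3) := by
  obtain ⟨⟨h0, hroot⟩, hle⟩ := isLeast_lambda3
  have hφ := Real.goldenRatio_pos
  have hφ2 := Real.goldenRatio_sq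
  have hφ3 : φ ^ 3 = 2 * φ + 1 := by linear_combination (φ + 1) * hφ2
  have hφlt : φ < 1.7 := by nlinarith
  obtain ⟨μ, hμ⟩ : ∃ μ, μ = φ ^ 3 - lambda3 := ⟨_, rfl⟩
  have hprod : lambda3 * μ = φ := by rw [hμ]; linear_combination -hroot
  have hμ0 : 0 < μ := (pos_iff_pos_of_mul_pos (hprod ▸ hφ)).1 h0
  have hfac : ∀ t : ℝ, t ^ 2 - φ ^ 3 * t + φ = (t - lambda3) * (t - μ) := fun t => by
    linear_combination t * hμ - hprod
  have hμle : lambda3 ≤ μ := hle ⟨hμ0, by rw [hfac]; ring⟩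
  have h37 : (3 / 7 - lambda3) * (3 / 7 - μ) < 0 := by
    rw [← hfac, hφ3]; linarith
  have hlt : lambda3 < 3 / 7 := by
    by_contra! h
    linarith [mul_nonneg_of_nonpos_of_nonpos (by linarith : 3 / 7 - lambda3 ≤ 0)
      (by linarith : 3 / 7 - μ ≤ 0)]
  have hμlt : 3 / 7 < μ := by
    by_contra! h
    linarith [mul_nonneg (by linarith : 0 ≤ 3 / 7 - lambda3) (by linarith : 0 ≤ 3 / 7 - μ)]
  refine ⟨hlt, fun t h1 h2 => ⟨?_, fun h => ?_⟩⟩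
  · rw [hfac]
    exact mul_nonpos_of_nonneg_of_nonpos (by linarith) (by linarith)
  · rw [hfac] at h
    rcases mul_eq_zero.1 h with h | h <;> linarith

/-- The relation between the polynomials for `λ` and for `θ`. -/
theorem goldenRatio_mul_sub (hθ : lam * (1 + θ) = 1) :
    φ * (θ ^ 2 - 1) - θ = (1 + θ) ^ 2 * (lam ^ 2 - φ ^ 3 * lam + φ) := by
  have hφ3 : φ ^ 3 = 2 * φ + 1 := by linear_combination (φ + 1) * Real.goldenRatio_sq
  rw [hφ3]
  linear_combination (-(lam * (1 + θ)) - 1 + (2 * φ + 1) * (1 + θ)) * hθ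

/-- The bounds for `θ` if `λ₃ ≤ λ ≤ 3/7`. -/
theorem theta_bounds (hlam : 0 < lam) (hθ : lam * (1 + θ) = 1) (h1 : lambda3 ≤ lam)
    (h2 : lam ≤ 3 / 7) : 4 / 3 ≤ θ ∧ θ ≤ 1.356 ∧ θ ^ 2 - 1 ≤ θ / φ := by
  have hφ := Real.goldenRatio_pos
  have hφ2 := Real.goldenRatio_sq
  have h3 : 4 / 3 ≤ θ := by
    by_contra! h
    nlinarith
  have h4 : φ * (θ ^ 2 - 1) - θ ≤ 0 := by
    rw [goldenRatio_mul_sub hθ]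
    exact mul_nonpos_of_nonneg_of_nonpos (by positivity) (lambda3_sign.2 lam h1 h2).1
  have h5 : φ < 1.61804 := by nlinarith
  have h6 : θ ^ 2 - 1 ≤ θ * (φ - 1) := by
    have : φ * (θ ^ 2 - 1) ≤ φ * (θ * (φ - 1)) := by
      have : φ * (θ * (φ - 1)) = θ := by linear_combination θ * hφ2
      linarith
    exact le_of_mul_le_mul_left this hφ
  refine ⟨h3, ?_, ?_⟩
  · by_contra! h
    nlinarith
  · rw [le_div_iff₀ hφ]; linarith

/-- If `λ₃ ≤ λ ≤ 3/7`, then `λ = λ₃`. -/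
theorem eq_lambda3_of_le (hξ : 3 < Module.rank ℚ ℚ⟮ξ⟯) (hlam : 0 < lam)
    (happ : UniformlyApproximable ξ lam) (hθ : lam * (1 + θ) = 1) (h1 : lambda3 ≤ lam)
    (h2 : lam ≤ 3 / 7) : lam = lambda3 := by
  obtain ⟨t1, t2, t3⟩ := theta_bounds hlam hθ h1 h2
  obtain ⟨c, hc⟩ : ∃ c, ApproxBound ξ lam c := IsMinimalSeq.exists_L_le hlam happ
  obtain ⟨x, hx⟩ := exists_isMinimalSeq hξ hlam happ
  obtain ⟨C, hC⟩ := hc.exists_run_slack hξ hlam hθ t1 t2 t3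
  have hle : (θ - (θ ^ 2 - 1)) - (θ ^ 2 - 1) ^ 2 / θ ≤ 0 := by
    by_contra! hpos
    obtain ⟨N, -, hN⟩ := hx.exists_le_logN (C / ((θ - (θ ^ 2 - 1)) - (θ ^ 2 - 1) ^ 2 / θ) + 1)
    obtain ⟨g, h, i, j, hh, hr⟩ := exists_isRun (hx.infinite_I hξ) (hx.infinite_J hξ)
      (hc.exists_notMem_J hξ hlam hθ t1 t2 hx) N
    have h3 := (hC x hx g h i j hr).1
    rw [← le_div_iff₀' hpos] at h3
    linarith [hN (h + 1) (by omega)]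
  have h3 := eq_div_goldenRatio t1 t3 hle
  refine (lambda3_sign.2 lam h1 h2).2 ?_
  have h4 := goldenRatio_mul_sub (lam := lam) hθ
  rw [h3, mul_div_cancel₀ _ Real.goldenRatio_pos.ne', sub_self] at h4
  exact (mul_eq_zero.1 h4.symm).resolve_left (by positivity)

/-- The number `λ` cannot exceed `λ₃`. -/
theorem eq_lambda3 (hξ : 3 < Module.rank ℚ ℚ⟮ξ⟯) (happ : UniformlyApproximable ξ lam)
    (hge : lambda3 ≤ lam) : lam = lambda3 := by
  have h0 := isLeast_lambda3.1.1
  have h37 := lambda3_sign.1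
  have h1 : lambda3 ≤ min lam (3 / 7) := le_min hge h37.le
  have hpos : 0 < min lam (3 / 7) := h0.trans_le h1
  have h2 := eq_lambda3_of_le hξ hpos (happ.mono (min_le_left _ _))
    (θ := (min lam (3 / 7))⁻¹ - 1) (by field_simp; ring) h1 (min_le_right _ _)
  rcases min_choice lam (3 / 7) with h | h
  · rw [← h, h2]
  · linarith

/-! ### From logarithms to sizes -/

theorem le_mul_of_log_le {a b C K : ℝ} (ha : 0 < a) (hb : 0 < b)
    (h : Real.log a ≤ Real.log b + C) (hK : Real.exp C ≤ K) : a ≤ K * b := by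
  calc a = Real.exp (Real.log a) := (Real.exp_log ha).symm
    _ ≤ Real.exp (Real.log b + C) := Real.exp_le_exp.2 h
    _ = Real.exp C * b := by rw [Real.exp_add, Real.exp_log hb, mul_comm]
    _ ≤ K * b := by gcongr

theorem asymp_of_log {a b C K : ℝ} (ha : 0 < a) (hb : 0 < b)
    (h : |Real.log a - Real.log b| ≤ C) (hK : Real.exp C ≤ K) : Asymp K a b := by
  rw [abs_le] at h
  exact ⟨le_mul_of_log_le ha hb (by linarith) hK, le_mul_of_log_le hb ha (by linarith) hK⟩

theorem asymp_rpow_of_log {a b t C K : ℝ} (ha : 0 < a) (hb : 0 < b)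
    (h : |Real.log a - t * Real.log b| ≤ C) (hK : Real.exp C ≤ K) : Asymp K a (b ^ t) :=
  asymp_of_log ha (Real.rpow_pos_of_pos hb t) (by rwa [Real.log_rpow hb]) hK

end CubicApprox

theorem mainTheorem2 (ξ lam θ : ℝ)
    (hξ : 3 < Module.rank ℚ ℚ⟮ξ⟯)
    (hlam : 0 < lam)
    (happrox : UniformlyApproximable ξ lam)
    (hθ : θ = (1 - lam) / lam)
    (hge : lambda3 ≤ lam) :
    lam = lambda3 ∧
    -- the implied constant and the threshold depend only on `ξ` and `lam`
    ∃ (K : ℝ) (h₀ : ℕ), 0 < K ∧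
      ∀ x : ℕ → Fin 4 → ℤ, IsMinimalSeq ξ x →
        {r : ℕ × ℕ × ℕ × ℕ | IsRun x r.1 r.2.1 r.2.2.1 r.2.2.2}.Infinite ∧
        ∀ g h i j : ℕ, IsRun x g h i j →
          (Asymp K ‖x (g + 1)‖ ‖x h‖ ∧
            Asymp K ‖x (h + 1)‖ ‖x i‖ ∧ Asymp K ‖x i‖ (‖x h‖ ^ θ) ∧
            Asymp K ‖x (i + 1)‖ ‖x j‖ ∧ Asymp K ‖x j‖ (‖x i‖ ^ (φ / θ)) ∧
            Asymp K ‖x (j + 1)‖ (‖x j‖ ^ θ)) ∧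
          (Asymp K (L ξ (x g)) (‖x (g + 1)‖ ^ (-lam)) ∧
            Asymp K (L ξ (x h)) (‖x (h + 1)‖ ^ (-lam)) ∧
            Asymp K (L ξ (x i)) (‖x (i + 1)‖ ^ (-lam)) ∧
            Asymp K (L ξ (x j)) (‖x (j + 1)‖ ^ (-lam))) ∧
          Asymp K (height (U x h)) (‖x (h + 1)‖ ^ (lam / φ)) ∧
          (h₀ ≤ h → g ∈ J x ∧ ‖x g‖ ≤ K * ‖x h‖ ^ (θ / φ)) := by
  have h37 := lambda3_sign.1
  have hlam3 := eq_lambda3 hξ happrox hge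
  have hθ' : lam * (1 + θ) = 1 := by rw [hθ]; field_simp; ring
  obtain ⟨t1, t2, t3⟩ := theta_bounds hlam hθ' hge (by linarith)
  obtain ⟨c, hc⟩ : ∃ c, ApproxBound ξ lam c := IsMinimalSeq.exists_L_le hlam happrox
  have hroot := isLeast_lambda3.1.2
  have hu : θ ^ 2 - 1 = θ / φ := by
    have h4 := goldenRatio_mul_sub hθ'
    rw [hlam3, hroot, mul_zero] at h4
    rw [eq_div_iff Real.goldenRatio_pos.ne']
    linarith
  obtain ⟨C₁, hC₁⟩ := hc.exists_run_estimates hξ hlam hθ' t1 t2 hu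
  obtain ⟨C₂, hC₂⟩ := hc.exists_first_estimates hξ hlam hθ' t1 t2 hu
  have k1 : Real.exp C₁ ≤ max (Real.exp C₁) (Real.exp C₂) := le_max_left _ _
  have k2 : Real.exp C₂ ≤ max (Real.exp C₁) (Real.exp C₂) := le_max_right _ _
  refine ⟨hlam3, max (Real.exp C₁) (Real.exp C₂), ⌈Real.exp C₂⌉₊ + 1,
    lt_max_of_lt_left (Real.exp_pos _), fun x hx => ⟨?_, fun g h i j hr => ?_⟩⟩
  · intro hfin
    obtain ⟨B, hB⟩ := (hfin.image fun r => r.2.1).bddAbove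
    obtain ⟨g, h, i, j, hh, hr⟩ := exists_isRun (hx.infinite_I hξ) (hx.infinite_J hξ)
      (hc.exists_notMem_J hξ hlam hθ' t1 t2 hx) (B + 1)
    have := hB ⟨(g, h, i, j), hr, rfl⟩
    simp only at this
    omega
  obtain ⟨c1, c2, c3, c4, c5, c6, c7, c8, c9, c10, c11⟩ := hC₁ x hx g h i j hr
  obtain ⟨d1, d2⟩ := hC₂ x hx g h i j hr
  obtain ⟨hgh, hhi, hij, -, -⟩ := hr
  have hg1 : 1 ≤ g := by have := hgh.two_le; omega
  have hh1 : 1 ≤ h := by have := hgh.lt; omega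
  have hi1 : 1 ≤ i := by have := hhi.lt; omega
  have hj1 : 1 ≤ j := by have := hij.lt; omega
  have hX : ∀ {k}, 1 ≤ k → 0 < ‖x k‖ := fun hk => hx.norm_pos hk
  have hX' : ∀ k, 0 < ‖x (k + 1)‖ := fun k => hx.norm_pos (Nat.le_add_left 1 k)
  have hL : ∀ {k}, 1 ≤ k → 0 < L ξ (x k) := fun hk => hx.L_pos hξ hk
  refine ⟨⟨asymp_of_log (hX' g) (hX hh1) c1 k1, asymp_of_log (hX' h) (hX hi1) c2 k1,
    asymp_rpow_of_log (hX hi1) (hX hh1) c3 k1, asymp_of_log (hX' i) (hX hj1) c4 k1,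
    asymp_rpow_of_log (hX hj1) (hX hi1) c5 k1, asymp_rpow_of_log (hX' j) (hX hj1) c6 k1⟩,
    ⟨asymp_rpow_of_log (hL hg1) (hX' g) c7 k1, asymp_rpow_of_log (hL hh1) (hX' h) c8 k1,
      asymp_rpow_of_log (hL hi1) (hX' i) c9 k1, asymp_rpow_of_log (hL hj1) (hX' j) c10 k1⟩,
    asymp_rpow_of_log (hx.height_pos hhi.1) (hX' h) c11 k1, fun hh₀ => ?_⟩
  have hgJ : g ∈ J x := by
    by_contra hgJ
    -- `exp C₂ < h ≤ X_h`
    have h3 : Real.exp C₂ < h := (Nat.le_ceil _).trans_lt (by exact_mod_cast hh₀)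
    have h4 := (Real.lt_log_iff_exp_lt (hX hh1)).2 (h3.trans_le (hx.natCast_le_norm hh1))
    exact absurd (d2 hgJ) (not_le.2 h4)
  refine ⟨hgJ, le_mul_of_log_le (hX hg1) (Real.rpow_pos_of_pos (hX hh1) _) ?_ k2⟩
  rw [Real.log_rpow (hX hh1)]
  exact d1 hgJ
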